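/- Let $n\ge 2$ and let $\Omega\subset\mathbf R^n$ be a bounded domain (nonempty, open, connected) with Lipschitz boundary. Let $n(x)$ be the outer unit normal, defined $\sigma$-a.e. on $\partial\Omega$, where $\sigma$ is the $(n-1)$-dimensional Hausdorff measure. Let $\mathbf A=(a_{i,j})$ be a field of symmetric $n\times n$ matrices on $\overline\Omega$ whose entries extend to $C^1$ functions on a neighbourhood of $\overline\Omega$, with $$c_{\mathbf A}\|\xi\|^2\le \xi^T\mathbf A(x)\xi\le C_{\mathbf A}\|\xi\|^2\qquad (x\in\overline\Omega,\ \xi\in\mathbf R^n)$$ for some constants $c_{\mathbf A},C_{\mathbf A}>0$. Put $(\operatorname{div}\mathbf A)_i=\sum_j\partial a_{i,j}/\partial x_j$, $d_{\mathbf A}=\|\operatorname{div}\mathbf A\|_{L^\infty(\Omega)}^2c_{\mathbf A}^{-1}$, $\|y\|_{\mathbf A}=\sqrt{y^T\mathbf A(x)y}$, and $Pu=\sum_{i,j}a_{i,j}\,\partial^2u/\partial x_i\partial x_j$ with weak derivatives. Let $0<B\le\infty$, let $h:(0,B)\to(0,\infty)$ be continuous, let $H'=h$ and $\widetilde H'=H$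 on $(0,B)$, and put $\mathcal G_H=H^2/h$. Let $u\in W^{2,1}_{\rm loc}(\Omega)$ with $u(x)\in(0,B)$ for a.e. $x\in\Omega$, $\widetilde H(u)\in W^{2,1}(\Omega)$ and $Pu\,H(u)\in L^1(\Omega)$. On $\partial\Omega$, each component $w$ of the weak gradient $\nabla(\widetilde H(u))$ is evaluated as $w(x)=\limsup_{r\to0+}\frac1{|\Omega\cap B(x,r)|}\int_{\Omega\cap B(x,r)}w\,dy$. Then: (i) $n(x)$ exists and $\nabla(\widetilde H(u))(x)$ is finite for $\sigma$-a.e. $x\in\partial\Omega$, and $$\int_\Omega\|\nabla u\|_{\mathbf A}^2h(u)\,dx=-\int_\Omega Pu\,H(u)\,dx-\int_\Omega(\operatorname{div}\mathbf A\cdot\nabla u)\,H(u)\,dx+\Theta,\qquad \Theta=\int_{\partial\Omega}n(x)^T\mathbf A(x)\nabla(\widetilde H(u))\,d\sigma(x),$$ where all the integrals converge absolutely. (ii) If $\operatorname{div}\mathbf A\equiv0$ in $\Omega$, then $$\int_\Omega\|\nabla u\|_{\mathbf A}^2h(u)\,dx\le\int_\Omega|Pu||H(u)|\,dx+\Theta,$$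 and in general $$\int_\Omega\|\nabla u\|_{\mathbf A}^2h(u)\,dx\le d_{\mathbf A}\int_\Omega\mathcal G_H(u)\,dx+2\int_\Omega|Pu||H(u)|\,dx+2\Theta,$$ where $\int_\Omega\mathcal G_H(u)\,dx$ may be $+\infty$ (with $0\cdot\infty=0$). -/

import Mathlib

open MeasureTheory Filter Topology Set
open scoped ContDiff ENNReal Matrix

noncomputable section

namespace EllipticIdentity

/-- Euclidean space `ℝⁿ`. -/
abbrev E (n : ℕ) : Type := EuclideanSpace ℝ (Fin n)

variable {n : ℕ}

/-! ### Bounded Lipschitz domains and their outer normal -/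

/-- Near every boundary point, `Ω` is, in suitable Cartesian coordinates, the strict subgraph of a
Lipschitz function: with `e` the unit vector of the last coordinate axis, `⟪e, x⟫` is the last
coordinate of `x` and `x - ⟪e, x⟫ e` is its projection to the hyperplane `e^⊥` of the other
coordinates. (Only the values of `φ` on `e^⊥` matter.) -/
def HasLipschitzBoundary (Ω : Set (E n)) : Prop :=
  ∀ p ∈ frontier Ω, ∃ U : Set (E n), IsOpen U ∧ p ∈ U ∧
    ∃ e : E n, ‖e‖ = 1 ∧ ∃ (K : NNReal) (φ : E n → ℝ), LipschitzWith K φ ∧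
      ∀ x ∈ U, x ∈ Ω ↔ inner ℝ e x < φ (x - (inner ℝ e x : ℝ) • e)

/-- A bounded domain (nonempty, open, connected) with Lipschitz boundary. -/
structure IsBoundedLipschitzDomain (Ω : Set (E n)) : Prop where
  isOpen : IsOpen Ω
  isConnected : IsConnected Ω
  isBounded : Bornology.IsBounded Ω
  lipschitz : HasLipschitzBoundary Ω

/-- `ν` is the outer unit normal to `Ω` at `x`: to first order at `x`, the set `Ω` is the half-space
`{y | ⟪y - x, ν⟫ < 0}`. For a strict subgraph this holds exactly at the points at which the graph
has a tangent hyperplane. -/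
def IsOuterNormal (Ω : Set (E n)) (x ν : E n) : Prop :=
  ‖ν‖ = 1 ∧ ∀ ε > 0, ∃ r > 0, ∀ y ∈ Metric.ball x r,
    (y ∈ Ω → inner ℝ (y - x) ν ≤ ε * ‖y - x‖) ∧ (y ∉ Ω → -(ε * ‖y - x‖) ≤ inner ℝ (y - x) ν)

open Classical in
/-- The outer unit normal to `Ω` at `x` (and `0` where there is none). -/
def outerNormal (Ω : Set (E n)) (x : E n) : E n :=
  if h : ∃ ν, IsOuterNormal Ω x ν then h.choose else 0

/-! ### Weak derivatives and Sobolev spaces -/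

/-- `g` is the weak (distributional) `i`-th partial derivative of `f` on `Ω`. -/
def IsWeakPartial (Ω : Set (E n)) (i : Fin n) (f g : E n → ℝ) : Prop :=
  LocallyIntegrableOn f Ω ∧ LocallyIntegrableOn g Ω ∧
    ∀ φ : E n → ℝ, ContDiff ℝ ∞ φ → HasCompactSupport φ → tsupport φ ⊆ Ω →
      (∫ x in Ω, f x * fderiv ℝ φ x (EuclideanSpace.single i 1)) = -∫ x in Ω, g x * φ x

/-- `f ∈ W^{m,1}(Ω)`. -/
def MemW1 (Ω : Set (E n)) : ℕ → (E n → ℝ) → Prop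
  | 0, f => IntegrableOn f Ω
  | m + 1, f => IntegrableOn f Ω ∧ ∀ i, ∃ g, IsWeakPartial Ω i f g ∧ MemW1 Ω m g

/-- `f ∈ W^{m,1}_loc(Ω)`. -/
def MemW1Loc (Ω : Set (E n)) : ℕ → (E n → ℝ) → Prop
  | 0, f => LocallyIntegrableOn f Ω
  | m + 1, f => LocallyIntegrableOn f Ω ∧ ∀ i, ∃ g, IsWeakPartial Ω i f g ∧ MemW1Loc Ω m g

open Classical in
/-- The weak partial derivative `∂f/∂xᵢ` on `Ω` (unique up to null sets; `0` if it does not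
exist). -/
def weakPartial (Ω : Set (E n)) (i : Fin n) (f : E n → ℝ) : E n → ℝ :=
  if h : ∃ g, IsWeakPartial Ω i f g then h.choose else 0

/-- The weak gradient. -/
def weakGrad (Ω : Set (E n)) (f : E n → ℝ) (x : E n) : E n :=
  WithLp.toLp 2 fun i => weakPartial Ω i f x

/-- The value at `x` of the canonical representative of `w`,
`limsup_{r → 0+} |Ω ∩ B(x,r)|⁻¹ ∫_{Ω ∩ B(x,r)} w`, an extended real number; on `∂Ω` this is the
trace of `w`. -/
def canonicalValue (Ω : Set (E n)) (w : E n → ℝ) (x : E n) : EReal :=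
  limsup (fun r : ℝ => ((⨍ y in Ω ∩ Metric.ball x r, w y : ℝ) : EReal)) (𝓝[>] 0)

/-- The weak gradient, evaluated pointwise (in particular on `∂Ω`) through the canonical
representatives of its components. -/
def traceGrad (Ω : Set (E n)) (f : E n → ℝ) (x : E n) : E n :=
  WithLp.toLp 2 fun i => (canonicalValue Ω (weakPartial Ω i f) x).toReal

/-! ### The elliptic operator -/

/-- `g ∈ C¹(closure Ω)`: `g` agrees on `closure Ω` with a `C¹` function on an open neighbourhood of
`closure Ω`. -/
def IsC1UpToBoundary (Ω : Set (E n)) (g : E n → ℝ) : Prop :=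
  ∃ U : Set (E n), IsOpen U ∧ closure Ω ⊆ U ∧
    ∃ g' : E n → ℝ, ContDiffOn ℝ 1 g' U ∧ EqOn g g' (closure Ω)

/-- The matrix field `A` is symmetric with coefficients in `C¹(closure Ω)`, and
`c ‖ξ‖² ≤ ξᵀ A(x) ξ ≤ C ‖ξ‖²` on `closure Ω`. -/
structure IsUniformlyElliptic (Ω : Set (E n)) (A : E n → Matrix (Fin n) (Fin n) ℝ) (c C : ℝ) :
    Prop where
  c_pos : 0 < c
  C_pos : 0 < C
  symm : ∀ x ∈ closure Ω, (A x).IsSymm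
  c1 : ∀ i j, IsC1UpToBoundary Ω fun x => A x i j
  lower : ∀ x ∈ closure Ω, ∀ ξ : E n, c * ‖ξ‖ ^ 2 ≤ ξ.ofLp ⬝ᵥ (A x *ᵥ ξ.ofLp)
  upper : ∀ x ∈ closure Ω, ∀ ξ : E n, ξ.ofLp ⬝ᵥ (A x *ᵥ ξ.ofLp) ≤ C * ‖ξ‖ ^ 2

/-- `P u = ∑ᵢⱼ aᵢⱼ ∂²u/∂xᵢ∂xⱼ`. -/
def ellipticOp (Ω : Set (E n)) (A : E n → Matrix (Fin n) (Fin n) ℝ) (u : E n → ℝ) (x : E n) : ℝ :=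
  ∑ i, ∑ j, A x i j * weakPartial Ω i (weakPartial Ω j u) x

/-- The row-wise divergence of a matrix field: `(div A)ᵢ = ∑ⱼ ∂aᵢⱼ/∂xⱼ`. -/
def matDiv (A : E n → Matrix (Fin n) (Fin n) ℝ) (x : E n) : E n :=
  WithLp.toLp 2 fun i => ∑ j, fderiv ℝ (fun y => A y i j) x (EuclideanSpace.single j 1)

/-- `‖y‖_M = √(yᵀ M y)`. -/
def matNorm (M : Matrix (Fin n) (Fin n) ℝ) (y : E n) : ℝ :=
  √(y.ofLp ⬝ᵥ (M *ᵥ y.ofLp))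

/-- `d_A = ‖div A‖²_{L^∞(Ω)} / c`. -/
def dConst (Ω : Set (E n)) (A : E n → Matrix (Fin n) (Fin n) ℝ) (c : ℝ) : ℝ :=
  (eLpNorm (matDiv A) ∞ (volume.restrict Ω)).toReal ^ 2 * c⁻¹

/-- At the boundary point `x`, the outer normal exists and `∇w(x)` is finite, so that
`n(x)ᵀ A(x) ∇w(x)` is meaningful. -/
def ConormalDefinedAt (Ω : Set (E n)) (w : E n → ℝ) (x : E n) : Prop :=
  (∃ ν, IsOuterNormal Ω x ν) ∧
    ∀ i, canonicalValue Ω (weakPartial Ω i w) x ≠ ⊤ ∧ canonicalValue Ω (weakPartial Ω i w) x ≠ ⊥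

/-- `n(x)ᵀ A(x) ∇w(x)`, for `x ∈ ∂Ω`. -/
def conormalDeriv (Ω : Set (E n)) (A : E n → Matrix (Fin n) (Fin n) ℝ) (w : E n → ℝ) (x : E n) :
    ℝ :=
  (outerNormal Ω x).ofLp ⬝ᵥ (A x *ᵥ (traceGrad Ω w x).ofLp)

/-- `∫_{∂Ω} n(x)ᵀ A(x) ∇w(x) dσ(x)`, where `σ` is the `(n-1)`-dimensional Hausdorff measure
(normalized to be the Lebesgue measure on hyperplanes). -/
def boundaryTerm (Ω : Set (E n)) (A : E n → Matrix (Fin n) (Fin n) ℝ) (w : E n → ℝ) : ℝ :=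
  ∫ x in frontier Ω, conormalDeriv Ω A w x ∂μHE[n - 1]

/-! ### The weight -/

/-- The interval `(0, B)`, where `B` may be `∞`. -/
def openInterval (B : EReal) : Set ℝ := {s | 0 < s ∧ (s : EReal) < B}

/-- `G_H = H² / h`. -/
def gTransform (h H : ℝ → ℝ) (s : ℝ) : ℝ := H s ^ 2 / h s

end EllipticIdentity

end

open EllipticIdentity

noncomputable section

namespace EllipticIdentity

/-! Put `w = Ht(u)`, which lies in `W^{2,1}(Ω)`. The chain rule gives `∇w = H(u) ∇u` and `∂ᵢⱼw =
h(u) ∂ᵢu ∂ⱼu + H(u) ∂ᵢⱼu`; contracting with `A` yields `‖∇u‖_A² h(u) = ∑ aᵢⱼ ∂ᵢⱼw - Pu H(u)` almost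
everywhere. The right side is integrable, hence so is the left, and the divergence theorem for the
field `A ∇w`, whose divergence is `∑ aᵢⱼ ∂ᵢⱼw + div A · ∇w`, gives the identity. For the general
inequality, ellipticity and Young's inequality bound `2 |div A · ∇u H(u)|` by `‖∇u‖_A² h(u) + d_A
G_H(u)`. The identity is doubled and one copy of its finite left side is absorbed.

The chain rule is `ae_weakPartial_comp`. The weak derivative of the composite is known to exist and
only has to be identified, so no bounds on `h` or `H` are needed. After a cutoff, a difference
quotient is the average of the weak derivative over a segment. It therefore converges in `L¹`, and
almost everywhere along a subsequence. Along a common sequence of steps, classical differentiability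
of the outer function at a single point gives the limit.

The divergence theorem is `IsBoundedLipschitzDomain.integral_weakDir`. In a chart, `Ω` is the strict
subgraph of a Lipschitz function `ψ`. A compactly supported `f` with vertical weak derivative `g` is
the integral of `g` along the vertical line from below (`WeakDir.ae_eq_integral`), so its natural
boundary value `T y` is the integral of `g` over the whole line under the graph. At Lebesgue points
the averages of `|f - T y|` over `Ω ∩ B(x, r)` tend to zero (`Frame.exists_trace`), and Fubini's
theorem gives `∫ T = ∫ g`. By the area formula (`Frame.measure_graph_image`), surface measure has
density `√(1 + |∇ψ|²)`; the vertical component of the normal is its reciprocal, so `∫ T` is the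
boundary integral of `f ν·e`. Other directions follow because a Lipschitz subgraph stays one when
its axis is tilted slightly, and any vector is a combination of the axis and a tilted one
(`Frame.exists_subgraph_eq`). A partition of unity makes the result global. -/

section

/-! ### Orthogonal coordinates adapted to a unit vector -/

/-- Cartesian coordinates `x = ι y + t e` on `ℝᵐ⁺¹`, with `ι` an isometry onto `e^⊥`. -/
structure Frame (m : ℕ) where
  ι : E m →ₗᵢ[ℝ] E (m + 1)
  pr : E (m + 1) →L[ℝ] E m
  e : E (m + 1)
  norm_e : ‖e‖ = 1
  inner_e_ι : ∀ y, inner ℝ e (ι y) = 0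
  pr_ι : ∀ y, pr (ι y) = y
  pr_e : pr e = 0
  decomp : ∀ x, ι (pr x) + (inner ℝ e x : ℝ) • e = x
  measurePreserving : MeasurePreserving fun p : E m × ℝ => ι p.1 + p.2 • e

/-- Complete `e` to an orthonormal basis: the other vectors span `e^⊥`, and in the basis coordinates
the map `(y, t) ↦ ι y + t e` merely inserts `t` in position zero. -/
theorem exists_frame {m : ℕ} (e : E (m + 1)) (he : ‖e‖ = 1) : ∃ F : Frame m, F.e = e := by
  obtain ⟨b, hb⟩ : ∃ b : OrthonormalBasis (Fin (m + 1)) ℝ (E (m + 1)), b 0 = e := by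
    have h1 : Orthonormal ℝ (({0} : Set (Fin (m + 1))).domRestrict fun _ => e) := by
      constructor
      · intro i; simpa using he
      · intro i j hij
        exact absurd (Subsingleton.elim i j) hij
    obtain ⟨b, hb⟩ := h1.exists_orthonormalBasis_extension_of_card_eq (by simp)
    exact ⟨b, hb 0 rfl⟩
  let c : E m →ₗ[ℝ] E (m + 1) :=
    { toFun := fun y => WithLp.toLp 2 (Fin.cons 0 y.ofLp : Fin (m + 1) → ℝ)
      map_add' := by
        intro x y; ext i; refine Fin.cases ?_ (fun i => ?_) i <;> simp
      map_smul' := by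
        intro x y; ext i; refine Fin.cases ?_ (fun i => ?_) i <;> simp }
  let c' : E m →ₗᵢ[ℝ] E (m + 1) :=
    { toLinearMap := c
      norm_map' := by
        intro y
        simp [c, EuclideanSpace.norm_eq, Fin.sum_univ_succ] }
  let q : E (m + 1) →ₗ[ℝ] E m :=
    { toFun := fun x => WithLp.toLp 2 (fun i => x i.succ)
      map_add' := by intro x y; ext i; simp
      map_smul' := by intro x y; ext i; simp }
  have he' : b.repr e = EuclideanSpace.single 0 1 := by rw [← hb]; simp
  have hinner : ∀ x, inner ℝ e x = b.repr x 0 := by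
    intro x; rw [b.repr_apply_apply, hb]
  have hcomb : ∀ (y : E m) (t : ℝ), b.repr.symm (c' y) + t • e =
      b.repr.symm (WithLp.toLp 2 (Fin.cons t y.ofLp : Fin (m + 1) → ℝ)) := by
    intro y t
    apply b.repr.injective
    rw [map_add, map_smul, he']
    ext i
    refine Fin.cases ?_ (fun i => ?_) i <;> simp [c', c]
  refine ⟨⟨b.repr.symm.toLinearIsometry.comp c',
    (LinearMap.toContinuousLinearMap q).comp (b.repr.toContinuousLinearEquiv : _ →L[ℝ] _),
    e, he, ?_, ?_, ?_, ?_, ?_⟩, rfl⟩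
  · intro y
    rw [hinner]; simp [c', c]
  · intro y
    ext i; simp [q, c', c]
  · simp only [ContinuousLinearMap.coe_comp, Function.comp_apply]
    ext i
    simp [q, he']
  · intro x
    have := hcomb (q (b.repr x)) (inner ℝ e x)
    refine this.trans ?_
    apply b.repr.injective
    ext i
    refine Fin.cases ?_ (fun i => ?_) i
    · simp [hinner]
    · simp [q]
  -- A composition of volume-preserving maps: swap the factors, insert a coordinate, pass to the
  -- Euclidean norm, apply an isometry.
  · have h1 : MeasurePreserving (fun p : E m × ℝ => (p.2, p.1.ofLp)) :=
      (Measure.measurePreserving_swap (μ := (volume : Measure (Fin m → ℝ)))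
        (ν := (volume : Measure ℝ))).comp
        ((EuclideanSpace.volume_preserving_symm_measurableEquiv_toLp (Fin m)).prod
          (MeasurePreserving.id volume))
    have h2 := (volume_preserving_piFinSuccAbove (fun _ : Fin (m + 1) => ℝ) 0).symm _
    have h3 := PiLp.volume_preserving_toLp (Fin (m + 1))
    have h4 := b.repr.symm.measurePreserving
    have h5 := h4.comp (h3.comp (h2.comp h1))
    refine (MeasurePreserving.congr h5 ?_ (ae_of_all _ fun p => ?_))
    · fun_prop
    · simp only [Function.comp_apply]
      rw [MeasurableEquiv.piFinSuccAbove_symm_apply, Fin.insertNthEquiv_zero]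
      exact (hcomb p.1 p.2).symm

namespace Frame

variable {m : ℕ} (F : Frame m)

/-- The point with coordinates `(y, t)`. -/
def coord (p : E m × ℝ) : E (m + 1) := F.ι p.1 + p.2 • F.e

theorem measurePreserving_coord : MeasurePreserving F.coord := F.measurePreserving

@[fun_prop]
theorem continuous_coord : Continuous F.coord := by
  unfold coord
  fun_prop

theorem pr_coord (y : E m) (t : ℝ) : F.pr (F.coord (y, t)) = y := by
  simp [coord, F.pr_ι, F.pr_e]

theorem inner_coord (y : E m) (t : ℝ) : inner ℝ F.e (F.coord (y, t)) = t := by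
  simp [coord, F.inner_e_ι, inner_add_right, inner_smul_right, F.norm_e]

theorem coord_pr (x : E (m + 1)) : F.coord (F.pr x, inner ℝ F.e x) = x := F.decomp x

/-- `coord` as a homeomorphism. -/
def homeo : E m × ℝ ≃ₜ E (m + 1) where
  toFun := F.coord
  invFun x := (F.pr x, inner ℝ F.e x)
  left_inv p := Prod.ext (F.pr_coord p.1 p.2) (F.inner_coord p.1 p.2)
  right_inv x := F.coord_pr x
  continuous_toFun := F.continuous_coord
  continuous_invFun := by fun_prop

theorem measurableEmbedding_coord : MeasurableEmbedding F.coord :=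
  F.homeo.measurableEmbedding

theorem coord_sub (y z : E m) (s t : ℝ) :
    F.coord (y, s) - F.coord (z, t) = F.coord (y - z, s - t) := by
  simp only [coord, map_sub, sub_smul]; abel

theorem coord_add_smul (y : E m) (s t : ℝ) :
    F.coord (y, s) + t • F.e = F.coord (y, s + t) := by
  simp only [coord, add_smul]; abel

theorem coord_sub_smul (y : E m) (s t : ℝ) :
    F.coord (y, s) - t • F.e = F.coord (y, s - t) := by
  simp only [coord, sub_smul]; abel

theorem norm_coord_sq (y : E m) (t : ℝ) : ‖F.coord (y, t)‖ ^ 2 = ‖y‖ ^ 2 + t ^ 2 := by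
  simp only [coord]
  rw [norm_add_sq_real, real_inner_comm, inner_smul_left, F.inner_e_ι, F.ι.norm_map, norm_smul,
    F.norm_e]
  simp

theorem norm_coord_le (y : E m) (t : ℝ) : ‖F.coord (y, t)‖ ≤ ‖y‖ + |t| := by
  refine (norm_add_le _ _).trans ?_
  simp [norm_smul, F.norm_e]

theorem norm_le_norm_coord (y : E m) (t : ℝ) : ‖y‖ ≤ ‖F.coord (y, t)‖ := by
  rw [← abs_of_nonneg (norm_nonneg y), ← abs_of_nonneg (norm_nonneg (F.coord (y, t))),
    ← sq_le_sq, norm_coord_sq]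
  nlinarith

theorem abs_le_norm_coord (y : E m) (t : ℝ) : |t| ≤ ‖F.coord (y, t)‖ := by
  rw [← abs_of_nonneg (norm_nonneg (F.coord (y, t))), ← sq_le_sq, norm_coord_sq]
  nlinarith [sq_nonneg ‖y‖]

theorem norm_pr_le (x : E (m + 1)) : ‖F.pr x‖ ≤ ‖x‖ := by
  conv_rhs => rw [← F.coord_pr x]
  exact F.norm_le_norm_coord _ _

/-- The parametrization of the graph of `ψ`. -/
def graph (ψ : E m → ℝ) (y : E m) : E (m + 1) := F.coord (y, ψ y)

/-- The strict subgraph of `ψ`. -/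
def subgraph (ψ : E m → ℝ) : Set (E (m + 1)) := {x | inner ℝ F.e x < ψ (F.pr x)}

variable {F} {ψ : E m → ℝ}

theorem coord_mem_subgraph {y : E m} {t : ℝ} : F.coord (y, t) ∈ F.subgraph ψ ↔ t < ψ y := by
  simp [subgraph, pr_coord, inner_coord]

theorem isOpen_subgraph (hψ : Continuous ψ) : IsOpen (F.subgraph ψ) :=
  isOpen_lt (by fun_prop) (by fun_prop)

theorem continuous_graph (hψ : Continuous ψ) : Continuous (F.graph ψ) := by
  unfold graph; fun_prop

theorem pr_graph (y : E m) : F.pr (F.graph ψ y) = y := F.pr_coord _ _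

theorem graph_injective : Function.Injective (F.graph ψ) := fun y z h => by
  rw [← F.pr_graph (ψ := ψ) y, h, pr_graph]

theorem measurableEmbedding_graph (hψ : Continuous ψ) : MeasurableEmbedding (F.graph ψ) :=
  (continuous_graph hψ).measurableEmbedding graph_injective

theorem mem_range_graph {x : E (m + 1)} :
    x ∈ range (F.graph ψ) ↔ inner ℝ F.e x = ψ (F.pr x) := by
  constructor
  · rintro ⟨y, rfl⟩
    rw [pr_graph, graph, inner_coord]
  · intro h
    exact ⟨F.pr x, by rw [graph, ← h, coord_pr]⟩

theorem frontier_subgraph (hψ : Continuous ψ) : frontier (F.subgraph ψ) = range (F.graph ψ) := by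
  ext x
  rw [mem_range_graph]
  constructor
  · exact fun h => frontier_lt_subset_eq (by fun_prop) (by fun_prop) h
  · intro h
    rw [(isOpen_subgraph hψ).frontier_eq]
    refine ⟨?_, fun hx => (ne_of_lt hx) h⟩
    -- The part of the vertical line strictly below `x` lies in the subgraph and accumulates at `x`.
    have hc : Continuous fun t : ℝ => F.coord (F.pr x, t) := by fun_prop
    have h1 : Tendsto (fun t : ℝ => F.coord (F.pr x, t)) (𝓝[<] (inner ℝ F.e x)) (𝓝 x) := by
      have := (hc.tendsto (inner ℝ F.e x)).mono_left (nhdsWithin_le_nhds (s := Iio (inner ℝ F.e x)))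
      rwa [coord_pr] at this
    refine mem_closure_of_tendsto h1 ?_
    filter_upwards [self_mem_nhdsWithin] with t ht
    rw [coord_mem_subgraph, ← h]; exact ht

end Frame

end

section

/-! ### The area formula for Lipschitz graphs -/

/-- On `s`, points identified by `g` are identified by `f`. Hence `f` factors through `g`, and the
factor `g '' s → f '' s` is `K`-Lipschitz; injectivity is not required. -/
theorem euclideanHausdorffMeasure_image_le_image {X Y Z : Type*} [Nonempty X]
    [MetricSpace Y] [MeasurableSpace Y] [BorelSpace Y]
    [MetricSpace Z] [MeasurableSpace Z] [BorelSpace Z] {f : X → Y} {g : X → Z} {s : Set X}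
    {K : NNReal} (h : ∀ x ∈ s, ∀ y ∈ s, dist (f x) (f y) ≤ K * dist (g x) (g y)) (d : ℕ) :
    (μHE[d] : Measure Y) (f '' s) ≤ (K : ℝ≥0∞) ^ d * (μHE[d] : Measure Z) (g '' s) := by
  have hinv : ∀ x ∈ s, Function.invFunOn g s (g x) ∈ s ∧ g (Function.invFunOn g s (g x)) = g x :=
    fun x hx => ⟨Function.invFunOn_mem ⟨x, hx, rfl⟩, Function.invFunOn_eq ⟨x, hx, rfl⟩⟩
  have himg : f '' s = (f ∘ Function.invFunOn g s) '' (g '' s) := by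
    rw [image_image]
    refine image_congr fun x hx => ?_
    have := h x hx _ (hinv x hx).1
    rw [(hinv x hx).2, dist_self, mul_zero] at this
    exact dist_le_zero.1 this
  have hL : LipschitzOnWith K (f ∘ Function.invFunOn g s) (g '' s) := by
    refine LipschitzOnWith.of_dist_le_mul ?_
    rintro _ ⟨x, hx, rfl⟩ _ ⟨y, hy, rfl⟩
    have := h _ (hinv x hx).1 _ (hinv y hy).1
    rwa [(hinv x hx).2, (hinv y hy).2] at this
  have := hL.hausdorffMeasure_image_le (d := d) (by positivity)
  rw [← himg, ENNReal.rpow_natCast] at this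
  simp only [Measure.euclideanHausdorffMeasure_def, Measure.smul_apply,
    Measure.nnreal_smul_coe_apply]
  calc _ ≤ _ := mul_le_mul_right this _
    _ = _ := by ring

variable {m : ℕ}

/-- The Jacobian of `y ↦ (y, ψ y)` at a point where `ψ` has derivative `A`. -/
def graphJac (A : E m →L[ℝ] ℝ) : ℝ := √(1 + ‖A‖ ^ 2)

theorem one_le_graphJac (A : E m →L[ℝ] ℝ) : 1 ≤ graphJac A :=
  Real.one_le_sqrt.2 (by nlinarith [sq_nonneg ‖A‖])

theorem graphJac_pos (A : E m →L[ℝ] ℝ) : 0 < graphJac A := one_pos.trans_le (one_le_graphJac A)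

theorem graphJac_sq (A : E m →L[ℝ] ℝ) : graphJac A ^ 2 = 1 + ‖A‖ ^ 2 :=
  Real.sq_sqrt (by positivity)

/-- The Jacobian is at least 1, so an additive error in the derivative costs only a multiplicative
factor. -/
theorem graphJac_le {A B : E m →L[ℝ] ℝ} {ε : ℝ} (h : ‖A - B‖ ≤ ε) :
    graphJac A ≤ (1 + ε) * graphJac B := by
  have hε : 0 ≤ ε := (norm_nonneg _).trans h
  have h1 : ‖A‖ ≤ ‖B‖ + ε := by
    have := norm_sub_norm_le A B
    linarith
  have h2 := graphJac_sq B
  have h3 := one_le_graphJac B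
  refine Real.sqrt_le_iff.2 ⟨by positivity, ?_⟩
  rw [mul_pow, h2]
  nlinarith [norm_nonneg A, norm_nonneg B, mul_nonneg hε (sq_nonneg (‖B‖ - 1)),
    mul_nonneg hε (sq_nonneg ‖B‖), sq_nonneg (ε * ‖B‖), mul_self_le_mul_self (norm_nonneg A) h1]

/-- The positive endomorphism whose square is `1 + AᵀA` -/
theorem exists_stretch (A : E m →L[ℝ] ℝ) : ∃ D : E m →ₗ[ℝ] E m,
    (∀ y, ‖D y‖ ^ 2 = ‖y‖ ^ 2 + (A y) ^ 2) ∧ |LinearMap.det D| = graphJac A := by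
  set a : E m := (InnerProductSpace.toDual ℝ (E m)).symm A with ha
  have hAa : ∀ y, A y = inner ℝ a y := fun y => by
    rw [ha, InnerProductSpace.toDual_symm_apply]
  have hna : ‖A‖ = ‖a‖ := by rw [ha, LinearIsometryEquiv.norm_map]
  set J := graphJac A with hJ
  have hJpos : 0 < J := graphJac_pos A
  have hJ2 : J ^ 2 = 1 + ‖a‖ ^ 2 := by rw [hJ, graphJac_sq, hna]
  have haA : A a = ‖a‖ ^ 2 := by rw [hAa, real_inner_self_eq_norm_sq]
  -- For `y ↦ y + k A(y) a` the norm condition reads `2k + k²‖a‖² = 1`. As `‖a‖² = J² - 1`, the root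
  -- is `k = 1/(J + 1)`, and the determinant `1 + k‖a‖²` is then `J`.
  refine ⟨LinearMap.transvection (A : E m →ₗ[ℝ] ℝ) ((1 / (J + 1)) • a), fun y => ?_, ?_⟩
  · rw [LinearMap.transvection.apply, norm_add_sq_real]
    simp only [ContinuousLinearMap.coe_coe, smul_smul, inner_smul_right, norm_smul, mul_pow,
      Real.norm_eq_abs, sq_abs]
    rw [real_inner_comm, ← hAa]
    have : ‖a‖ ^ 2 = (J - 1) * (J + 1) := by linarith
    rw [this]
    field_simp
    ring
  · rw [LinearMap.transvection.det]
    simp only [ContinuousLinearMap.coe_coe, map_smul, haA, smul_eq_mul]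
    have : 1 + 1 / (J + 1) * ‖a‖ ^ 2 = J := by
      have : ‖a‖ ^ 2 = (J - 1) * (J + 1) := by linarith
      rw [this]; field_simp; ring
    rw [this, abs_of_pos hJpos]

namespace Frame

variable {F : Frame m} {ψ : E m → ℝ}

/-- `D` induces the same distances as the linear graph map `y ↦ (y, A y)`. On `s` these differ from
distances in the graph of `ψ` by at most `ε‖y - z‖`, which is at most `ε` times either distance; so
each is within a factor `1 + ε` of the other. The volume of `D '' s` is read off the determinant. -/
theorem measure_graph_image_of_approximatesLinearOn {A : E m →L[ℝ] ℝ} {s : Set (E m)}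
    {ε : NNReal} (h : ApproximatesLinearOn ψ A s ε) :
    (μHE[m] : Measure (E (m + 1))) (F.graph ψ '' s) ≤
        ((1 + ε : NNReal) : ℝ≥0∞) ^ m * (ENNReal.ofReal (graphJac A) * volume s) ∧
      ENNReal.ofReal (graphJac A) * volume s ≤
        ((1 + ε : NNReal) : ℝ≥0∞) ^ m * (μHE[m] : Measure (E (m + 1))) (F.graph ψ '' s) := by
  obtain ⟨D, hD, hdet⟩ := exists_stretch A
  have hvol : ENNReal.ofReal (graphJac A) * volume s = (μHE[m] : Measure (E m)) (D '' s) := by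
    rw [EuclideanSpace.euclideanHausdorffMeasure_eq_volume, Measure.addHaar_image_linearMap, hdet]
  have hDc : ∀ y z, dist (D y) (D z) = ‖F.coord (y - z, A (y - z))‖ := fun y z => by
    rw [dist_eq_norm, ← map_sub, ← sq_eq_sq₀ (norm_nonneg _) (norm_nonneg _), hD, norm_coord_sq]
  have hγc : ∀ y z, dist (F.graph ψ y) (F.graph ψ z) = ‖F.coord (y - z, ψ y - ψ z)‖ :=
    fun y z => by rw [dist_eq_norm, graph, graph, coord_sub]
  have hdiff : ∀ y ∈ s, ∀ z ∈ s,
      ‖F.coord (y - z, ψ y - ψ z) - F.coord (y - z, A (y - z))‖ ≤ ε * ‖y - z‖ := by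
    intro y hy z hz
    rw [coord_sub]
    refine (F.norm_coord_le _ _).trans ?_
    simpa using h y hy z hz
  rw [hvol]
  constructor
  · refine euclideanHausdorffMeasure_image_le_image (fun y hy z hz => ?_) m
    rw [hDc, hγc]
    have h1 := hdiff y hy z hz
    have h2 := norm_sub_norm_le (F.coord (y - z, ψ y - ψ z)) (F.coord (y - z, A (y - z)))
    have h3 := mul_le_mul_of_nonneg_left (F.norm_le_norm_coord (y - z) (A (y - z))) ε.coe_nonneg
    push_cast
    linarith
  · refine euclideanHausdorffMeasure_image_le_image (fun y hy z hz => ?_) m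
    rw [hDc, hγc]
    have h1 := hdiff y hy z hz
    rw [norm_sub_rev] at h1
    have h2 := norm_sub_norm_le (F.coord (y - z, A (y - z))) (F.coord (y - z, ψ y - ψ z))
    have h3 := mul_le_mul_of_nonneg_left (F.norm_le_norm_coord (y - z) (ψ y - ψ z)) ε.coe_nonneg
    push_cast
    linarith

theorem measure_graph_image_eq_zero {K : NNReal} (hψ : LipschitzWith K ψ) {s : Set (E m)}
    (hs : volume s = 0) : (μHE[m] : Measure (E (m + 1))) (F.graph ψ '' s) = 0 := by
  -- A Lipschitz function approximates the zero map with error `K`, which is good enough for null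
  -- sets.
  have h : ApproximatesLinearOn ψ (0 : E m →L[ℝ] ℝ) s K := by
    intro y _ z _
    simpa [dist_eq_norm] using hψ.dist_le_mul y z
  have := (measure_graph_image_of_approximatesLinearOn (F := F) h).1
  rw [hs, mul_zero, mul_zero] at this
  exact le_antisymm this zero_le

theorem measurable_graphJac_fderiv (ψ : E m → ℝ) :
    Measurable fun y => graphJac (fderiv ℝ ψ y) := by
  unfold graphJac
  have := measurable_fderiv ℝ ψ
  fun_prop

theorem ae_norm_fderiv_sub_le (hm : 0 < m) {A : E m →L[ℝ] ℝ} {s : Set (E m)} {ε : NNReal}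
    (h : ApproximatesLinearOn ψ A s ε) (hs : MeasurableSet s)
    (hd : ∀ y ∈ s, DifferentiableAt ℝ ψ y) :
    ∀ᵐ y ∂volume.restrict s, ‖fderiv ℝ ψ y - A‖ ≤ ε := by
  -- `ApproximatesLinearOn.norm_fderiv_sub_le` concerns maps of a space to itself, so `ψ` is
  -- multiplied by a fixed unit vector; this requires `0 < m`.
  let b : E m := EuclideanSpace.single ⟨0, hm⟩ 1
  have hb : ‖b‖ = 1 := by simp [b]
  have h1 : ApproximatesLinearOn (fun y => ψ y • b) (A.smulRight b) s ε := by
    intro y hy z hz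
    have := h y hy z hz
    simp only [ContinuousLinearMap.smulRight_apply, ← sub_smul, norm_smul, hb, mul_one]
    exact this
  have h2 := h1.norm_fderiv_sub_le volume hs (fun y => (fderiv ℝ ψ y).smulRight b)
    (fun y hy => ((hd y hy).hasFDerivAt.smul_const b).hasFDerivWithinAt)
  filter_upwards [h2] with y hy
  have h3 : ‖((fderiv ℝ ψ y).smulRight b) - A.smulRight b‖ = ‖fderiv ℝ ψ y - A‖ := by
    have : ((fderiv ℝ ψ y).smulRight b) - A.smulRight b = (fderiv ℝ ψ y - A).smulRight b := by
      ext; simp [sub_mul]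
    rw [this, ContinuousLinearMap.norm_smulRight_apply, hb, mul_one]
  rw [← h3]
  exact_mod_cast hy

/-- Differentiability splits `s` into countably many pieces on which `ψ` is `ε`-close to a linear
map. Of the `m + 1` factors, `m` come from comparing measures on a piece and one from replacing the
Jacobian of `A k` by that of `fderiv ℝ ψ`. -/
theorem measure_graph_image_approx (hm : 0 < m) (hψ : Continuous ψ) {s : Set (E m)}
    (hs : MeasurableSet s) (hd : ∀ y ∈ s, DifferentiableAt ℝ ψ y) {ε : NNReal} (hε : 0 < ε) :
    (μHE[m] : Measure (E (m + 1))) (F.graph ψ '' s) ≤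
        ((1 + ε : NNReal) : ℝ≥0∞) ^ (m + 1) *
          ∫⁻ y in s, ENNReal.ofReal (graphJac (fderiv ℝ ψ y)) ∧
      ∫⁻ y in s, ENNReal.ofReal (graphJac (fderiv ℝ ψ y)) ≤
        ((1 + ε : NNReal) : ℝ≥0∞) ^ (m + 1) *
          (μHE[m] : Measure (E (m + 1))) (F.graph ψ '' s) := by
  obtain ⟨t, A, t_disj, t_meas, t_cover, ht, -⟩ :=
    exists_partition_approximatesLinearOn_of_hasFDerivWithinAt ψ s (fderiv ℝ ψ)
      (fun y hy => (hd y hy).hasFDerivAt.hasFDerivWithinAt) (fun _ => ε) (fun _ => hε.ne')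
  have hst : s = ⋃ k, s ∩ t k := by rw [← inter_iUnion, inter_eq_self_of_subset_left t_cover]
  have hdisj : Pairwise (Function.onFun Disjoint fun k => s ∩ t k) := fun i j hij =>
    (t_disj hij).mono inter_subset_right inter_subset_right
  have hmeas : ∀ k, MeasurableSet (s ∩ t k) := fun k => hs.inter (t_meas k)
  have e1 : (μHE[m] : Measure (E (m + 1))) (F.graph ψ '' s) =
      ∑' k, (μHE[m] : Measure (E (m + 1))) (F.graph ψ '' (s ∩ t k)) := by
    conv_lhs => rw [hst, image_iUnion]
    refine measure_iUnion (fun i j hij => ?_) fun k =>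
      (measurableEmbedding_graph hψ).measurableSet_image.2 (hmeas k)
    exact (disjoint_image_iff graph_injective).2 (hdisj hij)
  have e2 : ∫⁻ y in s, ENNReal.ofReal (graphJac (fderiv ℝ ψ y)) =
      ∑' k, ∫⁻ y in s ∩ t k, ENNReal.ofReal (graphJac (fderiv ℝ ψ y)) := by
    conv_lhs => rw [hst]
    exact lintegral_iUnion hmeas hdisj _
  have hae : ∀ k, ∀ᵐ y ∂volume.restrict (s ∩ t k), ‖fderiv ℝ ψ y - A k‖ ≤ ε := fun k =>
    ae_norm_fderiv_sub_le hm (ht k) (hmeas k) fun y hy => hd y hy.1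
  have hcast : ((1 + ε : NNReal) : ℝ≥0∞) = ENNReal.ofReal (1 + ε) := by
    rw [ENNReal.ofReal_eq_coe_nnreal (by positivity)]; rfl
  rw [e1, e2, ← ENNReal.tsum_mul_left, ← ENNReal.tsum_mul_left]
  constructor
  · refine ENNReal.tsum_le_tsum fun k => ?_
    refine (measure_graph_image_of_approximatesLinearOn (F := F) (ht k)).1.trans ?_
    rw [pow_succ, mul_assoc]
    refine mul_le_mul_right ?_ _
    rw [← setLIntegral_const, ← lintegral_const_mul' _ _ ENNReal.coe_ne_top]
    refine lintegral_mono_ae ?_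
    filter_upwards [hae k] with y hy
    rw [hcast, ← ENNReal.ofReal_mul (by positivity)]
    exact ENNReal.ofReal_le_ofReal (graphJac_le (by rwa [norm_sub_rev]))
  · refine ENNReal.tsum_le_tsum fun k => ?_
    have h1 : ∫⁻ y in s ∩ t k, ENNReal.ofReal (graphJac (fderiv ℝ ψ y)) ≤
        ((1 + ε : NNReal) : ℝ≥0∞) * (ENNReal.ofReal (graphJac (A k)) * volume (s ∩ t k)) := by
      rw [← setLIntegral_const, ← lintegral_const_mul' _ _ ENNReal.coe_ne_top]
      refine lintegral_mono_ae ?_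
      filter_upwards [hae k] with y hy
      rw [hcast, ← ENNReal.ofReal_mul (by positivity)]
      exact ENNReal.ofReal_le_ofReal (graphJac_le hy)
    refine h1.trans ?_
    rw [pow_succ', mul_assoc]
    refine mul_le_mul_right ?_ _
    exact (measure_graph_image_of_approximatesLinearOn (F := F) (ht k)).2

theorem le_of_forall_one_add_pow_mul {a b : ℝ≥0∞} (k : ℕ)
    (h : ∀ ε : NNReal, 0 < ε → a ≤ ((1 + ε : NNReal) : ℝ≥0∞) ^ k * b) : a ≤ b := by
  have h1 : Tendsto (fun ε : NNReal => ((1 + ε : NNReal) : ℝ≥0∞) ^ k) (𝓝[>] 0) (𝓝 1) := by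
    have : Continuous fun ε : NNReal => ((1 + ε : NNReal) : ℝ≥0∞) ^ k :=
      (ENNReal.continuous_pow k).comp (ENNReal.continuous_coe.comp (by fun_prop))
    have := (this.tendsto 0).mono_left (nhdsWithin_le_nhds (s := Ioi 0))
    simpa using this
  have h2 := ENNReal.Tendsto.mul_const (b := b) h1 (Or.inl one_ne_zero)
  rw [one_mul] at h2
  refine ge_of_tendsto h2 ?_
  filter_upwards [self_mem_nhdsWithin] with ε hε using h ε hε

/-- The area formula for the graph of a Lipschitz function. -/
theorem measure_graph_image (hm : 0 < m) {K : NNReal} (hψ : LipschitzWith K ψ) {s : Set (E m)}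
    (hs : MeasurableSet s) : (μHE[m] : Measure (E (m + 1))) (F.graph ψ '' s) =
      ∫⁻ y in s, ENNReal.ofReal (graphJac (fderiv ℝ ψ y)) := by
  -- Rademacher's theorem: the points of non-differentiability are null, and the graph map sends
  -- null sets to null sets.
  set d : Set (E m) := {y | DifferentiableAt ℝ ψ y} with hd
  have hdm : MeasurableSet d := measurableSet_of_differentiableAt ℝ ψ
  have hd0 : volume dᶜ = 0 := hψ.ae_differentiableAt
  have hsd : volume (s \ d) = 0 := measure_mono_null (fun y hy => hy.2) hd0
  have e1 : (μHE[m] : Measure (E (m + 1))) (F.graph ψ '' s) =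
      (μHE[m] : Measure (E (m + 1))) (F.graph ψ '' (s ∩ d)) := by
    refine le_antisymm ?_ (measure_mono (image_mono inter_subset_left))
    conv_lhs => rw [← inter_union_sdiff s d, image_union]
    refine (measure_union_le _ _).trans ?_
    rw [measure_graph_image_eq_zero hψ hsd, add_zero]
  have e2 : ∫⁻ y in s, ENNReal.ofReal (graphJac (fderiv ℝ ψ y)) =
      ∫⁻ y in s ∩ d, ENNReal.ofReal (graphJac (fderiv ℝ ψ y)) := by
    refine setLIntegral_congr ?_
    refine ae_eq_set.2 ⟨by rwa [sdiff_self_inter], ?_⟩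
    rw [sdiff_eq_empty.2 inter_subset_left, measure_empty]
  rw [e1, e2]
  have key := fun (ε : NNReal) (hε : 0 < ε) => measure_graph_image_approx (F := F) hm
    hψ.continuous (hs.inter hdm) (fun y hy => hy.2) hε
  exact le_antisymm (le_of_forall_one_add_pow_mul _ fun ε hε => (key ε hε).1)
    (le_of_forall_one_add_pow_mul _ fun ε hε => (key ε hε).2)

theorem restrict_range_graph (hm : 0 < m) {K : NNReal} (hψ : LipschitzWith K ψ) :
    (μHE[m] : Measure (E (m + 1))).restrict (range (F.graph ψ)) =
      (volume.withDensity fun y => ENNReal.ofReal (graphJac (fderiv ℝ ψ y))).map (F.graph ψ) := by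
  have hemb := measurableEmbedding_graph (F := F) hψ.continuous
  ext t ht
  rw [Measure.restrict_apply ht, hemb.map_apply, withDensity_apply _ (hemb.measurable ht),
    ← measure_graph_image (F := F) hm hψ (hemb.measurable ht), image_preimage_eq_inter_range]

theorem integrableOn_range_graph_iff (hm : 0 < m) {K : NNReal} (hψ : LipschitzWith K ψ)
    {G : E (m + 1) → ℝ} : IntegrableOn G (range (F.graph ψ)) μHE[m] ↔
      Integrable fun y => graphJac (fderiv ℝ ψ y) * G (F.graph ψ y) := by
  have hemb := measurableEmbedding_graph (F := F) hψ.continuous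
  rw [IntegrableOn, restrict_range_graph hm hψ, hemb.integrable_map_iff,
    integrable_withDensity_iff_integrable_smul' (measurable_graphJac_fderiv ψ).ennreal_ofReal
      (ae_of_all _ fun _ => ENNReal.ofReal_lt_top)]
  simp [ENNReal.toReal_ofReal (graphJac_pos _).le]

theorem integral_range_graph (hm : 0 < m) {K : NNReal} (hψ : LipschitzWith K ψ)
    (G : E (m + 1) → ℝ) : ∫ x in range (F.graph ψ), G x ∂μHE[m] =
      ∫ y, graphJac (fderiv ℝ ψ y) * G (F.graph ψ y) := by
  have hemb := measurableEmbedding_graph (F := F) hψ.continuous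
  rw [restrict_range_graph hm hψ, hemb.integral_map,
    integral_withDensity_eq_integral_toReal_smul (measurable_graphJac_fderiv ψ).ennreal_ofReal
      (ae_of_all _ fun _ => ENNReal.ofReal_lt_top)]
  simp [ENNReal.toReal_ofReal (graphJac_pos _).le]

theorem ae_range_graph {K : NNReal} (hψ : LipschitzWith K ψ)
    {p : E (m + 1) → Prop} (h : ∀ᵐ y, p (F.graph ψ y)) :
    ∀ᵐ x ∂(μHE[m] : Measure (E (m + 1))), x ∈ range (F.graph ψ) → p x := by
  refine measure_mono_null ?_ (measure_graph_image_eq_zero (F := F) hψ (s := {y | ¬ p (F.graph ψ y)}) h)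
  intro x hx
  simp only [mem_compl_iff, mem_ofPred_eq, Classical.not_imp] at hx
  obtain ⟨⟨y, rfl⟩, hy⟩ := hx
  exact ⟨y, hy, rfl⟩

/-! ### The outer normal of a subgraph -/

/-- The upward unit normal to the graph of a function with derivative `A`. -/
def normal (F : Frame m) (A : E m →L[ℝ] ℝ) : E (m + 1) :=
  (graphJac A)⁻¹ • F.coord (-(InnerProductSpace.toDual ℝ (E m)).symm A, 1)

theorem inner_coord_coord (y z : E m) (s t : ℝ) :
    inner ℝ (F.coord (y, s)) (F.coord (z, t)) = inner ℝ y z + s * t := by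
  simp only [coord, inner_add_left, inner_add_right, inner_smul_left, inner_smul_right,
    F.inner_e_ι, F.ι.inner_map_map, real_inner_self_eq_norm_sq, F.norm_e]
  rw [real_inner_comm F.e (F.ι y), F.inner_e_ι]
  simp [mul_comm]

theorem inner_coord_normal (A : E m →L[ℝ] ℝ) (y : E m) (t : ℝ) :
    inner ℝ (F.coord (y, t)) (F.normal A) = (graphJac A)⁻¹ * (t - A y) := by
  rw [normal, inner_smul_right, inner_coord_coord, inner_neg_right, real_inner_comm,
    InnerProductSpace.toDual_symm_apply]
  ring

theorem norm_normal (A : E m →L[ℝ] ℝ) : ‖F.normal A‖ = 1 := by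
  have h := graphJac_pos A
  rw [normal, norm_smul, Real.norm_eq_abs, abs_of_pos (inv_pos.2 h)]
  have : ‖F.coord (-(InnerProductSpace.toDual ℝ (E m)).symm A, 1)‖ = graphJac A := by
    rw [← sq_eq_sq₀ (norm_nonneg _) h.le, norm_coord_sq, graphJac_sq, norm_neg,
      LinearIsometryEquiv.norm_map]
    ring
  rw [this, inv_mul_cancel₀ h.ne']

/-- This is the reciprocal of the area density. The two cancel in the divergence theorem, turning an
integral over the graph into one over the base. -/
theorem inner_normal_e (A : E m →L[ℝ] ℝ) : inner ℝ (F.normal A) F.e = (graphJac A)⁻¹ := by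
  have : F.e = F.coord (0, 1) := by simp [coord]
  rw [real_inner_comm]
  nth_rw 1 [this]
  rw [inner_coord_normal]
  simp

/-- The product with the normal is `J⁻¹ (t - ψ y - ψ'(y)(z - y))`, while the sign of `t - ψ z`
decides membership; they differ by the Taylor remainder of `ψ`, and `J⁻¹ ≤ 1`. -/
theorem isOuterNormal_graph {y : E m} (hy : DifferentiableAt ℝ ψ y) :
    IsOuterNormal (F.subgraph ψ) (F.graph ψ y) (F.normal (fderiv ℝ ψ y)) := by
  refine ⟨norm_normal _, fun ε hε => ?_⟩
  have h1 := hy.hasFDerivAt.isLittleO.def hε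
  rw [Metric.eventually_nhds_iff_ball] at h1
  obtain ⟨r, hr, h1⟩ := h1
  refine ⟨r, hr, fun x hx => ?_⟩
  obtain ⟨⟨z, t⟩, rfl⟩ := F.homeo.surjective x
  change F.coord (z, t) ∈ _ at hx
  change (F.coord (z, t) ∈ _ → _) ∧ (F.coord (z, t) ∉ _ → _)
  change _ ∧ (_ → _ ≤ inner ℝ (F.coord (z, t) - _) _)
  change (_ → inner ℝ (F.coord (z, t) - _) _ ≤ ε * ‖F.coord (z, t) - _‖) ∧
    (_ → -(ε * ‖F.coord (z, t) - _‖) ≤ _)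
  rw [coord_mem_subgraph]
  rw [Metric.mem_ball, dist_eq_norm] at hx
  rw [graph, coord_sub] at hx ⊢
  rw [inner_coord_normal]
  have hzn := F.norm_le_norm_coord (z - y) (t - ψ y)
  have h2 := h1 z (by rw [Metric.mem_ball, dist_eq_norm]; exact hzn.trans_lt hx)
  rw [Real.norm_eq_abs, abs_le] at h2
  set J := graphJac (fderiv ℝ ψ y)
  have hJ : 1 ≤ J := one_le_graphJac _
  have hJi : 0 < J⁻¹ := inv_pos.2 (by linarith)
  have hJi1 : J⁻¹ ≤ 1 := inv_le_one_of_one_le₀ hJ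
  have h3 : ε * ‖z - y‖ ≤ ε * ‖F.coord (z - y, t - ψ y)‖ := mul_le_mul_of_nonneg_left hzn hε.le
  have h4 : 0 ≤ ε * ‖z - y‖ := by positivity
  constructor
  · intro ht
    have : t - ψ y - fderiv ℝ ψ y (z - y) ≤ ε * ‖z - y‖ := by linarith [h2.2]
    nlinarith [mul_le_mul_of_nonneg_left this hJi.le]
  · intro ht
    have : -(ε * ‖z - y‖) ≤ t - ψ y - fderiv ℝ ψ y (z - y) := by linarith [h2.1]
    nlinarith [mul_le_mul_of_nonneg_left this hJi.le]

end Frame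

theorem IsOuterNormal.congr {n : ℕ} {Ω Ω' U : Set (E n)} {x ν : E n} (h : IsOuterNormal Ω x ν)
    (hU : U ∈ 𝓝 x) (hΩ : ∀ y ∈ U, y ∈ Ω' ↔ y ∈ Ω) : IsOuterNormal Ω' x ν := by
  obtain ⟨r, hr, hrU⟩ := Metric.mem_nhds_iff.1 hU
  refine ⟨h.1, fun ε hε => ?_⟩
  obtain ⟨r', hr', h'⟩ := h.2 ε hε
  refine ⟨min r r', lt_min hr hr', fun y hy => ?_⟩
  rw [hΩ y (hrU (Metric.ball_subset_ball (min_le_left _ _) hy))]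
  exact h' y (Metric.ball_subset_ball (min_le_right _ _) hy)

/-- A direction that is strictly inward for `ν` leads into `Ω` for short times, so `ν'` cannot
regard it as strictly outward. -/
theorem IsOuterNormal.inner_nonpos {n : ℕ} {Ω : Set (E n)} {x ν ν' d : E n}
    (h : IsOuterNormal Ω x ν) (h' : IsOuterNormal Ω x ν') (hd : inner ℝ d ν < 0) :
    inner ℝ d ν' ≤ 0 := by
  have hd0 : 0 < ‖d‖ := norm_pos_iff.2 fun h0 => by simp [h0] at hd
  refine le_of_forall_pos_le_add fun δ hδ => ?_
  rw [zero_add]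
  -- Half of the slope `-⟪d, ν⟫ / ‖d‖`: with this tolerance `x + s d` cannot lie outside `Ω`.
  obtain ⟨r, hr, h1⟩ := h.2 (-inner ℝ d ν / (2 * ‖d‖)) (by
    have : 0 < -inner ℝ d ν := by linarith
    positivity)
  obtain ⟨r', hr', h2⟩ := h'.2 (δ / ‖d‖) (by positivity)
  set s := min r r' / (2 * ‖d‖) with hs
  have hm : 0 < min r r' := lt_min hr hr'
  have hs0 : 0 < s := by positivity
  have hsd : ‖s • d‖ = min r r' / 2 := by
    rw [norm_smul, Real.norm_eq_abs, abs_of_pos hs0, hs]; field_simp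
  have hball : ∀ ρ, min r r' ≤ ρ → x + s • d ∈ Metric.ball x ρ := fun ρ hρ => by
    rw [Metric.mem_ball, dist_eq_norm, add_sub_cancel_left, hsd]; linarith
  have hmem : x + s • d ∈ Ω := by
    by_contra hn
    have := (h1 _ (hball r (min_le_left _ _))).2 hn
    rw [add_sub_cancel_left, inner_smul_left, norm_smul, Real.norm_eq_abs, abs_of_pos hs0] at this
    simp only [conj_trivial] at this
    have h3 : -(-inner ℝ d ν / (2 * ‖d‖) * (s * ‖d‖)) = s * inner ℝ d ν / 2 := by field_simp
    rw [h3] at this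
    nlinarith
  have := (h2 _ (hball r' (min_le_right _ _))).1 hmem
  rw [add_sub_cancel_left, inner_smul_left, norm_smul, Real.norm_eq_abs, abs_of_pos hs0] at this
  simp only [conj_trivial] at this
  have h3 : δ / ‖d‖ * (s * ‖d‖) = s * δ := by field_simp
  rw [h3] at this
  exact le_of_mul_le_mul_left this hs0

theorem IsOuterNormal.unique {n : ℕ} {Ω : Set (E n)} {x ν ν' : E n}
    (h : IsOuterNormal Ω x ν) (h' : IsOuterNormal Ω x ν') : ν = ν' := by
  set p : ℝ := inner ℝ ν' ν with hp
  have hνν : inner ℝ ν ν = (1 : ℝ) := by rw [real_inner_self_eq_norm_sq, h.1]; norm_num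
  have hνν' : inner ℝ ν' ν' = (1 : ℝ) := by rw [real_inner_self_eq_norm_sq, h'.1]; norm_num
  have hcomm : inner ℝ ν ν' = p := real_inner_comm _ _
  have h1 : 0 ≤ p := by
    have := h.inner_nonpos h' (d := -ν) (by rw [inner_neg_left, hνν]; norm_num)
    rw [inner_neg_left, hcomm] at this
    linarith
  -- If `0 ≤ p < 1`, the vector `ν' - ((1 + p)/2) ν` has product `(p - 1)/2 < 0` with `ν` but `1 -
  -- p(1 + p)/2 > 0` with `ν'`.
  have h2 : 1 ≤ p := by
    by_contra! hlt
    have := h.inner_nonpos h' (d := ν' - ((1 + p) / 2) • ν) (by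
      rw [inner_sub_left, inner_smul_left, hνν]
      simp only [conj_trivial]
      linarith)
    rw [inner_sub_left, inner_smul_left, hνν', hcomm] at this
    simp only [conj_trivial] at this
    nlinarith
  have h3 : ‖ν - ν'‖ ^ 2 ≤ 0 := by
    rw [norm_sub_sq_real, h.1, h'.1, hcomm]; linarith
  have h4 : ‖ν - ν'‖ = 0 := by nlinarith [norm_nonneg (ν - ν')]
  exact sub_eq_zero.1 (norm_eq_zero.1 h4)

theorem IsOuterNormal.outerNormal_eq {n : ℕ} {Ω : Set (E n)} {x ν : E n}
    (h : IsOuterNormal Ω x ν) : outerNormal Ω x = ν := by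
  have hex : ∃ ν, IsOuterNormal Ω x ν := ⟨ν, h⟩
  rw [outerNormal, dif_pos hex]
  exact hex.choose_spec.unique h

end

section

/-! ### Weak directional derivatives -/

variable {n : ℕ}

/-- `f, g ∈ L¹(Ω)`, and `g` is the weak derivative of `f` in the direction `v`, tested against
compactly supported `C¹` functions. -/
def WeakDir (Ω : Set (E n)) (v : E n) (f g : E n → ℝ) : Prop :=
  IntegrableOn f Ω ∧ IntegrableOn g Ω ∧
    ∀ φ : E n → ℝ, ContDiff ℝ 1 φ → HasCompactSupport φ → tsupport φ ⊆ Ω →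
      (∫ x in Ω, f x * fderiv ℝ φ x v) = -∫ x in Ω, g x * φ x

theorem exists_bound_of_hasCompactSupport {F : Type*} [NormedAddCommGroup F] {g : E n → F}
    (hg : Continuous g) (hc : HasCompactSupport g) : ∃ M, 0 ≤ M ∧ ∀ x, ‖g x‖ ≤ M := by
  obtain ⟨M, hM⟩ := hg.bounded_above_of_compact_support hc
  exact ⟨M, (norm_nonneg _).trans (hM 0), hM⟩

/-- The convolution differs from `g x` by at most the oscillation `2 * M`. The bound is uniform in
the kernel, as dominated convergence requires. -/
theorem norm_normed_convolution_le {g : E n → ℝ} (hg : Continuous g) {M : ℝ}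
    (hM : ∀ x, ‖g x‖ ≤ M) (ρ : ContDiffBump (0 : E n)) (x : E n) :
    ‖convolution (ρ.normed volume) g (ContinuousLinearMap.lsmul ℝ ℝ) volume x‖ ≤ 3 * M := by
  have h := ρ.dist_normed_convolution_le (μ := volume) (g := g) (x₀ := x) (ε := 2 * M)
    hg.aestronglyMeasurable fun y _ => by
      rw [dist_eq_norm]
      refine (norm_sub_le _ _).trans ?_
      linarith [hM x, hM y]
  rw [dist_eq_norm] at h
  have := norm_le_norm_add_norm_sub' (convolution (ρ.normed volume) g
    (ContinuousLinearMap.lsmul ℝ ℝ) volume x) (g x)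
  linarith [hM x]

/-- Mollification of a compactly supported `C¹` function. -/
theorem exists_smooth_approx {Ω : Set (E n)} (hΩ : IsOpen Ω) (v : E n) {φ : E n → ℝ}
    (hφ : ContDiff ℝ 1 φ) (hc : HasCompactSupport φ) (hs : tsupport φ ⊆ Ω) :
    ∃ (φk : ℕ → E n → ℝ) (M : ℝ), 0 ≤ M ∧
      (∀ k, ContDiff ℝ ∞ (φk k) ∧ HasCompactSupport (φk k) ∧ tsupport (φk k) ⊆ Ω) ∧
      (∀ k x, ‖φk k x‖ ≤ M ∧ ‖fderiv ℝ (φk k) x v‖ ≤ M) ∧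
      ∀ x, Tendsto (fun k => φk k x) atTop (𝓝 (φ x)) ∧
        Tendsto (fun k => fderiv ℝ (φk k) x v) atTop (𝓝 (fderiv ℝ φ x v)) := by
  obtain ⟨δ, hδ, hδs⟩ := IsCompact.exists_cthickening_subset_open hc hΩ hs
  -- The outer radii `δ / (k + 1)` tend to zero and never exceed `δ`, so the mollified supports stay
  -- in the `δ`-thickening, inside `Ω`.
  let ρ : ℕ → ContDiffBump (0 : E n) := fun k =>
    ⟨δ / (2 * (k + 1)), δ / (k + 1), by positivity, by
      apply div_lt_div_of_pos_left hδ (by positivity)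
      have : (0 : ℝ) ≤ k := by positivity
      linarith⟩
  have hρ : Tendsto (fun k => (ρ k).rOut) atTop (𝓝 0) := by
    have := tendsto_one_div_add_atTop_nhds_zero_nat (𝕜 := ℝ)
    have := this.const_mul δ
    simpa [ρ, div_eq_mul_inv] using this
  have hρδ : ∀ k, (ρ k).rOut ≤ δ := fun k => by
    have : (0 : ℝ) ≤ k := by positivity
    exact div_le_self hδ.le (by linarith)
  have hli : ∀ k, LocallyIntegrable ((ρ k).normed volume : E n → ℝ) volume := fun k =>
    (ρ k).continuous_normed.locallyIntegrable
  have hφ' : Continuous fun x => fderiv ℝ φ x v :=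
    (hφ.continuous_fderiv one_ne_zero).clm_apply continuous_const
  have hφ's : HasCompactSupport fun x => fderiv ℝ φ x v :=
    (hc.fderiv ℝ).comp_left (g := fun L : E n →L[ℝ] ℝ => L v) rfl
  obtain ⟨M₀, hM₀, hb₀⟩ := exists_bound_of_hasCompactSupport hφ.continuous hc
  obtain ⟨M₁, hM₁, hb₁⟩ := exists_bound_of_hasCompactSupport hφ' hφ's
  let φk : ℕ → E n → ℝ := fun k =>
    convolution ((ρ k).normed volume) φ (ContinuousLinearMap.lsmul ℝ ℝ) volume
  have hder : ∀ k x, fderiv ℝ (φk k) x v = convolution ((ρ k).normed volume)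
      (fun x => fderiv ℝ φ x v) (ContinuousLinearMap.lsmul ℝ ℝ) volume x := by
    intro k x
    rw [(hc.hasFDerivAt_convolution_right (ContinuousLinearMap.lsmul ℝ ℝ) (hli k) hφ x).fderiv]
    exact convolution_precompR_apply _ (hli k) (hc.fderiv ℝ)
      (hφ.continuous_fderiv one_ne_zero) x v
  refine ⟨φk, 3 * M₀ + 3 * M₁, by positivity, fun k => ⟨?_, ?_, ?_⟩, fun k x => ⟨?_, ?_⟩,
    fun x => ⟨?_, ?_⟩⟩
  · exact (ρ k).hasCompactSupport_normed.contDiff_convolution_left _ (ρ k).contDiff_normed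
      hφ.continuous.locallyIntegrable
  · exact (ρ k).hasCompactSupport_normed.convolution _ hc
  · refine (closure_minimal ?_ Metric.isClosed_cthickening).trans hδs
    refine (support_convolution_subset_swap _).trans ?_
    rintro _ ⟨a, ha, b, hb, rfl⟩
    rw [(ρ k).support_normed_eq] at hb
    refine Metric.mem_cthickening_of_dist_le _ a δ _ (subset_tsupport _ ha) ?_
    simp only [dist_self_add_left]
    rw [Metric.mem_ball, dist_zero_right] at hb
    exact hb.le.trans (hρδ k)
  · refine (norm_normed_convolution_le hφ.continuous hb₀ _ _).trans (by linarith)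
  · rw [hder]
    exact (norm_normed_convolution_le hφ' hb₁ _ _).trans (by linarith)
  · exact ContDiffBump.convolution_tendsto_right_of_continuous hρ hφ.continuous x
  · simp_rw [hder]
    exact ContDiffBump.convolution_tendsto_right_of_continuous hρ hφ' x

theorem continuous_fderiv_apply_of_contDiff {φ : E n → ℝ} (hφ : ContDiff ℝ 1 φ) (v : E n) :
    Continuous fun x => fderiv ℝ φ x v :=
  (hφ.continuous_fderiv one_ne_zero).clm_apply continuous_const

/-- A `C¹` test function is a bounded limit of smooth ones together with its derivative. Testing
with `C¹` functions pays off when a test function is multiplied by a `C¹` coefficient. -/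
theorem IsWeakPartial.weakDir {Ω : Set (E n)} (hΩ : IsOpen Ω) {i : Fin n} {f g : E n → ℝ}
    (h : IsWeakPartial Ω i f g) (hf : IntegrableOn f Ω) (hg : IntegrableOn g Ω) :
    WeakDir Ω (EuclideanSpace.single i 1) f g := by
  refine ⟨hf, hg, fun φ hφ hc hs => ?_⟩
  obtain ⟨φk, M, hM, h1, h2, h3⟩ :=
    exists_smooth_approx hΩ (EuclideanSpace.single i 1) hφ hc hs
  have hk1 : ∀ k, ContDiff ℝ 1 (φk k) := fun k => (h1 k).1.of_le (by exact_mod_cast le_top)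
  have t1 : Tendsto (fun k => ∫ x in Ω, f x * fderiv ℝ (φk k) x (EuclideanSpace.single i 1)) atTop
      (𝓝 (∫ x in Ω, f x * fderiv ℝ φ x (EuclideanSpace.single i 1))) := by
    refine tendsto_integral_of_dominated_convergence (fun x => ‖f x‖ * M) (fun k => ?_)
      (hf.norm.mul_const M) (fun k => ae_of_all _ fun x => ?_) (ae_of_all _ fun x => ?_)
    · exact hf.aestronglyMeasurable.mul
        (continuous_fderiv_apply_of_contDiff (hk1 k) _).aestronglyMeasurable
    · rw [norm_mul]
      exact mul_le_mul_of_nonneg_left (h2 k x).2 (norm_nonneg _)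
    · exact ((h3 x).2).const_mul _
  have t2 : Tendsto (fun k => -∫ x in Ω, g x * φk k x) atTop (𝓝 (-∫ x in Ω, g x * φ x)) := by
    refine (tendsto_integral_of_dominated_convergence (fun x => ‖g x‖ * M) (fun k => ?_)
      (hg.norm.mul_const M) (fun k => ae_of_all _ fun x => ?_) (ae_of_all _ fun x => ?_)).neg
    · exact hg.aestronglyMeasurable.mul (hk1 k).continuous.aestronglyMeasurable
    · rw [norm_mul]
      exact mul_le_mul_of_nonneg_left (h2 k x).1 (norm_nonneg _)
    · exact ((h3 x).1).const_mul _
  refine tendsto_nhds_unique t1 (t2.congr fun k => ?_)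
  exact (h.2.2 (φk k) (h1 k).1 (h1 k).2.1 (h1 k).2.2).symm

theorem integrableOn_mul_of_continuous {Ω : Set (E n)} {f φ : E n → ℝ} (hf : IntegrableOn f Ω)
    (hφ : Continuous φ) (hc : HasCompactSupport φ) : IntegrableOn (fun x => f x * φ x) Ω := by
  obtain ⟨M, -, hM⟩ := exists_bound_of_hasCompactSupport hφ hc
  simp_rw [mul_comm (f _)]
  exact hf.bdd_mul hφ.aestronglyMeasurable (ae_of_all _ hM)

theorem hasCompactSupport_fderiv_apply {φ : E n → ℝ} (hc : HasCompactSupport φ) (v : E n) :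
    HasCompactSupport fun x => fderiv ℝ φ x v :=
  (hc.fderiv ℝ).comp_left (g := fun L : E n →L[ℝ] ℝ => L v) rfl

theorem WeakDir.add_smul {Ω : Set (E n)} {v w : E n} {f g k : E n → ℝ}
    (hg : WeakDir Ω v f g) (hk : WeakDir Ω w f k) (a b : ℝ) :
    WeakDir Ω (a • v + b • w) f (fun x => a * g x + b * k x) := by
  refine ⟨hg.1, (hg.2.1.const_mul a).add (hk.2.1.const_mul b), fun φ hφ hc hs => ?_⟩
  have hφ' := continuous_fderiv_apply_of_contDiff hφ
  have hφ's := hasCompactSupport_fderiv_apply hc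
  have e1 : ∫ x in Ω, f x * fderiv ℝ φ x (a • v + b • w) =
      a * (∫ x in Ω, f x * fderiv ℝ φ x v) + b * ∫ x in Ω, f x * fderiv ℝ φ x w := by
    rw [← integral_const_mul, ← integral_const_mul, ← integral_add]
    · refine integral_congr_ae (ae_of_all _ fun x => ?_)
      simp only [map_add, map_smul, smul_eq_mul]; ring
    · exact (integrableOn_mul_of_continuous hg.1 (hφ' v) (hφ's v)).const_mul a
    · exact (integrableOn_mul_of_continuous hg.1 (hφ' w) (hφ's w)).const_mul b
  have e2 : ∫ x in Ω, (a * g x + b * k x) * φ x =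
      a * (∫ x in Ω, g x * φ x) + b * ∫ x in Ω, k x * φ x := by
    rw [← integral_const_mul, ← integral_const_mul, ← integral_add]
    · refine integral_congr_ae (ae_of_all _ fun x => ?_)
      simp only; ring
    · exact (integrableOn_mul_of_continuous hg.2.1 hφ.continuous hc).const_mul a
    · exact (integrableOn_mul_of_continuous hk.2.1 hφ.continuous hc).const_mul b
  rw [e1, e2, hg.2.2 φ hφ hc hs, hk.2.2 φ hφ hc hs]
  ring

theorem WeakDir.zero {Ω : Set (E n)} {f : E n → ℝ} (hf : IntegrableOn f Ω) :
    WeakDir Ω 0 f 0 :=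
  ⟨hf, integrable_zero _ _ _, fun φ _ _ _ => by simp⟩

theorem WeakDir.of_partials {Ω : Set (E n)} {f : E n → ℝ} {g : Fin n → E n → ℝ}
    (hf : IntegrableOn f Ω) (h : ∀ i, WeakDir Ω (EuclideanSpace.single i 1) f (g i)) (v : E n) :
    WeakDir Ω v f (fun x => ∑ i, v i * g i x) := by
  have key : ∀ s : Finset (Fin n), WeakDir Ω (∑ i ∈ s, v i • EuclideanSpace.single i (1 : ℝ)) f
      (fun x => ∑ i ∈ s, v i * g i x) := by
    intro s
    induction s using Finset.induction_on with
    | empty =>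
      simp only [Finset.sum_empty]
      exact WeakDir.zero hf
    | insert i s hi ih =>
      have := (h i).add_smul ih (v i) 1
      simp only [one_smul, one_mul] at this
      simpa only [Finset.sum_insert hi] using this
  have hv : ∑ i, v i • EuclideanSpace.single i (1 : ℝ) = v := by
    ext j
    simp [Finset.sum_apply, Pi.single_apply]
  simpa only [hv] using key Finset.univ

theorem contDiff_mul_of_tsupport_subset {U : Set (E n)} (hU : IsOpen U) {a φ : E n → ℝ}
    {k : WithTop ℕ∞} (ha : ContDiffOn ℝ k a U) (hφ : ContDiff ℝ k φ) (hs : tsupport φ ⊆ U) :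
    ContDiff ℝ k fun x => a x * φ x := by
  rw [contDiff_iff_contDiffAt]
  intro x
  by_cases hx : x ∈ tsupport φ
  · exact (ha.contDiffAt (hU.mem_nhds (hs hx))).mul hφ.contDiffAt
  · have : (fun x => a x * φ x) =ᶠ[𝓝 x] fun _ => 0 := by
      filter_upwards [(isClosed_tsupport φ).isOpen_compl.mem_nhds hx] with y hy
      rw [image_eq_zero_of_notMem_tsupport hy, mul_zero]
    exact contDiffAt_const.congr_of_eventuallyEq this

/-- The Leibniz rule for the product with a `C¹` function. -/
theorem WeakDir.mul {Ω U : Set (E n)} (hΩ : IsOpen Ω) (hb : Bornology.IsBounded Ω) (hU : IsOpen U)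
    (hΩU : closure Ω ⊆ U) {a : E n → ℝ} (ha : ContDiffOn ℝ 1 a U) {v : E n} {f g : E n → ℝ}
    (h : WeakDir Ω v f g) :
    WeakDir Ω v (fun x => a x * f x) (fun x => a x * g x + f x * fderiv ℝ a x v) := by
  have hK : IsCompact (closure Ω) := hb.isCompact_closure
  have hac : ContinuousOn a (closure Ω) := ha.continuousOn.mono hΩU
  have ha'c : ContinuousOn (fun x => fderiv ℝ a x v) (closure Ω) :=
    ((ha.continuousOn_fderiv_of_isOpen hU le_rfl).clm_apply continuousOn_const).mono hΩU
  have bd : ∀ {b k : E n → ℝ}, ContinuousOn b (closure Ω) → IntegrableOn k Ω →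
      IntegrableOn (fun x => b x * k x) Ω := by
    intro b k hbc hk
    obtain ⟨M, hM⟩ := hK.exists_bound_of_continuousOn hbc
    refine hk.bdd_mul ((hbc.mono subset_closure).aestronglyMeasurable hΩ.measurableSet) (c := M) ?_
    exact (ae_restrict_iff' hΩ.measurableSet).2 (ae_of_all _ fun x hx => hM x (subset_closure hx))
  have i1 : IntegrableOn (fun x => f x * fderiv ℝ a x v) Ω := by
    simp_rw [mul_comm (f _)]
    exact bd ha'c h.1
  refine ⟨bd hac h.1, (bd hac h.2.1).add i1, fun φ hφ hc hs => ?_⟩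
  have hΩU' : Ω ⊆ U := subset_closure.trans hΩU
  have haφ : ContDiff ℝ 1 fun x => a x * φ x :=
    contDiff_mul_of_tsupport_subset hU ha hφ (hs.trans hΩU')
  have haφc : HasCompactSupport fun x => a x * φ x := hc.mul_left
  have haφs : tsupport (fun x => a x * φ x) ⊆ Ω :=
    (closure_mono (Function.support_mul_subset_right a φ)).trans hs
  have key := h.2.2 _ haφ haφc haφs
  have hder : ∀ x ∈ Ω, fderiv ℝ (fun x => a x * φ x) x v =
      a x * fderiv ℝ φ x v + φ x * fderiv ℝ a x v := by
    intro x hx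
    have h1 : DifferentiableAt ℝ a x :=
      ((ha.contDiffAt (hU.mem_nhds (hΩU' hx))).differentiableAt one_ne_zero)
    rw [fderiv_fun_mul h1 (hφ.differentiable one_ne_zero x)]
    simp
  have e1 : ∫ x in Ω, a x * f x * fderiv ℝ φ x v =
      (∫ x in Ω, f x * fderiv ℝ (fun x => a x * φ x) x v) -
        ∫ x in Ω, f x * fderiv ℝ a x v * φ x := by
    rw [← integral_sub]
    · refine setIntegral_congr_fun hΩ.measurableSet fun x hx => ?_
      simp only [hder x hx]; ring
    · exact integrableOn_mul_of_continuous h.1 (continuous_fderiv_apply_of_contDiff haφ v)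
        (hasCompactSupport_fderiv_apply haφc v)
    · exact integrableOn_mul_of_continuous i1 hφ.continuous hc
  have e2 : ∫ x in Ω, (a x * g x + f x * fderiv ℝ a x v) * φ x =
      (∫ x in Ω, g x * (a x * φ x)) + ∫ x in Ω, f x * fderiv ℝ a x v * φ x := by
    rw [← integral_add]
    · refine integral_congr_ae (ae_of_all _ fun x => ?_)
      simp only; ring
    · exact integrableOn_mul_of_continuous h.2.1 haφ.continuous haφc
    · exact integrableOn_mul_of_continuous i1 hφ.continuous hc
  rw [e1, e2, key]
  ring

/-- Localization of a weak derivative by a cutoff function. -/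
theorem IsWeakPartial.weakDir_cutoff {Ω : Set (E n)} {i : Fin n} {f g η : E n → ℝ}
    (h : IsWeakPartial Ω i f g) (hη : ContDiff ℝ ∞ η) (hηc : HasCompactSupport η)
    (hηs : tsupport η ⊆ Ω) :
    WeakDir univ (EuclideanSpace.single i 1) (fun x => η x * f x)
      (fun x => η x * g x + f x * fderiv ℝ η x (EuclideanSpace.single i 1)) := by
  set v : E n := EuclideanSpace.single i 1 with hv
  have hη1 : ContDiff ℝ 1 η := hη.of_le (by exact_mod_cast le_top)
  have hη' := continuous_fderiv_apply_of_contDiff hη1 v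
  have hη's : ∀ x ∉ tsupport η, fderiv ℝ η x v = 0 := fun x hx => by
    rw [image_eq_zero_of_notMem_tsupport (fun hx' => hx (tsupport_fderiv_subset ℝ hx'))]
    simp
  have hinteg : ∀ {b k : E n → ℝ}, LocallyIntegrableOn k Ω → Continuous b →
      (∀ x ∉ tsupport η, b x = 0) → Integrable (fun x => b x * k x) := by
    intro b k hk hb hb0
    have h1 : IntegrableOn k (tsupport η) := hk.integrableOn_compact_subset hηs hηc
    refine IntegrableOn.integrable_of_forall_notMem_eq_zero (s := tsupport η)
      (h1.continuousOn_mul hb.continuousOn hηc) fun x hx => by rw [hb0 x hx, zero_mul]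
  have hη0 : ∀ x ∉ tsupport η, η x = 0 := fun x hx => image_eq_zero_of_notMem_tsupport hx
  have i1 := hinteg h.1 hη1.continuous hη0
  have i2 := hinteg h.2.1 hη1.continuous hη0
  have i3 : Integrable fun x => f x * fderiv ℝ η x v := by
    simp_rw [mul_comm (f _)]; exact hinteg h.1 hη' hη's
  refine IsWeakPartial.weakDir isOpen_univ ⟨?_, ?_, fun φ hφ hφc _ => ?_⟩ i1.integrableOn
    (i2.add i3).integrableOn
  · exact (i1.locallyIntegrable).locallyIntegrableOn _
  · exact ((i2.add i3).locallyIntegrable).locallyIntegrableOn _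
  rw [← hv, Measure.restrict_univ]
  have key := h.2.2 (fun x => η x * φ x) (hη.mul hφ) hφc.mul_left
    ((closure_mono (Function.support_mul_subset_left η φ)).trans hηs)
  have hφ1 : ContDiff ℝ 1 φ := hφ.of_le (by exact_mod_cast le_top)
  have hder : ∀ x, fderiv ℝ (fun x => η x * φ x) x v =
      η x * fderiv ℝ φ x v + φ x * fderiv ℝ η x v := by
    intro x
    rw [fderiv_fun_mul (hη1.differentiable one_ne_zero x) (hφ1.differentiable one_ne_zero x)]
    simp
  rw [← hv, setIntegral_eq_integral_of_forall_compl_eq_zero,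
    setIntegral_eq_integral_of_forall_compl_eq_zero] at key
  rotate_left
  · intro x hx
    rw [hη0 x fun hx' => hx (hηs hx')]; simp
  · intro x hx
    rw [hder, hη0 x fun hx' => hx (hηs hx'), hη's x fun hx' => hx (hηs hx')]; simp
  have b1 : Integrable fun x => η x * f x * fderiv ℝ φ x v := integrableOn_univ.1
    (integrableOn_mul_of_continuous i1.integrableOn (continuous_fderiv_apply_of_contDiff hφ1 v)
        (hasCompactSupport_fderiv_apply hφc v))
  have b2 : Integrable fun x => f x * fderiv ℝ η x v * φ x := integrableOn_univ.1
    (integrableOn_mul_of_continuous i3.integrableOn hφ.continuous hφc)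
  have b3 : Integrable fun x => η x * g x * φ x := integrableOn_univ.1
    (integrableOn_mul_of_continuous i2.integrableOn hφ.continuous hφc)
  have e1 : ∫ x, f x * fderiv ℝ (fun x => η x * φ x) x v =
      (∫ x, η x * f x * fderiv ℝ φ x v) + ∫ x, f x * fderiv ℝ η x v * φ x := by
    rw [← integral_add b1 b2]
    refine integral_congr_ae (ae_of_all _ fun x => ?_)
    simp only [hder]; ring
  have e2 : ∫ x, (η x * g x + f x * fderiv ℝ η x v) * φ x =
      (∫ x, g x * (η x * φ x)) + ∫ x, f x * fderiv ℝ η x v * φ x := by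
    have : (fun x => g x * (η x * φ x)) = fun x => η x * g x * φ x := by ext x; ring
    rw [this, ← integral_add b3 b2]
    refine integral_congr_ae (ae_of_all _ fun x => ?_)
    simp only; ring
  rw [e2, ← neg_eq_iff_eq_neg.2 key, e1]
  ring

end

section

variable {n : ℕ}

/-! ### Integration along lines -/

theorem hasFDerivAt_integral_translate {φ : E n → ℝ} (hφ : ContDiff ℝ 1 φ)
    (hc : HasCompactSupport φ) (v : E n) (M : ℝ) (x : E n) :
    HasFDerivAt (fun x => ∫ s in (0 : ℝ)..M, φ (x + s • v))
      (∫ s in (0 : ℝ)..M, fderiv ℝ φ (x + s • v)) x := by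
  have hφ' := hφ.continuous_fderiv one_ne_zero
  obtain ⟨C, -, hC⟩ := exists_bound_of_hasCompactSupport hφ' (hc.fderiv ℝ)
  have hcont : ∀ y : E n, Continuous fun s : ℝ => φ (y + s • v) := fun y =>
    hφ.continuous.comp (by fun_prop)
  refine intervalIntegral.hasFDerivAt_integral_of_dominated_of_fderiv_le (s := univ)
    (bound := fun _ => C) (F' := fun y s => fderiv ℝ φ (y + s • v)) univ_mem
    (Eventually.of_forall fun y => (hcont y).aestronglyMeasurable)
    ((hcont x).intervalIntegrable _ _) ?_ (ae_of_all _ fun s _ y _ => hC _)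
    intervalIntegrable_const (ae_of_all _ fun s _ y _ => ?_)
  · exact (hφ'.comp (by fun_prop : Continuous fun s : ℝ => x + s • v)).aestronglyMeasurable
  · exact (hasFDerivAt_comp_add_right (s • v)).2
      (hφ.differentiable one_ne_zero (y + s • v)).hasFDerivAt

theorem contDiff_integral_translate {φ : E n → ℝ} (hφ : ContDiff ℝ 1 φ)
    (hc : HasCompactSupport φ) (v : E n) (M : ℝ) :
    ContDiff ℝ 1 (fun x => ∫ s in (0 : ℝ)..M, φ (x + s • v)) := by
  refine contDiff_one_iff_hasFDerivAt.2
    ⟨_, ?_, fun x => hasFDerivAt_integral_translate hφ hc v M x⟩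
  refine intervalIntegral.continuous_parametric_intervalIntegral_of_continuous' ?_ 0 M
  exact (hφ.continuous_fderiv one_ne_zero).comp (by fun_prop)

/-- For `M` large, `φ (x + M v)` vanishes on a given bounded set, so there the primitive has
derivative `-φ` along `v`. This makes it the test function that recovers `f` from `g`. -/
theorem fderiv_integral_translate {φ : E n → ℝ} (hφ : ContDiff ℝ 1 φ)
    (hc : HasCompactSupport φ) (v : E n) (M : ℝ) (x : E n) :
    fderiv ℝ (fun x => ∫ s in (0 : ℝ)..M, φ (x + s • v)) x v = φ (x + M • v) - φ x := by
  have hφ' := hφ.continuous_fderiv one_ne_zero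
  have hcomp : Continuous fun s : ℝ => fderiv ℝ φ (x + s • v) := hφ'.comp (by fun_prop)
  rw [(hasFDerivAt_integral_translate hφ hc v M x).fderiv,
    ContinuousLinearMap.intervalIntegral_apply (hcomp.intervalIntegrable _ _)]
  have hd : ∀ s : ℝ, HasDerivAt (fun s : ℝ => φ (x + s • v)) (fderiv ℝ φ (x + s • v) v) s := by
    intro s
    have h1 : HasDerivAt (fun s : ℝ => x + s • v) v s := by
      simpa using ((hasDerivAt_id s).smul_const v).const_add x
    exact (hφ.differentiable one_ne_zero (x + s • v)).hasFDerivAt.comp_hasDerivAt s h1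
  rw [intervalIntegral.integral_eq_sub_of_hasDerivAt (fun s _ => hd s)
    ((hcomp.clm_apply continuous_const).intervalIntegrable _ _)]
  simp

theorem measurePreserving_shear (μ : Measure ℝ) [SFinite μ] (v : E n) :
    MeasurePreserving (fun p : ℝ × E n => (p.1, p.2 + p.1 • v)) (μ.prod volume)
      (μ.prod volume) := by
  refine (MeasurePreserving.id μ).skew_product (g := fun s x => x + s • v) (by fun_prop)
    (ae_of_all _ fun s => ?_)
  exact (measurePreserving_add_right volume (s • v)).map_eq

theorem integrable_shear {g : E n → ℝ} (hg : Integrable g) (v : E n) (a b : ℝ) :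
    Integrable (fun p : ℝ × E n => g (p.2 + p.1 • v))
      ((volume.restrict (uIoc a b)).prod volume) := by
  have : IsFiniteMeasure (volume.restrict (uIoc a b)) := ⟨by simp [uIoc]⟩
  have h1 : Integrable (fun p : ℝ × E n => (1 : ℝ) * g p.2)
      ((volume.restrict (uIoc a b)).prod volume) :=
    Integrable.mul_prod (integrable_const 1) hg
  have h2 := (measurePreserving_shear (volume.restrict (uIoc a b)) v).integrable_comp_of_integrable h1
  simpa [Function.comp_def] using h2

/-- A function with bounded support in a set that is unbounded below in the direction `v` is the
integral of its weak derivative along almost every line. -/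
theorem WeakDir.ae_eq_integral {S : Set (E n)} (hS : IsOpen S) {v : E n} (hv : ‖v‖ = 1)
    (hdown : ∀ x ∈ S, ∀ s : ℝ, 0 ≤ s → x - s • v ∈ S) {f g : E n → ℝ} (h : WeakDir S v f g)
    {R : ℝ} (hf : ∀ x, R ≤ ‖x‖ → f x = 0) (hg : ∀ x, R ≤ ‖x‖ → g x = 0) :
    ∀ᵐ x, x ∈ S → f x = ∫ s in Ioi (0 : ℝ), g (x - s • v) := by
  set g' : E n → ℝ := S.indicator g with hg'
  have hg'i : Integrable g' := (integrable_indicator_iff hS.measurableSet).2 h.2.1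
  have hg'0 : ∀ x, R ≤ ‖x‖ → g' x = 0 := fun x hx => by
    by_cases hxS : x ∈ S
    · rw [hg', indicator_of_mem hxS, hg x hx]
    · rw [hg', indicator_of_notMem hxS]
  -- on bounded sets the integral may be truncated
  have trunc : ∀ (R' M : ℝ), R + R' ≤ M → 0 ≤ M → ∀ x ∈ S, ‖x‖ ≤ R' →
      ∫ s in Ioi (0 : ℝ), g (x - s • v) = ∫ s in (0 : ℝ)..M, g' (x - s • v) := by
    intro R' M hM hM0 x hxS hx
    rw [intervalIntegral.integral_of_le hM0]
    have e1 : ∫ s in Ioi (0 : ℝ), g (x - s • v) = ∫ s in Ioi (0 : ℝ), g' (x - s • v) := by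
      refine setIntegral_congr_fun measurableSet_Ioi fun s hs => ?_
      simp only [hg', indicator_of_mem (hdown x hxS s (le_of_lt hs))]
    rw [e1]
    refine setIntegral_eq_of_subset_of_forall_sdiff_eq_zero measurableSet_Ioi Ioc_subset_Ioi_self ?_
    intro s hs
    have hsM : M < s := by
      by_contra! hle
      exact hs.2 ⟨hs.1, hle⟩
    apply hg'0
    have h1 := norm_sub_norm_le (s • v) x
    rw [norm_smul, hv, mul_one, Real.norm_eq_abs, abs_of_pos (hM0.trans_lt hsM),
      norm_sub_rev] at h1
    linarith
  have hinteg : ∀ (M : ℝ), 0 ≤ M → ∀ b : E n → ℝ, Continuous b → HasCompactSupport b →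
      Integrable (fun p : ℝ × E n => b p.2 * g' (p.2 - p.1 • v))
        ((volume.restrict (uIoc 0 M)).prod volume) := by
    intro M hM b hb hbc
    have h2 := integrable_shear hg'i (-v) 0 M
    obtain ⟨C, -, hC⟩ := exists_bound_of_hasCompactSupport hb hbc
    have h3 := h2.bdd_mul (f := fun p : ℝ × E n => b p.2) (c := C)
      (hb.comp continuous_snd).aestronglyMeasurable (ae_of_all _ fun p => hC _)
    simpa [sub_eq_add_neg] using h3
  -- comparison on balls
  have main : ∀ R' : ℝ, 0 < R' → ∀ᵐ x, x ∈ S ∩ Metric.ball 0 R' →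
      f x - ∫ s in (0 : ℝ)..(|R| + R'), g' (x - s • v) = 0 := by
    intro R' hR'
    -- If `‖x‖ < R`, then `‖x + M v‖ > R'`, outside the support of `φ`; if `‖x‖ ≥ R`, then `f x =
    -- 0`.
    set M := |R| + R' with hM
    have hM0 : 0 ≤ M := by positivity
    have hfi : IntegrableOn f (S ∩ Metric.ball 0 R') := h.1.mono_set inter_subset_left
    have hk : IntegrableOn (fun x => ∫ s in (0 : ℝ)..M, g' (x - s • v)) univ := by
      rw [integrableOn_univ]
      simp_rw [intervalIntegral.integral_of_le hM0, ← uIoc_of_le hM0]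
      have h2 := (integrable_shear hg'i (-v) 0 M).integral_prod_right
      simpa [sub_eq_add_neg] using h2
    refine IsOpen.ae_eq_zero_of_integral_contDiff_smul_eq_zero (hS.inter Metric.isOpen_ball)
      ((hfi.sub (hk.mono_set (subset_univ _))).locallyIntegrableOn) ?_
    intro φ hφ hφc hφs
    have hφ1 : ContDiff ℝ 1 φ := hφ.of_le (by exact_mod_cast le_top)
    have hφS : tsupport φ ⊆ S := hφs.trans inter_subset_left
    have hφR : ∀ x, R' ≤ ‖x‖ → φ x = 0 := fun x hx =>
      image_eq_zero_of_notMem_tsupport fun hx' => by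
        have := (hφs hx').2
        rw [mem_ball_zero_iff] at this
        linarith
    -- The support of `Φ` is that of `φ` swept in the direction `-v`, hence compact and still in
    -- `S`. Testing with `Φ` gives `∫ f φ = ∫ g Φ`, and Fubini's theorem with a translation moves
    -- the line integral from `φ` to `g`.
    set Φ : E n → ℝ := fun x => ∫ s in (0 : ℝ)..M, φ (x + s • v) with hΦ
    have hΦ1 : ContDiff ℝ 1 Φ := contDiff_integral_translate hφ1 hφc v M
    set K : Set (E n) := (fun p : E n × ℝ => p.1 - p.2 • v) '' (tsupport φ ×ˢ Icc 0 M) with hK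
    have hKc : IsCompact K :=
      (IsCompact.prod hφc isCompact_Icc).image (by fun_prop)
    have hKS : K ⊆ S := by
      rintro _ ⟨⟨x, s⟩, ⟨hx, hs⟩, rfl⟩
      exact hdown x (hφS hx) s hs.1
    have hΦK : Function.support Φ ⊆ K := by
      intro x hx
      by_contra hxK
      apply hx
      simp only [hΦ]
      rw [intervalIntegral.integral_of_le hM0]
      refine setIntegral_eq_zero_of_forall_eq_zero fun s hs => ?_
      refine image_eq_zero_of_notMem_tsupport fun hmem => hxK ?_
      exact ⟨(x + s • v, s), ⟨hmem, hs.1.le, hs.2⟩, by simp⟩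
    have hΦs : tsupport Φ ⊆ K := closure_minimal hΦK hKc.isClosed
    have hΦc : HasCompactSupport Φ := hKc.of_isClosed_subset (isClosed_tsupport _) hΦs
    have key := h.2.2 Φ hΦ1 hΦc (hΦs.trans hKS)
    have e1 : ∫ x in S, f x * fderiv ℝ Φ x v = -∫ x in S, f x * φ x := by
      rw [← integral_neg]
      refine integral_congr_ae (ae_of_all _ fun x => ?_)
      simp only [hΦ]
      rw [fderiv_integral_translate hφ1 hφc]
      by_cases hx : R ≤ ‖x‖
      · simp [hf x hx]
      · rw [hφR (x + M • v)]
        · ring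
        · have h1 := norm_sub_norm_le (M • v) (-x)
          rw [norm_smul, hv, mul_one, Real.norm_eq_abs, abs_of_nonneg hM0, norm_neg,
            sub_neg_eq_add, add_comm (M • v)] at h1
          have := le_abs_self R
          linarith
    have e2 : ∫ x in S, g x * Φ x = ∫ x, φ x * ∫ s in (0 : ℝ)..M, g' (x - s • v) := by
      have s1 : ∫ x in S, g x * Φ x = ∫ x, g' x * Φ x := by
        rw [← integral_indicator hS.measurableSet]
        refine integral_congr_ae (ae_of_all _ fun x => ?_)
        simp only [hg']
        by_cases hx : x ∈ S <;> simp [hx]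
      have hI := hinteg M hM0 φ hφ.continuous hφc
      have s2 : ∫ x, φ x * ∫ s in (0 : ℝ)..M, g' (x - s • v) =
          ∫ s in (0 : ℝ)..M, ∫ x, φ x * g' (x - s • v) := by
        rw [intervalIntegral_integral_swap (f := fun s x => φ x * g' (x - s • v)) hI]
        refine integral_congr_ae (ae_of_all _ fun x => ?_)
        simp only [intervalIntegral.integral_const_mul]
      have s3 : ∀ s : ℝ, ∫ x, φ x * g' (x - s • v) = ∫ x, φ (x + s • v) * g' x := by
        intro s
        rw [← integral_add_right_eq_self (fun x => φ x * g' (x - s • v)) (s • v)]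
        simp
      have hI2 : Integrable (Function.uncurry fun (s : ℝ) (x : E n) => φ (x + s • v) * g' x)
          ((volume.restrict (uIoc 0 M)).prod volume) := by
        have := (measurePreserving_shear (volume.restrict (uIoc 0 M))
          v).integrable_comp_of_integrable hI
        simpa [Function.comp_def, Function.uncurry_def] using this
      rw [s1, s2]
      simp_rw [s3]
      rw [intervalIntegral_integral_swap hI2]
      refine integral_congr_ae (ae_of_all _ fun x => ?_)
      simp only [hΦ, intervalIntegral.integral_mul_const]
      ring
    have e3 : ∫ x in S, f x * φ x = ∫ x, φ x * (S.indicator f x) := by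
      rw [← integral_indicator hS.measurableSet]
      refine integral_congr_ae (ae_of_all _ fun x => ?_)
      by_cases hx : x ∈ S <;> simp [hx, mul_comm]
    have i1 : Integrable fun x => φ x * S.indicator f x := by
      have := integrableOn_mul_of_continuous (Ω := univ)
        (integrableOn_univ.2 ((integrable_indicator_iff hS.measurableSet).2 h.1))
        hφ.continuous hφc
      simpa [mul_comm] using this
    have i2 : Integrable fun x => φ x * ∫ s in (0 : ℝ)..M, g' (x - s • v) := by
      have := integrableOn_mul_of_continuous hk hφ.continuous hφc
      simpa [mul_comm] using this
    have e4 : ∫ x, φ x • (f x - ∫ s in (0 : ℝ)..M, g' (x - s • v)) =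
        (∫ x, φ x * (S.indicator f x)) - ∫ x, φ x * ∫ s in (0 : ℝ)..M, g' (x - s • v) := by
      rw [← integral_sub i1 i2]
      refine integral_congr_ae (ae_of_all _ fun x => ?_)
      simp only [smul_eq_mul]
      by_cases hx : x ∈ S
      · rw [indicator_of_mem hx]; ring
      · rw [image_eq_zero_of_notMem_tsupport fun hx' => hx (hφS hx')]; ring
    rw [e4, ← e3, ← e2]
    linarith [key, e1]
  have hall : ∀ᵐ x, ∀ k : ℕ, x ∈ S ∩ Metric.ball 0 ((k : ℝ) + 1) →
      f x - ∫ s in (0 : ℝ)..(|R| + ((k : ℝ) + 1)), g' (x - s • v) = 0 :=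
    ae_all_iff.2 fun k => main _ (by positivity)
  filter_upwards [hall] with x hx hxS
  obtain ⟨k, hk⟩ := exists_nat_gt ‖x‖
  have hk' : ‖x‖ < (k : ℝ) + 1 := by linarith
  have h1 := hx k ⟨hxS, by rwa [mem_ball_zero_iff]⟩
  have h2 := trunc ((k : ℝ) + 1) (|R| + ((k : ℝ) + 1)) (by linarith [le_abs_self R]) (by positivity)
    x hxS hk'.le
  rw [h2]; linarith

end

section

variable {n : ℕ}

/-! ### Difference quotients and the chain rule -/

theorem ae_integrable_line {g : E n → ℝ} (hg : Integrable g) {v : E n} (hv : ‖v‖ = 1) {R : ℝ}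
    (hg0 : ∀ x, R ≤ ‖x‖ → g x = 0) : ∀ᵐ x, Integrable fun s : ℝ => g (x + s • v) := by
  have h1 : ∀ᵐ x, ∀ k : ℕ, IntegrableOn (fun s : ℝ => g (x + s • v)) (uIoc (-(k : ℝ)) k) := by
    rw [ae_all_iff]
    intro k
    exact (integrable_shear hg v (-(k : ℝ)) k).prod_left_ae
  filter_upwards [h1] with x hx
  obtain ⟨k, hk⟩ := exists_nat_gt (‖x‖ + |R|)
  refine (hx k).integrable_of_forall_notMem_eq_zero fun s hs => hg0 _ ?_
  have hk0 : (0 : ℝ) ≤ k := by positivity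
  rw [uIoc_of_le (by linarith), mem_Ioc, not_and_or, not_lt, not_le] at hs
  have hs' : (k : ℝ) ≤ |s| := by
    rcases hs with hs | hs
    · rw [abs_of_nonpos (by linarith)]; linarith
    · rw [abs_of_pos (by linarith)]; exact hs.le
  have h2 := norm_sub_norm_le (s • v) (-x)
  rw [norm_smul, hv, mul_one, norm_neg, sub_neg_eq_add, add_comm (s • v), Real.norm_eq_abs] at h2
  linarith [le_abs_self R]

/-- The half-line representations at `x + t v` and at `x` are subtracted; only the segment between
the two points remains. -/
theorem WeakDir.ae_translate_sub {v : E n} (hv : ‖v‖ = 1) {f g : E n → ℝ}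
    (h : WeakDir univ v f g) {R : ℝ} (hf : ∀ x, R ≤ ‖x‖ → f x = 0)
    (hg : ∀ x, R ≤ ‖x‖ → g x = 0) (t : ℝ) :
    ∀ᵐ x, f (x + t • v) - f x = ∫ s in (0 : ℝ)..t, g (x + s • v) := by
  have h1 : ∀ᵐ x, f x = ∫ s in Iic (0 : ℝ), g (x + s • v) := by
    filter_upwards [h.ae_eq_integral isOpen_univ hv (fun _ _ _ _ => mem_univ _) hf hg] with x hx
    rw [hx (mem_univ x)]
    have := integral_comp_neg_Ioi (0 : ℝ) fun s : ℝ => g (x + s • v)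
    rw [neg_zero] at this
    rw [← this]
    simp [sub_eq_add_neg]
  have h2 : ∀ᵐ x, f (x + t • v) = ∫ s in Iic (0 : ℝ), g (x + t • v + s • v) :=
    (measurePreserving_add_right volume (t • v)).quasiMeasurePreserving.ae h1
  filter_upwards [h1, h2, ae_integrable_line (integrableOn_univ.1 h.2.1) hv hg] with x hx1 hx2 hx3
  have h4 : ∫ s in Iic (0 : ℝ), g (x + t • v + s • v) = ∫ s in Iic t, g (x + s • v) := by
    have := (measurePreserving_add_right volume t).setIntegral_preimage_emb
      (measurableEmbedding_addRight t) (fun s : ℝ => g (x + s • v)) (Iic t)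
    rw [← this]
    have hpre : (fun s : ℝ => s + t) ⁻¹' Iic t = Iic 0 := by ext s; simp
    rw [hpre]
    refine setIntegral_congr_fun measurableSet_Iic fun s _ => ?_
    simp only [_root_.add_smul]
    congr 1
    abel
  rw [hx1, hx2, h4]
  exact intervalIntegral.integral_Iic_sub_Iic hx3.integrableOn hx3.integrableOn

/-- This is continuity at zero of the action of translations on `L¹`. -/
theorem tendsto_lintegral_translate_sub {g : E n → ℝ} (hg : Integrable g) (v : E n) :
    Tendsto (fun s : ℝ => ∫⁻ x, ‖g (x + s • v) - g x‖ₑ) (𝓝 0) (𝓝 0) := by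
  have hm : MemLp g 1 := memLp_one_iff_integrable.2 hg
  let T : ℝ → Lp ℝ 1 (volume : Measure (E n)) := fun s => DomAddAct.mk (s • v) +ᵥ hm.toLp g
  have : Fact ((1 : ℝ≥0∞) ≠ ⊤) := ⟨ENNReal.one_ne_top⟩
  have hT : Continuous T := by
    have h1 : Continuous fun s : ℝ => DomAddAct.mk (s • v) :=
      DomAddAct.continuous_mk.comp (by fun_prop)
    exact h1.vadd continuous_const
  have h0 : T 0 = hm.toLp g := by simp [T]
  have h1 : Tendsto (fun s => edist (T s) (hm.toLp g)) (𝓝 0) (𝓝 0) := by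
    have := (hT.edist (continuous_const (y := hm.toLp g))).tendsto 0
    simpa only [h0, edist_self] using this
  refine h1.congr fun s => ?_
  simp only [T]
  rw [DomAddAct.mk_vadd_toLp, Lp.edist_toLp_toLp, eLpNorm_one_eq_lintegral_enorm]
  simp [add_comm]

/-- The quotient minus `g` is the mean of `g (x + s v) - g x` over `0 < s ≤ t k`. Its `L¹` norm is
bounded by the translation errors of `g`, which tend to zero; a subsequence then converges almost
everywhere. -/
theorem WeakDir.exists_seq_tendsto {v : E n} (hv : ‖v‖ = 1) {f g : E n → ℝ}
    (h : WeakDir univ v f g) {R : ℝ} (hf : ∀ x, R ≤ ‖x‖ → f x = 0)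
    (hg : ∀ x, R ≤ ‖x‖ → g x = 0) {t : ℕ → ℝ} (ht : Tendsto t atTop (𝓝 0)) (ht0 : ∀ k, 0 < t k) :
    ∃ ns : ℕ → ℕ, StrictMono ns ∧ ∀ᵐ x, Tendsto
      (fun k => (t (ns k))⁻¹ * (f (x + t (ns k) • v) - f x)) atTop (𝓝 (g x)) := by
  have hfi : Integrable f := integrableOn_univ.1 h.1
  have hgi : Integrable g := integrableOn_univ.1 h.2.1
  set Q : ℕ → E n → ℝ := fun k x => (t k)⁻¹ * (f (x + t k • v) - f x) with hQ
  have hQm : ∀ k, AEStronglyMeasurable (Q k) volume := fun k =>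
    (((hfi.comp_add_right (t k • v)).sub hfi).const_mul _).aestronglyMeasurable
  have hshm : AEMeasurable (fun p : ℝ × E n => ‖g (p.2 + p.1 • v) - g p.2‖ₑ)
      ((volume : Measure ℝ).prod volume) := by
    refine AEMeasurable.enorm (AEMeasurable.sub ?_ ?_)
    · have h1 : AEMeasurable (fun p : ℝ × E n => g p.2) ((volume : Measure ℝ).prod volume) :=
        hgi.aestronglyMeasurable.aemeasurable.comp_quasiMeasurePreserving
          Measure.quasiMeasurePreserving_snd
      exact h1.comp_quasiMeasurePreserving
        (measurePreserving_shear volume v).quasiMeasurePreserving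
    · exact hgi.aestronglyMeasurable.aemeasurable.comp_quasiMeasurePreserving
        Measure.quasiMeasurePreserving_snd
  have hbound : ∀ k (ε : ℝ≥0∞), (∀ s ∈ Ioc 0 (t k), ∫⁻ x, ‖g (x + s • v) - g x‖ₑ ≤ ε) →
      eLpNorm (Q k - g) 1 volume ≤ ε := by
    intro k ε hε
    rw [eLpNorm_one_eq_lintegral_enorm]
    have htk := ht0 k
    have h1 : ∀ᵐ x, ‖(Q k - g) x‖ₑ ≤
        ENNReal.ofReal (t k)⁻¹ * ∫⁻ s in Ioc 0 (t k), ‖g (x + s • v) - g x‖ₑ := by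
      filter_upwards [h.ae_translate_sub hv hf hg (t k), ae_integrable_line hgi hv hg] with x hx hx2
      have e1 : (Q k - g) x = (t k)⁻¹ * ∫ s in Ioc 0 (t k), (g (x + s • v) - g x) := by
        rw [integral_sub hx2.integrableOn (by simp)]
        rw [← intervalIntegral.integral_of_le htk.le, ← hx]
        simp only [Pi.sub_apply, hQ, integral_const, measureReal_restrict_apply_univ,
          Real.volume_real_Ioc_of_le htk.le, sub_zero, smul_eq_mul]
        field_simp
      rw [e1, enorm_mul, Real.enorm_eq_ofReal (by positivity)]
      exact mul_le_mul_right (enorm_integral_le_lintegral_enorm _) _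
    calc _ ≤ ∫⁻ x, ENNReal.ofReal (t k)⁻¹ * ∫⁻ s in Ioc 0 (t k), ‖g (x + s • v) - g x‖ₑ :=
          lintegral_mono_ae h1
      _ = ENNReal.ofReal (t k)⁻¹ * ∫⁻ s in Ioc 0 (t k), ∫⁻ x, ‖g (x + s • v) - g x‖ₑ := by
          rw [lintegral_const_mul' _ _ ENNReal.ofReal_ne_top]
          congr 1
          refine (lintegral_lintegral_swap (f := fun s x => ‖g (x + s • v) - g x‖ₑ) ?_).symm
          exact hshm.mono_measure (Measure.prod_mono Measure.restrict_le_self le_rfl)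
      _ ≤ ENNReal.ofReal (t k)⁻¹ * ∫⁻ s in Ioc 0 (t k), ε :=
          mul_le_mul_right (setLIntegral_mono' measurableSet_Ioc hε) _
      _ = ε := by
          rw [setLIntegral_const, Real.volume_Ioc, sub_zero, mul_comm ε, ← mul_assoc,
            ← ENNReal.ofReal_mul (by positivity), inv_mul_cancel₀ htk.ne', ENNReal.ofReal_one,
            one_mul]
  have hlim : Tendsto (fun k => eLpNorm (Q k - g) 1 volume) atTop (𝓝 0) := by
    rw [ENNReal.tendsto_nhds_zero]
    intro ε hε
    have h1 := (ENNReal.tendsto_nhds_zero.1 (tendsto_lintegral_translate_sub hgi v)) ε hε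
    obtain ⟨δ, hδ, h2⟩ := Metric.eventually_nhds_iff.1 h1
    filter_upwards [ht.eventually (gt_mem_nhds hδ)] with k hk
    refine hbound k ε fun s hs => h2 ?_
    rw [dist_zero_right, Real.norm_eq_abs, abs_of_pos hs.1]
    exact hs.2.trans_lt hk
  exact (tendstoInMeasure_of_tendsto_eLpNorm one_ne_zero hQm
    hgi.aestronglyMeasurable hlim).exists_seq_tendsto_ae

/-- The chain rule: pointwise a.e. identities `p = Ψ(u, w)` can be differentiated. -/
theorem ae_weakPartial_comp {Ω : Set (E n)} (hΩ : IsOpen Ω) {i : Fin n} {u u' w w' p p' : E n → ℝ}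
    (hu : IsWeakPartial Ω i u u') (hw : IsWeakPartial Ω i w w') (hp : IsWeakPartial Ω i p p')
    {Ψ : ℝ × ℝ → ℝ} {Ψ' : ℝ × ℝ → ℝ × ℝ →L[ℝ] ℝ} {O : Set (ℝ × ℝ)}
    (hΨ : ∀ q ∈ O, HasFDerivAt Ψ (Ψ' q) q)
    (hmem : ∀ᵐ x ∂volume.restrict Ω, (u x, w x) ∈ O)
    (hpe : ∀ᵐ x ∂volume.restrict Ω, p x = Ψ (u x, w x)) :
    ∀ᵐ x ∂volume.restrict Ω, p' x = Ψ' (u x, w x) (u' x, w' x) := by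
  rw [ae_restrict_iff' hΩ.measurableSet] at hmem hpe ⊢
  rw [ae_iff]
  refine measure_null_of_locally_null _ fun x₀ hx₀ => ?_
  have hx₀Ω : x₀ ∈ Ω := by
    by_contra hn
    exact hx₀ fun hx => absurd hx hn
  obtain ⟨ρ, hρ, hρΩ⟩ := Metric.isOpen_iff.1 hΩ x₀ hx₀Ω
  set r := ρ / 4 with hr
  have hr0 : 0 < r := by positivity
  -- The cutoff is 1 on the ball of radius `2r`, so it affects neither a point of the ball of radius
  -- `r` nor its short translates.
  let η : ContDiffBump x₀ := ⟨2 * r, 3 * r, by positivity, by linarith⟩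
  have hηs : tsupport η ⊆ Ω := by
    rw [η.tsupport_eq]
    refine (Metric.closedBall_subset_ball ?_).trans hρΩ
    change 3 * r < ρ
    linarith
  have hη1 : ∀ x ∈ Metric.ball x₀ (2 * r), η x = 1 := fun x hx =>
    η.one_of_mem_closedBall (Metric.ball_subset_closedBall hx)
  set v : E n := EuclideanSpace.single i 1 with hv
  have hv1 : ‖v‖ = 1 := by simp [hv]
  have hη'1 : ∀ x ∈ Metric.ball x₀ (2 * r), fderiv ℝ η x = 0 := fun x hx => by
    have : (η : E n → ℝ) =ᶠ[𝓝 x] fun _ => 1 := by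
      filter_upwards [Metric.isOpen_ball.mem_nhds hx] with y hy using hη1 y hy
    rw [this.fderiv_eq]; simp
  set R := ‖x₀‖ + 4 * r with hR
  have hη0 : ∀ x, R ≤ ‖x‖ → x ∉ tsupport η := fun x hx hx' => by
    rw [η.tsupport_eq, Metric.mem_closedBall, dist_eq_norm] at hx'
    have h1 : ‖x - x₀‖ ≤ 3 * r := hx'
    have := norm_le_norm_add_norm_sub' x x₀
    linarith
  have seq : ∀ {f f' : E n → ℝ}, IsWeakPartial Ω i f f' → ∀ t : ℕ → ℝ, Tendsto t atTop (𝓝 0) →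
      (∀ k, 0 < t k) → ∃ ns : ℕ → ℕ, StrictMono ns ∧ ∀ᵐ x, Tendsto
      (fun k => (t (ns k))⁻¹ * (η (x + t (ns k) • v) * f (x + t (ns k) • v) - η x * f x)) atTop
        (𝓝 (η x * f' x + f x * fderiv ℝ η x v)) := by
    intro f f' hf t ht ht0
    refine (hf.weakDir_cutoff η.contDiff η.hasCompactSupport hηs).exists_seq_tendsto hv1 (R := R)
      (fun x hx => ?_) (fun x hx => ?_) ht ht0
    · rw [image_eq_zero_of_notMem_tsupport (hη0 x hx), zero_mul]
    · rw [image_eq_zero_of_notMem_tsupport (hη0 x hx),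
        image_eq_zero_of_notMem_tsupport (f := fderiv ℝ η)
          (fun hx' => hη0 x hx (tsupport_fderiv_subset ℝ hx'))]
      simp
  -- Three successive extractions produce one sequence of steps along which the quotients of `u`,
  -- `w` and `p` all converge.
  obtain ⟨a, ha, hua⟩ := seq hu (fun k => 1 / ((k : ℝ) + 1))
    tendsto_one_div_add_atTop_nhds_zero_nat (fun k => by positivity)
  obtain ⟨b, hb, hwb⟩ := seq hw (fun k => 1 / ((a k : ℝ) + 1))
    (tendsto_one_div_add_atTop_nhds_zero_nat.comp ha.tendsto_atTop) (fun k => by positivity)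
  obtain ⟨c, hc, hpc⟩ := seq hp (fun k => 1 / ((a (b k) : ℝ) + 1))
    (tendsto_one_div_add_atTop_nhds_zero_nat.comp
      (ha.tendsto_atTop.comp hb.tendsto_atTop)) (fun k => by positivity)
  set t : ℕ → ℝ := fun k => 1 / ((a (b (c k)) : ℝ) + 1) with ht
  have ht0 : ∀ k, 0 < t k := fun k => by positivity
  have htlim : Tendsto t atTop (𝓝 0) := tendsto_one_div_add_atTop_nhds_zero_nat.comp
      (ha.tendsto_atTop.comp (hb.tendsto_atTop.comp hc.tendsto_atTop))
  have hpt : ∀ᵐ x, ∀ k, x + t k • v ∈ Ω →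
      p (x + t k • v) = Ψ (u (x + t k • v), w (x + t k • v)) :=
    ae_all_iff.2 fun k =>
      (measurePreserving_add_right volume (t k • v)).quasiMeasurePreserving.ae hpe
  refine ⟨Metric.ball x₀ r ∩ {x | ¬(x ∈ Ω → p' x = Ψ' (u x, w x) (u' x, w' x))},
    inter_comm _ _ ▸ inter_mem_nhdsWithin _ (Metric.ball_mem_nhds x₀ hr0), ?_⟩
  have hfin : ∀ᵐ x, x ∈ Metric.ball x₀ r → x ∈ Ω → p' x = Ψ' (u x, w x) (u' x, w' x) := by
    filter_upwards [hua, hwb, hpc, hpt, hmem, hpe] with x hux hwx hpx hptx hmx hpex hxr hxΩ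
    have hx2 : x ∈ Metric.ball x₀ (2 * r) := Metric.ball_subset_ball (by linarith) hxr
    have hux' := hux.comp (hb.tendsto_atTop.comp hc.tendsto_atTop)
    have hwx' := hwx.comp hc.tendsto_atTop
    rw [hη1 x hx2, hη'1 x hx2] at hux' hwx' hpx
    simp only [one_mul, _root_.zero_apply, mul_zero, add_zero] at hux' hwx' hpx
    have hev : ∀ᶠ k in atTop, x + t k • v ∈ Metric.ball x₀ (2 * r) := by
      have h1 : Tendsto (fun k => x + t k • v) atTop (𝓝 x) := by
        have := (htlim.smul_const v).const_add x
        simpa using this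
      exact h1.eventually (Metric.isOpen_ball.mem_nhds hx2)
    have hu1 : Tendsto (fun k => (t k)⁻¹ * (u (x + t k • v) - u x)) atTop (𝓝 (u' x)) := by
      refine hux'.congr' ?_
      filter_upwards [hev] with k hk
      simp only [Function.comp_apply]
      rw [show (1 / ((a (b (c k)) : ℝ) + 1)) = t k from rfl, hη1 _ hk, one_mul]
    have hw1 : Tendsto (fun k => (t k)⁻¹ * (w (x + t k • v) - w x)) atTop (𝓝 (w' x)) := by
      refine hwx'.congr' ?_
      filter_upwards [hev] with k hk
      simp only [Function.comp_apply]
      rw [show (1 / ((a (b (c k)) : ℝ) + 1)) = t k from rfl, hη1 _ hk, one_mul]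
    have hp1 : Tendsto (fun k => (t k)⁻¹ * (p (x + t k • v) - p x)) atTop (𝓝 (p' x)) := by
      refine hpx.congr' ?_
      filter_upwards [hev] with k hk
      rw [show (1 / ((a (b (c k)) : ℝ) + 1)) = t k from rfl, hη1 _ hk, one_mul]
    have hcd : Tendsto
        (fun k => (t k)⁻¹ • (u (x + t k • v) - u x, w (x + t k • v) - w x)) atTop
        (𝓝 (u' x, w' x)) := by
      simpa using hu1.prodMk_nhds hw1
    have hd : Tendsto (fun k => (u (x + t k • v) - u x, w (x + t k • v) - w x)) atTop (𝓝 0) := by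
      have h1 := htlim.smul hcd
      rw [zero_smul] at h1
      refine h1.congr fun k => ?_
      rw [smul_smul, mul_inv_cancel₀ (ht0 k).ne', one_smul]
    -- Only differentiability of `Ψ` at the one point `(u x, w x)` enters: the increments tend to
    -- zero and their rescalings converge.
    have hlim := ((hΨ _ (hmx hxΩ)).hasFDerivWithinAt (s := univ)).lim hd
      (Eventually.of_forall fun _ => mem_univ _) hcd
    refine tendsto_nhds_unique hp1 (hlim.congr' ?_)
    filter_upwards [hev] with k hk
    have hkΩ : x + t k • v ∈ Ω := hηs (subset_tsupport _ (by
      rw [Function.mem_support, hη1 _ hk]; exact one_ne_zero))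
    rw [hptx k hkΩ, hpex hxΩ]
    simp
  refine measure_mono_null ?_ hfin
  rintro x ⟨hx1, hx2⟩ hx3
  exact hx2 (hx3 hx1)

end

section

/-! ### Traces as strong limits of averages -/

/-- `f` has trace `a` at `x`: the averages of `|f - a|` over `Ω ∩ B(x, r)` tend to zero. -/
def HasTrace {n : ℕ} (Ω : Set (E n)) (f : E n → ℝ) (x : E n) (a : ℝ) : Prop :=
  Tendsto (fun r : ℝ => (∫⁻ y in Ω ∩ Metric.ball x r, ‖f y - a‖ₑ) /
    volume (Ω ∩ Metric.ball x r)) (𝓝[>] 0) (𝓝 0)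

section Trace

variable {n : ℕ} {Ω : Set (E n)} {f : E n → ℝ} {x : E n} {a : ℝ}

theorem volume_inter_ball_pos (hΩ : IsOpen Ω) (hx : x ∈ closure Ω) {r : ℝ} (hr : 0 < r) :
    0 < volume (Ω ∩ Metric.ball x r) := by
  refine (hΩ.inter Metric.isOpen_ball).measure_pos _ ?_
  rw [inter_comm]
  exact mem_closure_iff.1 hx _ Metric.isOpen_ball (Metric.mem_ball_self hr)

theorem volume_inter_ball_lt_top (Ω : Set (E n)) (x : E n) (r : ℝ) :
    volume (Ω ∩ Metric.ball x r) < ⊤ :=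
  (measure_mono inter_subset_right).trans_lt measure_ball_lt_top

/-- An average of `f` is within the average of `|f - a|` of `a`. Hence the limsup is a genuine,
finite limit. -/
theorem HasTrace.canonicalValue_eq (h : HasTrace Ω f x a) (hΩ : IsOpen Ω) (hf : IntegrableOn f Ω)
    (hx : x ∈ closure Ω) : canonicalValue Ω f x = a := by
  have h1 : Tendsto (fun r : ℝ => ⨍ y in Ω ∩ Metric.ball x r, f y) (𝓝[>] 0) (𝓝 a) := by
    rw [tendsto_iff_edist_tendsto_0]
    refine tendsto_of_tendsto_of_tendsto_of_le_of_le' tendsto_const_nhds h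
      (Eventually.of_forall fun _ => zero_le) ?_
    filter_upwards [self_mem_nhdsWithin] with r hr
    have hpos := volume_inter_ball_pos hΩ hx hr
    have hfin := volume_inter_ball_lt_top Ω x r
    have hfi : IntegrableOn f (Ω ∩ Metric.ball x r) := hf.mono_set inter_subset_left
    have hreal : 0 < volume.real (Ω ∩ Metric.ball x r) := ENNReal.toReal_pos hpos.ne' hfin.ne
    have e1 : (⨍ y in Ω ∩ Metric.ball x r, f y) - a =
        (volume.real (Ω ∩ Metric.ball x r))⁻¹ * ∫ y in Ω ∩ Metric.ball x r, (f y - a) := by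
      rw [integral_sub hfi (integrableOn_const hfin.ne), setAverage_eq, setIntegral_const]
      simp only [smul_eq_mul]
      field_simp
    rw [edist_eq_enorm_sub, e1, enorm_mul, Real.enorm_eq_ofReal (by positivity),
      ENNReal.ofReal_inv_of_pos hreal, measureReal_def, ENNReal.ofReal_toReal hfin.ne,
      ENNReal.div_eq_inv_mul]
    exact mul_le_mul_right (enorm_integral_le_lintegral_enorm _) _
  exact (continuous_coe_real_ereal.tendsto a |>.comp h1).limsup_eq

theorem HasTrace.congr {Ω' : Set (E n)} {f' : E n → ℝ} (h : HasTrace Ω f x a)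
    (hΩ : ∀ᶠ y in 𝓝 x, y ∈ Ω' ↔ y ∈ Ω) (hf : ∀ᶠ y in 𝓝 x, y ∈ Ω → f' y = f y)
    (hm : MeasurableSet Ω) : HasTrace Ω' f' x a := by
  obtain ⟨ρ, hρ, hρ'⟩ := Metric.eventually_nhds_iff_ball.1 (hΩ.and hf)
  refine Tendsto.congr' ?_ h
  filter_upwards [Ioo_mem_nhdsGT hρ] with r hr
  have hset : Ω' ∩ Metric.ball x r = Ω ∩ Metric.ball x r := by
    ext y
    refine and_congr_left fun hy => ?_
    exact (hρ' y (Metric.ball_subset_ball hr.2.le hy)).1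
  rw [hset]
  congr 1
  refine setLIntegral_congr_fun (hm.inter Metric.isOpen_ball.measurableSet) fun y hy => ?_
  simp only [(hρ' y (Metric.ball_subset_ball hr.2.le hy.2)).2 hy.1]

theorem HasTrace.mul (h : HasTrace Ω f x a) (hm : MeasurableSet Ω) {b : E n → ℝ}
    (hb : ContinuousWithinAt b Ω x) : HasTrace Ω (fun y => b y * f y) x (b x * a) := by
  have hC : Tendsto (fun r : ℝ => ENNReal.ofReal (|b x| + 1) *
      ((∫⁻ y in Ω ∩ Metric.ball x r, ‖f y - a‖ₑ) / volume (Ω ∩ Metric.ball x r)))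
      (𝓝[>] 0) (𝓝 0) := by
    simpa using ENNReal.Tendsto.const_mul h (Or.inr (ENNReal.ofReal_ne_top (r := |b x| + 1)))
  unfold HasTrace
  rw [ENNReal.tendsto_nhds_zero]
  intro ε hε
  -- In `b y f y - b x a = b y (f y - a) + (b y - b x) a` the last term costs `δ |a|`, which gets
  -- half of the tolerance.
  obtain ⟨δ, hδ0, hδε⟩ : ∃ δ : ℝ, 0 < δ ∧ ENNReal.ofReal (δ * |a|) ≤ ε / 2 := by
    have h1 : Tendsto (fun δ : ℝ => ENNReal.ofReal (δ * |a|)) (𝓝[>] 0) (𝓝 0) := by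
      have : Continuous fun δ : ℝ => ENNReal.ofReal (δ * |a|) :=
        ENNReal.continuous_ofReal.comp (by fun_prop)
      have := (this.tendsto 0).mono_left (nhdsWithin_le_nhds (s := Ioi 0))
      simpa using this
    have h2 := (ENNReal.tendsto_nhds_zero.1 h1) (ε / 2) (ENNReal.half_pos hε.ne')
    obtain ⟨δ, hδ⟩ := (h2.and self_mem_nhdsWithin).exists
    exact ⟨δ, hδ.2, hδ.1⟩
  have hb1 : ∀ᶠ y in 𝓝[Ω] x, |b y - b x| < min δ 1 := by
    have := hb.eventually (Metric.ball_mem_nhds (b x) (lt_min hδ0 one_pos))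
    filter_upwards [this] with y hy
    rwa [← Real.dist_eq]
  rw [eventually_nhdsWithin_iff] at hb1
  obtain ⟨ρ, hρ, hρ'⟩ := Metric.eventually_nhds_iff_ball.1 hb1
  filter_upwards [Ioo_mem_nhdsGT hρ, (ENNReal.tendsto_nhds_zero.1 hC) (ε / 2)
    (ENNReal.half_pos hε.ne')] with r hr hr2
  have hpt : ∀ y ∈ Ω ∩ Metric.ball x r, ‖b y * f y - b x * a‖ₑ ≤
      ENNReal.ofReal (|b x| + 1) * ‖f y - a‖ₑ + ENNReal.ofReal (δ * |a|) := by
    intro y hy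
    have h1 := hρ' y (Metric.ball_subset_ball hr.2.le hy.2) hy.1
    have h2 : |b y| ≤ |b x| + 1 := by
      have := abs_sub_abs_le_abs_sub (b y) (b x)
      have := h1.le.trans (min_le_right _ _)
      linarith
    have h3 : |b y - b x| ≤ δ := h1.le.trans (min_le_left _ _)
    rw [Real.enorm_eq_ofReal_abs, Real.enorm_eq_ofReal_abs, ← ENNReal.ofReal_mul (by positivity),
      ← ENNReal.ofReal_add (by positivity) (by positivity)]
    refine ENNReal.ofReal_le_ofReal ?_
    have e1 : b y * f y - b x * a = b y * (f y - a) + (b y - b x) * a := by ring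
    rw [e1]
    refine (abs_add_le _ _).trans ?_
    rw [abs_mul, abs_mul]
    gcongr
  have hI : ∫⁻ y in Ω ∩ Metric.ball x r, ‖b y * f y - b x * a‖ₑ ≤
      ENNReal.ofReal (|b x| + 1) * (∫⁻ y in Ω ∩ Metric.ball x r, ‖f y - a‖ₑ) +
        ENNReal.ofReal (δ * |a|) * volume (Ω ∩ Metric.ball x r) := by
    refine (setLIntegral_mono' (hm.inter Metric.isOpen_ball.measurableSet) hpt).trans ?_
    rw [lintegral_add_right _ measurable_const, lintegral_const_mul' _ _ ENNReal.ofReal_ne_top,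
      setLIntegral_const]
  refine (ENNReal.div_le_div_right hI _).trans ?_
  rw [ENNReal.add_div, mul_div_assoc, mul_div_assoc]
  refine (add_le_add hr2 ?_).trans (ENNReal.add_halves ε).le
  refine le_trans ?_ hδε
  calc _ ≤ ENNReal.ofReal (δ * |a|) * 1 := mul_le_mul_right ENNReal.div_self_le_one _
    _ = _ := mul_one _

end Trace

/-! ### Existence of traces on Lipschitz graphs -/

namespace Frame

variable {m : ℕ} {F : Frame m} {ψ : E m → ℝ}

/-- The part of a subgraph over `A` that is closer than `d` to the graph (in coordinates). -/
def slab (ψ : E m → ℝ) (A : Set (E m)) (d : ℝ) : Set (E m × ℝ) :=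
  {p | p.1 ∈ A ∧ p.2 ∈ Ioo (ψ p.1 - d) (ψ p.1)}

theorem measurableSet_slab (hψ : Continuous ψ) {A : Set (E m)} (hA : MeasurableSet A) (d : ℝ) :
    MeasurableSet (slab ψ A d) := by
  have h1 : MeasurableSet {p : E m × ℝ | ψ p.1 - d < p.2} :=
    measurableSet_lt (by fun_prop) (by fun_prop)
  have h2 : MeasurableSet {p : E m × ℝ | p.2 < ψ p.1} :=
    measurableSet_lt (by fun_prop) (by fun_prop)
  have : slab ψ A d = Prod.fst ⁻¹' A ∩ ({p | ψ p.1 - d < p.2} ∩ {p | p.2 < ψ p.1}) := rfl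
  rw [this]
  exact (measurable_fst hA).inter (h1.inter h2)

theorem lintegral_slab (hψ : Continuous ψ) {A : Set (E m)} (hA : MeasurableSet A) (d : ℝ)
    {H : E m → ℝ≥0∞} (hH : AEMeasurable H volume) :
    ∫⁻ p in slab ψ A d, H p.1 = ENNReal.ofReal d * ∫⁻ y in A, H y := by
  have hm := measurableSet_slab hψ hA d
  rw [← lintegral_indicator hm, Measure.volume_eq_prod, lintegral_prod]
  · rw [← lintegral_const_mul' _ _ ENNReal.ofReal_ne_top, ← lintegral_indicator hA]
    refine lintegral_congr fun y => ?_
    by_cases hy : y ∈ A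
    · have : ∀ t : ℝ, (slab ψ A d).indicator (fun p => H p.1) (y, t) =
          (Ioo (ψ y - d) (ψ y)).indicator (fun _ => H y) t := by
        intro t
        by_cases ht : t ∈ Ioo (ψ y - d) (ψ y)
        · rw [indicator_of_mem ht, indicator_of_mem]
          exact ⟨hy, ht⟩
        · rw [indicator_of_notMem ht, indicator_of_notMem]
          exact fun h => ht h.2
      simp_rw [this]
      rw [lintegral_indicator measurableSet_Ioo, setLIntegral_const, Real.volume_Ioo,
        indicator_of_mem hy, sub_sub_cancel, mul_comm]
    · have : ∀ t : ℝ, (slab ψ A d).indicator (fun p => H p.1) (y, t) = 0 := fun t =>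
        indicator_of_notMem (fun h => hy h.1) _
      simp [this, hy]
  · exact (hH.comp_quasiMeasurePreserving Measure.quasiMeasurePreserving_fst).indicator hm

theorem volume_slab (hψ : Continuous ψ) {A : Set (E m)} (hA : MeasurableSet A) (d : ℝ) :
    volume (slab ψ A d) = ENNReal.ofReal d * volume A := by
  have := lintegral_slab hψ hA d (H := fun _ => 1) aemeasurable_const
  simpa using this

/-- In the ball, `ψ z - t ≤ |ψ z - ψ y| + |ψ y - t|` is less than `K r + r`. Slabs are preferred to
balls because Fubini's theorem reduces their integrals to the base. -/
theorem coord_preimage_subset_slab {K : NNReal} (hψ : LipschitzWith K ψ) (y : E m) (r : ℝ) :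
    F.coord ⁻¹' (F.subgraph ψ ∩ Metric.ball (F.graph ψ y) r) ⊆
      slab ψ (Metric.closedBall y r) ((1 + K) * r) := by
  rintro ⟨z, t⟩ ⟨h1, h2⟩
  rw [coord_mem_subgraph] at h1
  rw [Metric.mem_ball, dist_eq_norm, graph, coord_sub] at h2
  have h3 := (F.norm_le_norm_coord (z - y) (t - ψ y)).trans_lt h2
  have h4 := (F.abs_le_norm_coord (z - y) (t - ψ y)).trans_lt h2
  have h5 := hψ.dist_le_mul z y
  rw [Real.dist_eq, dist_eq_norm] at h5
  have h6 : (K : ℝ) * ‖z - y‖ ≤ K * r := mul_le_mul_of_nonneg_left h3.le K.coe_nonneg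
  refine ⟨by rw [Metric.mem_closedBall, dist_eq_norm]; exact h3.le, ?_, h1⟩
  have := (abs_lt.1 h4).1
  have := (abs_le.1 (h5.trans h6)).2
  simp only
  linarith

theorem slab_subset_coord_preimage {K : NNReal} (hψ : LipschitzWith K ψ) (y : E m) {r : ℝ}
    (hr : 0 < r) : slab ψ (Metric.closedBall y (r / (K + 3))) (r / (K + 3)) ⊆
      F.coord ⁻¹' (F.subgraph ψ ∩ Metric.ball (F.graph ψ y) r) := by
  rintro ⟨z, t⟩ ⟨h1, h2, h3⟩
  -- The distance to the centre is at most `ρ + (ρ + K ρ) = (K + 2) ρ`, strictly less than `r`.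
  set ρ := r / ((K : ℝ) + 3) with hρ
  have hK : (0 : ℝ) ≤ K := K.coe_nonneg
  have hρr : (K + 3) * ρ = r := by rw [hρ]; field_simp
  have hρ0 : 0 < ρ := by positivity
  simp only at h1 h2 h3
  rw [Metric.mem_closedBall, dist_eq_norm] at h1
  refine ⟨coord_mem_subgraph.2 h3, ?_⟩
  rw [Metric.mem_ball, dist_eq_norm, graph, coord_sub]
  refine (F.norm_coord_le _ _).trans_lt ?_
  have h5 := hψ.dist_le_mul z y
  rw [Real.dist_eq, dist_eq_norm] at h5
  have h6 : (K : ℝ) * ‖z - y‖ ≤ K * ρ := mul_le_mul_of_nonneg_left h1 hK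
  have h7 := abs_le.1 (h5.trans h6)
  have h8 : |t - ψ y| ≤ ρ + K * ρ := abs_le.2 ⟨by linarith [h7.1], by nlinarith [h7.2]⟩
  linarith

/-- The subgraph fills a fixed proportion of each ball centred on the graph, so averages over it are
controlled by averages over a slab. -/
theorem volume_subgraph_inter_ball_ge {K : NNReal} (hψ : LipschitzWith K ψ) (y : E m) {r : ℝ}
    (hr : 0 < r) : ENNReal.ofReal r * volume (Metric.closedBall y r) ≤
      ENNReal.ofReal (((K : ℝ) + 3) ^ (m + 1)) *
        volume (F.subgraph ψ ∩ Metric.ball (F.graph ψ y) r) := by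
  have hK : (0 : ℝ) ≤ K := K.coe_nonneg
  have h1 := measure_mono (μ := volume) (slab_subset_coord_preimage (F := F) hψ y hr)
  rw [volume_slab hψ.continuous Metric.isClosed_closedBall.measurableSet,
    F.measurePreserving_coord.measure_preimage_emb F.measurableEmbedding_coord] at h1
  refine le_trans (le_of_eq ?_) (mul_le_mul_right h1 _)
  have hρ : 0 ≤ r / ((K : ℝ) + 3) := by positivity
  rw [Measure.addHaar_closedBall _ _ hr.le, Measure.addHaar_closedBall _ _ hρ]
  simp only [finrank_euclideanSpace, Fintype.card_fin]
  rw [← mul_assoc, ← mul_assoc, ← mul_assoc, ← ENNReal.ofReal_mul hr.le,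
    ← ENNReal.ofReal_mul (by positivity), ← ENNReal.ofReal_mul (by positivity)]
  congr 2
  rw [div_pow]
  field_simp
  rw [pow_succ']

/-- Existence of the trace on the graph, for a function that is weakly differentiable in the
vertical direction. -/
theorem exists_trace {K : NNReal} (hψ : LipschitzWith K ψ) {f g : E (m + 1) → ℝ}
    (h : WeakDir (F.subgraph ψ) F.e f g) {R : ℝ} (hf : ∀ x, R ≤ ‖x‖ → f x = 0)
    (hg : ∀ x, R ≤ ‖x‖ → g x = 0) :
    ∃ T : E m → ℝ, Integrable T ∧ ∫ y, T y = ∫ x in F.subgraph ψ, g x ∧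
      ∀ᵐ y, HasTrace (F.subgraph ψ) f (F.graph ψ y) (T y) := by
  set S := F.subgraph ψ with hS
  have hSo : IsOpen S := isOpen_subgraph hψ.continuous
  set g' : E (m + 1) → ℝ := S.indicator g with hg'
  have hg'i : Integrable g' := (integrable_indicator_iff hSo.measurableSet).2 h.2.1
  set G : E m × ℝ → ℝ := fun p => g' (F.coord p) with hG
  have hGi : Integrable G := F.measurePreserving_coord.integrable_comp_of_integrable hg'i
  have hG0 : ∀ y s, ψ y ≤ s → G (y, s) = 0 := fun y s hs =>
    indicator_of_notMem (fun hmem => (coord_mem_subgraph.1 hmem).not_ge hs) _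
  have hGS : ∀ y s, s < ψ y → G (y, s) = g (F.coord (y, s)) := fun y s hs =>
    indicator_of_mem (coord_mem_subgraph.2 hs) _
  -- The trace candidate integrates `g` over the entire vertical line under the graph; Fubini's
  -- theorem makes its integral that of `g`.
  set T : E m → ℝ := fun y => ∫ s, G (y, s) with hT
  have hTi : Integrable T := hGi.integral_prod_left
  have hTint : ∫ y, T y = ∫ x in S, g x := by
    rw [← integral_indicator hSo.measurableSet, ← F.measurePreserving_coord.integral_comp
      F.measurableEmbedding_coord]
    exact (integral_prod G hGi).symm
  -- the tails of `G`
  set L : ℝ → E m → ℝ≥0∞ := fun δ y => ∫⁻ s in Ioo (ψ y - δ) (ψ y), ‖G (y, s)‖ₑ with hL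
  have hLprod : ∀ δ y, L δ y = ∫⁻ s, (slab ψ univ δ).indicator (fun p => ‖G p‖ₑ) (y, s) := by
    intro δ y
    simp only [hL]
    rw [← lintegral_indicator measurableSet_Ioo]
    refine lintegral_congr fun s => ?_
    by_cases hs : s ∈ Ioo (ψ y - δ) (ψ y)
    · rw [indicator_of_mem hs, indicator_of_mem]
      exact ⟨mem_univ _, hs⟩
    · rw [indicator_of_notMem hs, indicator_of_notMem]
      exact fun h => hs h.2
  have hLm : ∀ δ, AEMeasurable (L δ) volume := by
    intro δ
    have h1 : AEMeasurable ((slab ψ univ δ).indicator fun p => ‖G p‖ₑ)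
        ((volume : Measure (E m)).prod volume) :=
      hGi.aestronglyMeasurable.enorm.indicator
        (measurableSet_slab hψ.continuous MeasurableSet.univ δ)
    have := h1.lintegral_prod_right'
    simpa only [← hLprod] using this
  have hLfin : ∀ δ, ∫⁻ y, L δ y ≠ ⊤ := by
    intro δ
    refine ne_top_of_le_ne_top hGi.2.ne ?_
    rw [Measure.volume_eq_prod, lintegral_prod _ hGi.aestronglyMeasurable.enorm]
    exact lintegral_mono fun y => setLIntegral_le_lintegral _ _
  have hline : ∀ᵐ y, Integrable fun s => G (y, s) := hGi.prod_right_ae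
  -- pointwise comparison of `f` with its trace
  have hcmp : ∀ᵐ p : E m × ℝ, ∀ δ, p.2 ∈ Ioo (ψ p.1 - δ) (ψ p.1) →
      ‖f (F.coord p) - T p.1‖ₑ ≤ L δ p.1 := by
    have h1 : ∀ᵐ p : E m × ℝ, F.coord p ∈ S →
        f (F.coord p) = ∫ s in Ioi (0 : ℝ), g (F.coord p - s • F.e) :=
      F.measurePreserving_coord.quasiMeasurePreserving.ae
        (h.ae_eq_integral hSo F.norm_e (by
          intro x hx s hs
          obtain ⟨⟨y, t⟩, rfl⟩ := F.homeo.surjective x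
          have hx' : F.coord (y, t) ∈ F.subgraph ψ := hx
          change F.coord (y, t) - s • F.e ∈ F.subgraph ψ
          rw [coord_mem_subgraph] at hx'
          rw [coord_sub_smul, coord_mem_subgraph]
          linarith) hf hg)
    have h2 : ∀ᵐ p : E m × ℝ, Integrable fun s => G (p.1, s) :=
      Measure.quasiMeasurePreserving_fst.ae hline
    filter_upwards [h1, h2] with p hp1 hp2 δ hδ
    obtain ⟨y, t⟩ := p
    simp only at hδ hp2 ⊢
    have hmem : F.coord (y, t) ∈ S := coord_mem_subgraph.2 hδ.2
    have e1 : f (F.coord (y, t)) = ∫ s in Iio t, G (y, s) := by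
      rw [hp1 hmem]
      have := (Measure.measurePreserving_sub_left (volume : Measure ℝ) t).setIntegral_preimage_emb
        (MeasurableEquiv.subLeft t).measurableEmbedding (fun s => G (y, s)) (Iio t)
      rw [← this]
      have hpre : (fun s : ℝ => t - s) ⁻¹' Iio t = Ioi 0 := by ext s; simp
      rw [hpre]
      refine setIntegral_congr_fun measurableSet_Ioi fun s hs => ?_
      have hs' : (0 : ℝ) < s := hs
      change _ = G (y, t - s)
      rw [hGS y _ (by linarith [hδ.2]), coord_sub_smul]
    -- What separates `f` at height `t` from the trace is the integral of `g` between `t` and the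
    -- graph, a tail that `L δ` bounds.
    have e2 : T y - f (F.coord (y, t)) = ∫ s in Ici t, G (y, s) := by
      rw [e1]
      simp only [hT]
      rw [← integral_add_compl (measurableSet_Iio (a := t)) hp2, compl_Iio]
      ring
    have e3 : ∫ s in Ici t, G (y, s) = ∫ s in Ico t (ψ y), G (y, s) := by
      refine setIntegral_eq_of_subset_of_forall_sdiff_eq_zero measurableSet_Ici
        Ico_subset_Ici_self fun s hs => hG0 y s ?_
      by_contra! hlt
      exact hs.2 ⟨hs.1, hlt⟩
    rw [← enorm_neg, neg_sub, e2, e3]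
    refine (enorm_integral_le_lintegral_enorm _).trans ?_
    exact lintegral_mono_set fun s hs => ⟨hδ.1.trans_le hs.1, hs.2⟩
  -- Lebesgue points
  have hleb1 := (Besicovitch.vitaliFamily (volume : Measure (E m))
    ).ae_tendsto_lintegral_enorm_sub_div_of_integrable hTi
  -- Only the heights `1/(k + 1)` are used, so that countably many exceptional sets occur.
  have hleb2 : ∀ᵐ y : E m, ∀ k : ℕ, Tendsto
      (fun A => (∫⁻ z in A, L (1 / ((k : ℝ) + 1)) z) / volume A)
      ((Besicovitch.vitaliFamily (volume : Measure (E m))).filterAt y)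
      (𝓝 (L (1 / ((k : ℝ) + 1)) y)) :=
    ae_all_iff.2 fun k => (Besicovitch.vitaliFamily (volume : Measure (E m))
      ).ae_tendsto_lintegral_div (hLm _) (hLfin _)
  refine ⟨T, hTi, hTint, ?_⟩
  filter_upwards [hleb1, hleb2, hline] with y hy1 hy2 hy3
  -- The factor `1 + K` comes from the height of the outer slab, `(K + 3)^(m + 1)` from the volume
  -- comparison.
  set C : ℝ≥0∞ := ENNReal.ofReal ((1 + K) * ((K : ℝ) + 3) ^ (m + 1)) with hC
  have hCtop : C ≠ ⊤ := ENNReal.ofReal_ne_top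
  have hL0 : Tendsto (fun k : ℕ => C * L (1 / ((k : ℝ) + 1)) y) atTop (𝓝 0) := by
    have h1 : Tendsto (fun k : ℕ => L (1 / ((k : ℝ) + 1)) y) atTop (𝓝 0) := by
      refine tendsto_setLIntegral_zero hy3.2.ne ?_
      have h2 : Tendsto (fun k : ℕ => ENNReal.ofReal (1 / ((k : ℝ) + 1))) atTop (𝓝 0) := by
        have := (ENNReal.continuous_ofReal.tendsto 0).comp
          (tendsto_one_div_add_atTop_nhds_zero_nat (𝕜 := ℝ))
        rwa [ENNReal.ofReal_zero] at this
      refine h2.congr fun k => ?_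
      simp [Real.volume_Ioo]
    simpa using ENNReal.Tendsto.const_mul h1 (Or.inr hCtop)
  unfold HasTrace
  rw [ENNReal.tendsto_nhds_zero]
  intro ε hε
  -- The height `δ` is fixed first, making `C * L δ y < ε`. Letting `r → 0` at the Lebesgue point
  -- `y` then sends the average of `|T z - T y|` to zero and that of `L δ` to `L δ y`.
  obtain ⟨k, hk⟩ := (hL0.eventually (gt_mem_nhds hε)).exists
  set δ : ℝ := 1 / ((k : ℝ) + 1) with hδ
  have hδ0 : 0 < δ := by positivity
  have hK : (0 : ℝ) ≤ K := K.coe_nonneg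
  have hballs := Besicovitch.tendsto_filterAt (volume : Measure (E m)) y
  have hlim : Tendsto (fun r => C * ((∫⁻ z in Metric.closedBall y r, ‖T z - T y‖ₑ) /
      volume (Metric.closedBall y r) + (∫⁻ z in Metric.closedBall y r, L δ z) /
      volume (Metric.closedBall y r))) (𝓝[>] 0) (𝓝 (C * (0 + L δ y))) :=
    ENNReal.Tendsto.const_mul ((hy1.comp hballs).add ((hy2 k).comp hballs)) (Or.inr hCtop)
  rw [zero_add] at hlim
  have hsmall : ∀ᶠ r : ℝ in 𝓝[>] 0, (1 + K) * r < δ := by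
    have hc : Continuous fun r : ℝ => (1 + (K : ℝ)) * r := by fun_prop
    have := (hc.tendsto 0).mono_left (nhdsWithin_le_nhds (s := Ioi 0))
    rw [mul_zero] at this
    exact this.eventually (gt_mem_nhds hδ0)
  filter_upwards [hlim.eventually (gt_mem_nhds hk), hsmall, self_mem_nhdsWithin] with r hr1 hr2 hr
  have hr0 : 0 < r := hr
  refine le_trans ?_ hr1.le
  set V := volume (S ∩ Metric.ball (F.graph ψ y) r) with hV
  set I := ∫⁻ z in Metric.closedBall y r, (‖T z - T y‖ₑ + L δ z) with hI
  have hTm : AEMeasurable (fun z => ‖T z - T y‖ₑ) volume :=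
    (hTi.aestronglyMeasurable.sub aestronglyMeasurable_const).enorm
  have hinteg : ∫⁻ x in S ∩ Metric.ball (F.graph ψ y) r, ‖f x - T y‖ₑ ≤
      ENNReal.ofReal ((1 + K) * r) * I := by
    rw [← F.measurePreserving_coord.setLIntegral_comp_preimage_emb F.measurableEmbedding_coord]
    refine (lintegral_mono_set (coord_preimage_subset_slab hψ y r)).trans ?_
    rw [hI, ← lintegral_slab (H := fun z => ‖T z - T y‖ₑ + L δ z) hψ.continuous
      Metric.isClosed_closedBall.measurableSet _ (hTm.add (hLm δ))]
    refine lintegral_mono_ae ?_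
    filter_upwards [ae_restrict_of_ae hcmp, ae_restrict_mem (measurableSet_slab hψ.continuous
      Metric.isClosed_closedBall.measurableSet _)] with p hp hps
    have h1 := hp δ ⟨by linarith [hps.2.1], hps.2.2⟩
    calc ‖f (F.coord p) - T y‖ₑ = ‖(T p.1 - T y) + (f (F.coord p) - T p.1)‖ₑ := by
          congr 1; ring
      _ ≤ ‖T p.1 - T y‖ₑ + ‖f (F.coord p) - T p.1‖ₑ := enorm_add_le _ _
      _ ≤ _ := by gcongr
  have hvol := volume_subgraph_inter_ball_ge (F := F) hψ y hr0
  have hB0 : volume (Metric.closedBall y r) ≠ 0 := (Metric.measure_closedBall_pos _ _ hr0).ne'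
  have hBt : volume (Metric.closedBall y r) ≠ ⊤ := measure_closedBall_lt_top.ne
  have hV0 : V ≠ 0 := by
    intro h0
    rw [← hV, h0, mul_zero, nonpos_iff_eq_zero, mul_eq_zero] at hvol
    rcases hvol with h1 | h1
    · exact (ENNReal.ofReal_pos.2 hr0).ne' h1
    · exact hB0 h1
  have hVt : V ≠ ⊤ := (volume_inter_ball_lt_top S _ _).ne
  rw [← ENNReal.add_div, ← lintegral_add_left' hTm.restrict]
  refine (ENNReal.div_le_div_right hinteg _).trans ?_
  rw [ENNReal.div_le_iff hV0 hVt, hC, ENNReal.ofReal_mul (by positivity),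
    ENNReal.ofReal_mul (by positivity)]
  calc ENNReal.ofReal (1 + K) * ENNReal.ofReal r * I
      = ENNReal.ofReal (1 + K) * (I / volume (Metric.closedBall y r)) *
        (ENNReal.ofReal r * volume (Metric.closedBall y r)) := by
        rw [mul_assoc, mul_assoc]
        congr 1
        rw [mul_left_comm, ENNReal.div_mul_cancel hB0 hBt]
    _ ≤ ENNReal.ofReal (1 + K) * (I / volume (Metric.closedBall y r)) *
        (ENNReal.ofReal (((K : ℝ) + 3) ^ (m + 1)) * V) := mul_le_mul_right hvol _
    _ = _ := by ring

end Frame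

end

section

/-! ### Change of the vertical direction of a subgraph -/

theorem exists_zero_of_slope {Λ : ℝ → ℝ} (hΛ : Continuous Λ) {c : ℝ} (hc : 0 < c)
    (hslope : ∀ s t, s ≤ t → c * (t - s) ≤ Λ t - Λ s) : ∃ t, Λ t = 0 := by
  set a := |Λ 0| / c with ha
  have ha0 : 0 ≤ a := by positivity
  have hca : c * a = |Λ 0| := by rw [ha]; field_simp
  have h1 := hslope 0 a ha0
  have h2 := hslope (-a) 0 (by linarith)
  have h3 := neg_abs_le (Λ 0)
  have h4 := le_abs_self (Λ 0)
  have hmem : (0 : ℝ) ∈ Icc (Λ (-a)) (Λ a) := ⟨by linarith, by linarith⟩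
  obtain ⟨t, -, ht⟩ := intermediate_value_Icc (by linarith : -a ≤ a) hΛ.continuousOn hmem
  exact ⟨t, ht⟩

/-- A Lipschitz subgraph is also one for the slightly tilted axis proportional to `F.e + s v`, and
`v` is a combination of the two axes. Thus the divergence theorem in vertical directions implies it
in direction `v`. -/
theorem Frame.exists_subgraph_eq {m : ℕ} (F : Frame m) {ψ : E m → ℝ} {K : NNReal}
    (hψ : LipschitzWith K ψ) (v : E (m + 1)) :
    ∃ (F' : Frame m) (ψ' : E m → ℝ) (K' : NNReal), LipschitzWith K' ψ' ∧
      F'.subgraph ψ' = F.subgraph ψ ∧ ∃ α β : ℝ, v = α • F.e + β • F'.e := by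
  have hK : (0 : ℝ) ≤ K := K.coe_nonneg
  have hv : 0 ≤ ‖v‖ := norm_nonneg v
  -- So small that `(1 + K) s ‖v‖ ≤ 1/2`; the defining function then grows along `q` at rate at
  -- least `1 - (1 + K) s ‖v‖ ≥ 1/2`.
  set s : ℝ := 1 / (2 * (1 + K) * (‖v‖ + 1)) with hs
  have hs0 : 0 < s := by positivity
  have hsv : (1 + K) * (s * ‖v‖) ≤ 1 / 2 := by
    rw [hs]
    rw [show (1 + (K : ℝ)) * (1 / (2 * (1 + K) * (‖v‖ + 1)) * ‖v‖) =
      (1 / 2) * (‖v‖ / (‖v‖ + 1)) by field_simp]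
    have : ‖v‖ / (‖v‖ + 1) ≤ 1 := div_le_one_of_le₀ (by linarith) (by linarith)
    linarith
  set q : E (m + 1) := F.e + s • v with hq
  have hinner : (1 : ℝ) - s * ‖v‖ ≤ inner ℝ F.e q := by
    rw [hq, inner_add_right, inner_smul_right, real_inner_self_eq_norm_sq, F.norm_e]
    have h1 := neg_le_of_abs_le (abs_real_inner_le_norm F.e v)
    rw [F.norm_e, one_mul] at h1
    nlinarith
  have hq0 : q ≠ 0 := by
    intro h0
    rw [h0, inner_zero_right] at hinner
    nlinarith [mul_nonneg hK (mul_nonneg hs0.le hv)]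
  set N := ‖q‖ with hN
  have hN0 : 0 < N := norm_pos_iff.2 hq0
  obtain ⟨F', hF'⟩ := exists_frame (N⁻¹ • q) (by
    rw [norm_smul, Real.norm_eq_abs, abs_of_pos (inv_pos.2 hN0), inv_mul_cancel₀ hN0.ne'])
  -- `Λ` is negative exactly on the subgraph. Being strictly increasing along the new axis, it has a
  -- single zero on each line, which is the height of the new graph.
  set Λ : E (m + 1) → ℝ := fun x => inner ℝ F.e x - ψ (F.pr x) with hΛ
  have hΛc : Continuous Λ := by
    have := hψ.continuous
    fun_prop
  have hΛL : ∀ x y, |Λ x - Λ y| ≤ (1 + K) * ‖x - y‖ := by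
    intro x y
    have e1 : Λ x - Λ y = inner ℝ F.e (x - y) - (ψ (F.pr x) - ψ (F.pr y)) := by
      simp only [hΛ, inner_sub_right]; ring
    have h1 := abs_real_inner_le_norm F.e (x - y)
    rw [F.norm_e, one_mul] at h1
    have h2 := hψ.dist_le_mul (F.pr x) (F.pr y)
    rw [Real.dist_eq, dist_eq_norm, ← map_sub] at h2
    have h3 := mul_le_mul_of_nonneg_left (F.norm_pr_le (x - y)) hK
    rw [e1]
    refine (abs_sub _ _).trans ?_
    linarith
  set c : ℝ := N⁻¹ / 2 with hc
  have hc0 : 0 < c := by positivity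
  have hslope : ∀ x (t : ℝ), 0 ≤ t → c * t ≤ Λ (x + t • F'.e) - Λ x := by
    intro x t ht
    have e1 : t • F'.e = (t * N⁻¹) • q := by rw [hF', smul_smul]
    set τ := t * N⁻¹ with hτ
    have hτ0 : 0 ≤ τ := by positivity
    have e2 : Λ (x + τ • q) - Λ x =
        τ * inner ℝ F.e q - (ψ (F.pr (x + τ • q)) - ψ (F.pr x)) := by
      simp only [hΛ, inner_add_right, inner_smul_right]; ring
    have h2 := hψ.dist_le_mul (F.pr (x + τ • q)) (F.pr x)
    rw [Real.dist_eq, dist_eq_norm, ← map_sub, add_sub_cancel_left, map_smul, norm_smul,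
      Real.norm_eq_abs, abs_of_nonneg hτ0] at h2
    have h3 : ‖F.pr q‖ ≤ s * ‖v‖ := by
      rw [hq, map_add, F.pr_e, zero_add, map_smul, norm_smul, Real.norm_eq_abs, abs_of_pos hs0]
      exact mul_le_mul_of_nonneg_left (F.norm_pr_le v) hs0.le
    have h4 : (K : ℝ) * (τ * ‖F.pr q‖) ≤ K * (τ * (s * ‖v‖)) := by gcongr
    have h5 := (abs_le.1 (h2.trans h4)).2
    have h6 := mul_le_mul_of_nonneg_left hinner hτ0
    have h7 := mul_le_mul_of_nonneg_left hsv hτ0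
    rw [e1, e2]
    have e3 : c * t = τ * (1 / 2) := by rw [hc, hτ]; ring
    rw [e3]
    nlinarith
  have hcoord : ∀ z (a b : ℝ), a ≤ b → c * (b - a) ≤ Λ (F'.coord (z, b)) - Λ (F'.coord (z, a)) := by
    intro z a b hab
    have := hslope (F'.coord (z, a)) (b - a) (by linarith)
    rwa [F'.coord_add_smul, add_sub_cancel] at this
  have hex : ∀ z, ∃ t, Λ (F'.coord (z, t)) = 0 := fun z =>
    exists_zero_of_slope (Λ := fun t => Λ (F'.coord (z, t)))
      (hΛc.comp (F'.continuous_coord.comp (by fun_prop))) hc0 (hcoord z)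
  choose ψ' hψ' using hex
  have habs : ∀ z (a b : ℝ), c * |b - a| ≤ |Λ (F'.coord (z, b)) - Λ (F'.coord (z, a))| := by
    intro z a b
    rcases le_total a b with hab | hab
    · rw [abs_of_nonneg (by linarith : 0 ≤ b - a)]
      exact (hcoord z a b hab).trans (le_abs_self _)
    · rw [abs_sub_comm b a, abs_of_nonneg (by linarith : 0 ≤ a - b), abs_sub_comm]
      exact (hcoord z b a hab).trans (le_abs_self _)
  -- `Λ` is `(1 + K)`-Lipschitz and has slope at least `c` along the axis, whence the constant `(1 +
  -- K) / c`. The coefficients solve `F.e + s v = N F'.e` for `v`.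
  refine ⟨F', ψ', ⟨(1 + K) / c, by positivity⟩, ?_, ?_, -s⁻¹, s⁻¹ * N, ?_⟩
  · refine LipschitzWith.of_dist_le_mul fun z z' => ?_
    rw [Real.dist_eq, dist_eq_norm]
    change |ψ' z - ψ' z'| ≤ (1 + K) / c * ‖z - z'‖
    have h1 := habs z' (ψ' z') (ψ' z)
    rw [hψ' z', ← hψ' z] at h1
    have h2 := hΛL (F'.coord (z', ψ' z)) (F'.coord (z, ψ' z))
    rw [F'.coord_sub, sub_self] at h2
    have h3 := F'.norm_coord_le (z' - z) 0
    rw [abs_zero, add_zero, norm_sub_rev] at h3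
    have h4 : c * |ψ' z - ψ' z'| ≤ (1 + K) * ‖z - z'‖ :=
      h1.trans (h2.trans (mul_le_mul_of_nonneg_left h3 (by positivity)))
    rw [div_mul_eq_mul_div, le_div_iff₀ hc0]
    linarith
  · ext x
    obtain ⟨⟨z, t⟩, rfl⟩ := F'.homeo.surjective x
    change F'.coord (z, t) ∈ _ ↔ F'.coord (z, t) ∈ _
    rw [coord_mem_subgraph]
    have hmem : F'.coord (z, t) ∈ F.subgraph ψ ↔ Λ (F'.coord (z, t)) < 0 := by
      simp only [hΛ, sub_neg]; rfl
    rw [hmem]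
    constructor
    · intro ht
      have := hcoord z t (ψ' z) ht.le
      rw [hψ' z] at this
      nlinarith
    · intro ht
      by_contra! hle
      have := hcoord z (ψ' z) t hle
      rw [hψ' z] at this
      nlinarith
  · rw [hF', smul_smul, mul_assoc, mul_inv_cancel₀ hN0.ne', mul_one, hq, smul_add, smul_smul,
      inv_mul_cancel₀ hs0.ne', one_smul, neg_smul]
    abel

/-! ### Localization -/

section Localize

variable {n : ℕ}

theorem integrableOn_of_inter_eq {μ : Measure (E n)} {S Ω t : Set (E n)} (hS : MeasurableSet S)
    (h : S ∩ t = Ω ∩ t) {k : E n → ℝ} (hk : ∀ x ∉ t, k x = 0)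
    (hi : IntegrableOn k Ω μ) : IntegrableOn k S μ := by
  refine IntegrableOn.of_forall_sdiff_eq_zero (hi.mono_set (inter_subset_left (t := t))) hS ?_
  intro x hx
  refine hk x fun hxt => hx.2 ?_
  rw [← h]
  exact ⟨hx.1, hxt⟩

theorem setIntegral_of_inter_eq {μ : Measure (E n)} {S Ω t : Set (E n)} (hS : MeasurableSet S)
    (hΩ : MeasurableSet Ω) (h : S ∩ t = Ω ∩ t) {k : E n → ℝ} (hk : ∀ x ∉ t, k x = 0) :
    ∫ x in S, k x ∂μ = ∫ x in Ω, k x ∂μ := by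
  rw [setIntegral_eq_of_subset_of_forall_sdiff_eq_zero hS (inter_subset_left (t := t))
      fun x hx => hk x fun hxt => hx.2 ⟨hx.1, hxt⟩,
    setIntegral_eq_of_subset_of_forall_sdiff_eq_zero hΩ (inter_subset_left (t := t))
      fun x hx => hk x fun hxt => hx.2 ⟨hx.1, hxt⟩, h]

theorem fderiv_apply_eq_zero_of_notMem_tsupport {η : E n → ℝ} {x : E n} (hx : x ∉ tsupport η)
    (v : E n) : fderiv ℝ η x v = 0 := by
  rw [image_eq_zero_of_notMem_tsupport (fun hx' => hx (tsupport_fderiv_subset ℝ hx'))]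
  rfl

theorem WeakDir.integrableOn_cutoff {Ω : Set (E n)} {v : E n} {f g η : E n → ℝ}
    (h : WeakDir Ω v f g) (hη : ContDiff ℝ 1 η) (hηc : HasCompactSupport η) :
    IntegrableOn (fun x => η x * g x + f x * fderiv ℝ η x v) Ω := by
  have i1 : IntegrableOn (fun x => η x * g x) Ω := by
    simpa [mul_comm] using integrableOn_mul_of_continuous h.2.1 hη.continuous hηc
  exact i1.add (integrableOn_mul_of_continuous h.1
    (continuous_fderiv_apply_of_contDiff hη v) (hasCompactSupport_fderiv_apply hηc v))

/-- Multiplication by a cutoff function supported where `Ω` and `S` agree turns a weakly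
differentiable function on `Ω` into one on `S`. -/
theorem WeakDir.cutoff {Ω S : Set (E n)} (hΩ : IsOpen Ω) (hS : IsOpen S) {v : E n}
    {f g η : E n → ℝ} (h : WeakDir Ω v f g) (hη : ContDiff ℝ 1 η) (hηc : HasCompactSupport η)
    (hηs : S ∩ tsupport η = Ω ∩ tsupport η) :
    WeakDir S v (fun x => η x * f x) (fun x => η x * g x + f x * fderiv ℝ η x v) := by
  have hη0 : ∀ x ∉ tsupport η, η x = 0 := fun x hx => image_eq_zero_of_notMem_tsupport hx
  have hη'0 : ∀ x ∉ tsupport η, fderiv ℝ η x v = 0 := fun x hx =>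
    fderiv_apply_eq_zero_of_notMem_tsupport hx v
  have i1 : IntegrableOn (fun x => η x * f x) Ω := by
    simpa [mul_comm] using integrableOn_mul_of_continuous h.1 hη.continuous hηc
  have i2 := h.integrableOn_cutoff hη hηc
  refine ⟨integrableOn_of_inter_eq hS.measurableSet hηs (fun x hx => by rw [hη0 x hx, zero_mul]) i1,
    integrableOn_of_inter_eq hS.measurableSet hηs
      (fun x hx => by rw [hη0 x hx, hη'0 x hx]; ring) i2, fun φ hφ hφc hφs => ?_⟩
  rw [setIntegral_of_inter_eq hS.measurableSet hΩ.measurableSet hηs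
      (fun x hx => by simp only [hη0 x hx]; ring),
    setIntegral_of_inter_eq hS.measurableSet hΩ.measurableSet hηs
      (fun x hx => by simp only [hη0 x hx, hη'0 x hx]; ring)]
  have hts : tsupport (fun x => η x * φ x) ⊆ Ω := by
    intro x hx
    have h1 : x ∈ tsupport η := closure_mono (Function.support_mul_subset_left η φ) hx
    have h2 : x ∈ tsupport φ := closure_mono (Function.support_mul_subset_right η φ) hx
    have h3 : x ∈ S ∩ tsupport η := ⟨hφs h2, h1⟩
    rw [hηs] at h3
    exact h3.1
  have hηφ : ContDiff ℝ 1 fun x => η x * φ x := hη.mul hφ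
  have hηφc : HasCompactSupport fun x => η x * φ x := hφc.mul_left
  have key := h.2.2 _ hηφ hηφc hts
  have hder : ∀ x, fderiv ℝ (fun x => η x * φ x) x v =
      η x * fderiv ℝ φ x v + φ x * fderiv ℝ η x v := by
    intro x
    rw [fderiv_fun_mul (hη.differentiable one_ne_zero x) (hφ.differentiable one_ne_zero x)]
    simp
  have j1 : IntegrableOn (fun x => f x * fderiv ℝ η x v * φ x) Ω :=
    integrableOn_mul_of_continuous (integrableOn_mul_of_continuous h.1
      (continuous_fderiv_apply_of_contDiff hη v) (hasCompactSupport_fderiv_apply hηc v))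
      hφ.continuous hφc
  have e1 : ∫ x in Ω, η x * f x * fderiv ℝ φ x v =
      (∫ x in Ω, f x * fderiv ℝ (fun x => η x * φ x) x v) -
        ∫ x in Ω, f x * fderiv ℝ η x v * φ x := by
    rw [← integral_sub _ j1]
    · refine integral_congr_ae (ae_of_all _ fun x => ?_)
      simp only [hder]; ring
    · exact integrableOn_mul_of_continuous h.1 (continuous_fderiv_apply_of_contDiff hηφ v)
        (hasCompactSupport_fderiv_apply hηφc v)
  have e2 : ∫ x in Ω, (η x * g x + f x * fderiv ℝ η x v) * φ x =
      (∫ x in Ω, g x * (η x * φ x)) + ∫ x in Ω, f x * fderiv ℝ η x v * φ x := by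
    rw [← integral_add _ j1]
    · refine integral_congr_ae (ae_of_all _ fun x => ?_)
      simp only; ring
    · exact integrableOn_mul_of_continuous h.2.1 hηφ.continuous hηφc
  rw [e1, e2, key]
  ring

theorem mem_frontier_congr {Ω S : Set (E n)} {x : E n} (h : ∀ᶠ y in 𝓝 x, y ∈ Ω ↔ y ∈ S) :
    x ∈ frontier Ω ↔ x ∈ frontier S := by
  rw [frontier_eq_closure_inter_closure, frontier_eq_closure_inter_closure, mem_inter_iff,
    mem_inter_iff, mem_closure_iff_frequently, mem_closure_iff_frequently,
    mem_closure_iff_frequently, mem_closure_iff_frequently, frequently_congr h,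
    frequently_congr (p := (· ∈ Ωᶜ)) (q := (· ∈ Sᶜ)) (h.mono fun y hy => not_congr hy)]

end Localize

end

section

/-! ### The divergence theorem in a chart -/

/-- The boundary value of `f`. -/
def trace {n : ℕ} (Ω : Set (E n)) (f : E n → ℝ) (x : E n) : ℝ := (canonicalValue Ω f x).toReal

theorem HasTrace.trace_eq {n : ℕ} {Ω : Set (E n)} {f : E n → ℝ} {x : E n} {a : ℝ}
    (h : HasTrace Ω f x a) (hΩ : IsOpen Ω) (hf : IntegrableOn f Ω)
    (hx : x ∈ closure Ω) : trace Ω f x = a := by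
  rw [trace, h.canonicalValue_eq hΩ hf hx, EReal.toReal_coe]

theorem hasTrace_zero {n : ℕ} (Ω : Set (E n)) (x : E n) : HasTrace Ω (fun _ => 0) x 0 := by
  unfold HasTrace
  simp

variable {m : ℕ}

/-- On `U`, the set `Ω` is the subgraph of a Lipschitz function in the coordinates `F`. -/
structure IsGraphChart (Ω U : Set (E (m + 1))) (F : Frame m) (ψ : E m → ℝ) (K : NNReal) :
    Prop where
  isOpen : IsOpen U
  lipschitz : LipschitzWith K ψ
  mem_iff : ∀ x ∈ U, x ∈ Ω ↔ x ∈ F.subgraph ψ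

theorem HasLipschitzBoundary.exists_chart {Ω : Set (E (m + 1))} (h : HasLipschitzBoundary Ω)
    {p : E (m + 1)} (hp : p ∈ frontier Ω) :
    ∃ U F ψ K, p ∈ U ∧ IsGraphChart Ω U F ψ K := by
  obtain ⟨U, hU, hpU, e, he, K, φ, hφ, hmem⟩ := h p hp
  obtain ⟨F, rfl⟩ := exists_frame e he
  refine ⟨U, F, fun y => φ (F.ι y), K, hpU, hU, ?_, fun x hx => ?_⟩
  · have := hφ.comp F.ι.lipschitz
    rwa [mul_one] at this
  · rw [hmem x hx]
    have : x - (inner ℝ F.e x : ℝ) • F.e = F.ι (F.pr x) := by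
      rw [sub_eq_iff_eq_add]; exact (F.decomp x).symm
    rw [this]
    rfl

theorem IsGraphChart.mono {Ω U V : Set (E (m + 1))} {F : Frame m} {ψ : E m → ℝ} {K : NNReal}
    (h : IsGraphChart Ω U F ψ K) (hV : IsOpen V) (hVU : V ⊆ U) : IsGraphChart Ω V F ψ K :=
  ⟨hV, h.lipschitz, fun x hx => h.mem_iff x (hVU hx)⟩

/-- Projecting the graph to its base does not increase distances, so a null set of the graph lies
over a null set. -/
theorem ae_graph_of_ae {F : Frame m} {ψ : E m → ℝ} {p : E (m + 1) → Prop}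
    (h : ∀ᵐ x ∂(μHE[m] : Measure (E (m + 1))), x ∈ range (F.graph ψ) → p x) :
    ∀ᵐ y, p (F.graph ψ y) := by
  have h1 := euclideanHausdorffMeasure_image_le_image (f := fun y : E m => y) (g := F.graph ψ)
    (s := {y | ¬ p (F.graph ψ y)}) (K := 1) (fun y _ z _ => by
      rw [NNReal.coe_one, one_mul, dist_eq_norm, dist_eq_norm, Frame.graph, Frame.graph,
        Frame.coord_sub]
      exact F.norm_le_norm_coord _ _) m
  rw [image_id', EuclideanSpace.euclideanHausdorffMeasure_eq_volume] at h1
  rw [ae_iff]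
  refine le_antisymm (h1.trans ?_) zero_le
  rw [ENNReal.coe_one, one_pow, one_mul]
  refine (measure_mono ?_).trans h.le
  rintro _ ⟨y, hy, rfl⟩ hn
  exact hy (hn ⟨y, rfl⟩)

theorem Frame.graph_mem_closure {F : Frame m} {ψ : E m → ℝ} (hψ : Continuous ψ) (y : E m) :
    F.graph ψ y ∈ closure (F.subgraph ψ) := by
  have : F.graph ψ y ∈ frontier (F.subgraph ψ) := by
    rw [Frame.frontier_subgraph hψ]; exact ⟨y, rfl⟩
  exact frontier_subset_closure this

namespace IsGraphChart

variable {Ω U : Set (E (m + 1))} {F : Frame m} {ψ : E m → ℝ} {K : NNReal}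

theorem mem_frontier_iff (hc : IsGraphChart Ω U F ψ K) {x : E (m + 1)} (hx : x ∈ U) :
    x ∈ frontier Ω ↔ x ∈ range (F.graph ψ) := by
  rw [← Frame.frontier_subgraph hc.lipschitz.continuous]
  refine mem_frontier_congr ?_
  filter_upwards [hc.isOpen.mem_nhds hx] with y hy using hc.mem_iff y hy

theorem eventually_iff (hc : IsGraphChart Ω U F ψ K) {x : E (m + 1)} (hx : x ∈ U) :
    ∀ᶠ y in 𝓝 x, y ∈ Ω ↔ y ∈ F.subgraph ψ := by
  filter_upwards [hc.isOpen.mem_nhds hx] with y hy using hc.mem_iff y hy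

theorem inter_tsupport (hc : IsGraphChart Ω U F ψ K) {η : E (m + 1) → ℝ} (hη : tsupport η ⊆ U) :
    F.subgraph ψ ∩ tsupport η = Ω ∩ tsupport η := by
  ext x
  refine and_congr_left fun hx => ?_
  exact (hc.mem_iff x (hη hx)).symm

/-- The cutoff carries `f` from `Ω` to the full subgraph and supplies the bounded support that the
trace theorem needs. -/
theorem exists_trace_cutoff (hc : IsGraphChart Ω U F ψ K) (hΩ : IsOpen Ω)
    {f g η : E (m + 1) → ℝ} (h : WeakDir Ω F.e f g) (hη : ContDiff ℝ 1 η)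
    (hηc : HasCompactSupport η) (hηU : tsupport η ⊆ U) :
    ∃ T : E m → ℝ, Integrable T ∧
      ∫ y, T y = ∫ x in Ω, (η x * g x + f x * fderiv ℝ η x F.e) ∧
      IntegrableOn (fun x => η x * f x) (F.subgraph ψ) ∧
      ∀ᵐ y, HasTrace (F.subgraph ψ) (fun x => η x * f x) (F.graph ψ y) (T y) := by
  have hSo : IsOpen (F.subgraph ψ) := Frame.isOpen_subgraph hc.lipschitz.continuous
  have hη0 : ∀ x ∉ tsupport η, η x = 0 := fun x hx => image_eq_zero_of_notMem_tsupport hx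
  have hη'0 : ∀ x ∉ tsupport η, fderiv ℝ η x F.e = 0 := fun x hx =>
    fderiv_apply_eq_zero_of_notMem_tsupport hx F.e
  have hS := hc.inter_tsupport hηU
  have hW := h.cutoff hΩ hSo hη hηc hS
  obtain ⟨R, hR⟩ := hηc.isBounded.subset_ball 0
  have hR' : ∀ x, R ≤ ‖x‖ → x ∉ tsupport η := fun x hx hx' => by
    have := hR hx'
    rw [mem_ball_zero_iff] at this
    linarith
  obtain ⟨T, hT1, hT2, hT3⟩ := Frame.exists_trace hc.lipschitz hW (R := R)
    (fun x hx => by rw [hη0 x (hR' x hx), zero_mul])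
    (fun x hx => by rw [hη0 x (hR' x hx), hη'0 x (hR' x hx)]; ring)
  refine ⟨T, hT1, ?_, hW.1, hT3⟩
  rw [hT2]
  exact setIntegral_of_inter_eq hSo.measurableSet hΩ.measurableSet hS
    (fun x hx => by rw [hη0 x hx, hη'0 x hx]; ring)

/-- A cutoff equal to 1 near `p` does not change `f` there, so the trace of the product is that of
`f`. -/
theorem exists_nhds_ae_hasTrace (hc : IsGraphChart Ω U F ψ K) (hΩ : IsOpen Ω)
    {f g : E (m + 1) → ℝ} (h : WeakDir Ω F.e f g) {p : E (m + 1)} (hp : p ∈ U) :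
    ∃ V ∈ 𝓝 p, ∀ᵐ x ∂(μHE[m] : Measure (E (m + 1))), x ∈ V → x ∈ frontier Ω →
      (∃ ν, IsOuterNormal Ω x ν) ∧ ∃ a, HasTrace Ω f x a := by
  obtain ⟨ρ, hρ, hρU⟩ := Metric.isOpen_iff.1 hc.isOpen p hp
  let η : ContDiffBump p := ⟨ρ / 4, ρ / 2, by positivity, by linarith⟩
  have hηs : tsupport η ⊆ U := by
    rw [η.tsupport_eq]
    refine (Metric.closedBall_subset_ball ?_).trans hρU
    change ρ / 2 < ρ
    linarith
  obtain ⟨T, -, -, -, hT⟩ := hc.exists_trace_cutoff hΩ h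
    (η.contDiff (n := (1 : ℕ∞))) η.hasCompactSupport hηs
  have hdiff : ∀ᵐ y, DifferentiableAt ℝ ψ y := hc.lipschitz.ae_differentiableAt
  refine ⟨Metric.ball p (ρ / 4), Metric.ball_mem_nhds p (by positivity), ?_⟩
  filter_upwards [Frame.ae_range_graph (F := F) hc.lipschitz (p := fun x =>
    (∃ ν, IsOuterNormal (F.subgraph ψ) x ν) ∧
      ∃ a, HasTrace (F.subgraph ψ) (fun x => η x * f x) x a)
    (by
      filter_upwards [hT, hdiff] with y hy hy'
      exact ⟨⟨_, Frame.isOuterNormal_graph hy'⟩, ⟨T y, hy⟩⟩)] with x hx hxV hxΩ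
  have hxU : x ∈ U := hρU (Metric.ball_subset_ball (by linarith) hxV)
  obtain ⟨⟨ν, hν⟩, ⟨a, ha⟩⟩ := hx ((hc.mem_frontier_iff hxU).1 hxΩ)
  refine ⟨⟨ν, hν.congr (hc.isOpen.mem_nhds hxU) hc.mem_iff⟩, ⟨a, ha.congr (hc.eventually_iff hxU)
    ?_ (Frame.isOpen_subgraph hc.lipschitz.continuous).measurableSet⟩⟩
  filter_upwards [Metric.isOpen_ball.mem_nhds hxV] with y hy _
  have h1 : η y = 1 := η.one_of_mem_closedBall (Metric.ball_subset_closedBall hy)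
  rw [h1, one_mul]

/-- The divergence theorem in the vertical direction of a chart. -/
theorem integral_cutoff (hm : 0 < m) (hc : IsGraphChart Ω U F ψ K) (hΩ : IsOpen Ω)
    {f g η : E (m + 1) → ℝ} (h : WeakDir Ω F.e f g)
    (htr : ∀ᵐ x ∂(μHE[m] : Measure (E (m + 1))), x ∈ frontier Ω → HasTrace Ω f x (trace Ω f x))
    (hη : ContDiff ℝ 1 η) (hηc : HasCompactSupport η) (hηU : tsupport η ⊆ U) :
    IntegrableOn (fun x => η x * trace Ω f x * inner ℝ (outerNormal Ω x) F.e) (frontier Ω)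
        μHE[m] ∧
      ∫ x in Ω, (η x * g x + f x * fderiv ℝ η x F.e) =
        ∫ x in frontier Ω, η x * trace Ω f x * inner ℝ (outerNormal Ω x) F.e ∂μHE[m] := by
  obtain ⟨T, hT1, hT2, hT3, hT4⟩ := hc.exists_trace_cutoff hΩ h hη hηc hηU
  have hSo : IsOpen (F.subgraph ψ) := Frame.isOpen_subgraph hc.lipschitz.continuous
  have hη0 : ∀ x ∉ tsupport η, η x = 0 := fun x hx => image_eq_zero_of_notMem_tsupport hx
  have htr' : ∀ᵐ y, F.graph ψ y ∈ U → HasTrace Ω f (F.graph ψ y) (trace Ω f (F.graph ψ y)) := by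
    refine ae_graph_of_ae (p := fun x => x ∈ U → HasTrace Ω f x (trace Ω f x)) ?_
    filter_upwards [htr] with x hx hxr hxU
    exact hx ((hc.mem_frontier_iff hxU).2 hxr)
  have hdiff : ∀ᵐ y, DifferentiableAt ℝ ψ y := hc.lipschitz.ae_differentiableAt
  -- The area density cancels the vertical component of the normal. Where `η` vanishes nearby both
  -- sides are zero, so no information on `Ω` outside `U` is needed.
  have hTy : ∀ᵐ y, graphJac (fderiv ℝ ψ y) * (η (F.graph ψ y) * trace Ω f (F.graph ψ y) *
      inner ℝ (outerNormal Ω (F.graph ψ y)) F.e) = T y := by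
    filter_upwards [hT4, htr', hdiff] with y hy1 hy2 hy3
    set x := F.graph ψ y with hx
    have hxcl : x ∈ closure (F.subgraph ψ) := F.graph_mem_closure hc.lipschitz.continuous y
    have hT := hy1.trace_eq hSo hT3 hxcl
    by_cases hxt : x ∈ tsupport η
    · have hxU := hηU hxt
      have h1 : HasTrace (F.subgraph ψ) (fun z => η z * f z) x (η x * trace Ω f x) := by
        refine ((hy2 hxU).mul hΩ.measurableSet hη.continuous.continuousWithinAt).congr ?_
          (Eventually.of_forall fun _ _ => rfl) hΩ.measurableSet
        exact (hc.eventually_iff hxU).mono fun z hz => hz.symm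
      have h2 : outerNormal Ω x = F.normal (fderiv ℝ ψ y) :=
        ((Frame.isOuterNormal_graph hy3).congr (hc.isOpen.mem_nhds hxU) hc.mem_iff).outerNormal_eq
      rw [h2, Frame.inner_normal_e, ← hT, h1.trace_eq hSo hT3 hxcl]
      have := (graphJac_pos (fderiv ℝ ψ y)).ne'
      field_simp
    · have h1 : HasTrace (F.subgraph ψ) (fun z => η z * f z) x 0 := by
        refine (hasTrace_zero (F.subgraph ψ) x).congr (Eventually.of_forall fun _ => Iff.rfl) ?_
          hSo.measurableSet
        filter_upwards [(isClosed_tsupport η).isOpen_compl.mem_nhds hxt] with z hz _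
        rw [hη0 z hz, zero_mul]
      rw [← hT, h1.trace_eq hSo hT3 hxcl, hη0 x hxt]
      ring
  have hinter : frontier Ω ∩ tsupport η = range (F.graph ψ) ∩ tsupport η := by
    ext x
    exact and_congr_left fun hx => hc.mem_frontier_iff (hηU hx)
  have hzero : ∀ x ∉ tsupport η,
      η x * trace Ω f x * inner ℝ (outerNormal Ω x) F.e = 0 := fun x hx => by
    rw [hη0 x hx]; ring
  have hrange : MeasurableSet (range (F.graph ψ)) :=
    (Frame.measurableEmbedding_graph hc.lipschitz.continuous).measurableSet_range
  constructor
  · refine integrableOn_of_inter_eq isClosed_frontier.measurableSet hinter hzero ?_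
    rw [Frame.integrableOn_range_graph_iff hm hc.lipschitz]
    exact hT1.congr (hTy.mono fun y hy => hy.symm)
  · rw [setIntegral_of_inter_eq isClosed_frontier.measurableSet hrange hinter hzero,
      Frame.integral_range_graph hm hc.lipschitz, ← hT2]
    exact integral_congr_ae (hTy.mono fun y hy => hy.symm)

/-- The divergence theorem in a chart, in an arbitrary direction. -/
theorem integral_cutoff_dir (hm : 0 < m) (hc : IsGraphChart Ω U F ψ K) (hΩ : IsOpen Ω)
    {f : E (m + 1) → ℝ} {g : Fin (m + 1) → E (m + 1) → ℝ}
    (h : ∀ i, WeakDir Ω (EuclideanSpace.single i 1) f (g i))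
    (htr : ∀ᵐ x ∂(μHE[m] : Measure (E (m + 1))), x ∈ frontier Ω → HasTrace Ω f x (trace Ω f x))
    {η : E (m + 1) → ℝ}
    (hη : ContDiff ℝ 1 η) (hηc : HasCompactSupport η) (hηU : tsupport η ⊆ U) (v : E (m + 1)) :
    IntegrableOn (fun x => η x * trace Ω f x * inner ℝ (outerNormal Ω x) v) (frontier Ω)
        μHE[m] ∧
      ∫ x in Ω, (η x * (∑ i, v i * g i x) + f x * fderiv ℝ η x v) =
        ∫ x in frontier Ω, η x * trace Ω f x * inner ℝ (outerNormal Ω x) v ∂μHE[m] := by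
  -- The same piece of `Ω` is seen in two frames; both identities are linear in the direction and
  -- combine to the one for `v`.
  obtain ⟨F', ψ', K', hψ', hsub, α, β, hv⟩ := F.exists_subgraph_eq hc.lipschitz v
  have hc' : IsGraphChart Ω U F' ψ' K' := ⟨hc.isOpen, hψ', fun x hx => by
    rw [hsub]; exact hc.mem_iff x hx⟩
  have hd := WeakDir.of_partials (h 0).1 h
  obtain ⟨i1, e1⟩ := hc.integral_cutoff hm hΩ (hd F.e) htr hη hηc hηU
  obtain ⟨i2, e2⟩ := hc'.integral_cutoff hm hΩ (hd F'.e) htr hη hηc hηU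
  have hbd : (fun x => η x * trace Ω f x * inner ℝ (outerNormal Ω x) v) = fun x =>
      α * (η x * trace Ω f x * inner ℝ (outerNormal Ω x) F.e) +
        β * (η x * trace Ω f x * inner ℝ (outerNormal Ω x) F'.e) := by
    ext x
    rw [hv, inner_add_right, inner_smul_right, inner_smul_right]; ring
  have hin : ∀ x, η x * (∑ i, v i * g i x) + f x * fderiv ℝ η x v =
      α * (η x * (∑ i, F.e i * g i x) + f x * fderiv ℝ η x F.e) +
        β * (η x * (∑ i, F'.e i * g i x) + f x * fderiv ℝ η x F'.e) := by
    intro x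
    have : ∑ i, v i * g i x = α * (∑ i, F.e i * g i x) + β * ∑ i, F'.e i * g i x := by
      rw [Finset.mul_sum, Finset.mul_sum, ← Finset.sum_add_distrib]
      refine Finset.sum_congr rfl fun i _ => ?_
      rw [hv]
      simp only [PiLp.add_apply, PiLp.smul_apply, smul_eq_mul]
      ring
    rw [this, hv]
    simp only [map_add, map_smul, smul_eq_mul]
    ring
  constructor
  · rw [hbd]
    exact (i1.const_mul α).add (i2.const_mul β)
  · rw [hbd]
    simp_rw [hin]
    rw [integral_add (((hd F.e).integrableOn_cutoff hη hηc).const_mul α)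
        (((hd F'.e).integrableOn_cutoff hη hηc).const_mul β),
      integral_add (i1.const_mul α) (i2.const_mul β), integral_const_mul, integral_const_mul,
      integral_const_mul, integral_const_mul, e1, e2]

end IsGraphChart

end

section

variable {m : ℕ} {Ω : Set (E (m + 1))}

/-! ### The divergence theorem on a bounded Lipschitz domain -/

theorem IsBoundedLipschitzDomain.ae_hasTrace (hΩ : IsBoundedLipschitzDomain Ω)
    {f : E (m + 1) → ℝ} {g : Fin (m + 1) → E (m + 1) → ℝ}
    (h : ∀ i, WeakDir Ω (EuclideanSpace.single i 1) f (g i)) :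
    ∀ᵐ x ∂(μHE[m] : Measure (E (m + 1))), x ∈ frontier Ω →
      (∃ ν, IsOuterNormal Ω x ν) ∧ HasTrace Ω f x (trace Ω f x) := by
  rw [ae_iff]
  refine measure_null_of_locally_null _ fun p hp => ?_
  have hpΩ : p ∈ frontier Ω := by
    by_contra hn
    exact hp fun hx => absurd hx hn
  obtain ⟨U, F, ψ, K, hpU, hc⟩ := hΩ.lipschitz.exists_chart hpΩ
  obtain ⟨V, hV, hae⟩ := hc.exists_nhds_ae_hasTrace hΩ.isOpen
    (WeakDir.of_partials (h 0).1 h F.e) hpU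
  refine ⟨V ∩ {x | ¬(x ∈ frontier Ω → (∃ ν, IsOuterNormal Ω x ν) ∧ HasTrace Ω f x (trace Ω f x))},
    inter_comm _ _ ▸ inter_mem_nhdsWithin _ hV, measure_mono_null ?_ hae⟩
  rintro x ⟨hx1, hx2⟩ hx3
  refine hx2 fun hx => ?_
  obtain ⟨h1, a, ha⟩ := hx3 hx1 hx
  refine ⟨h1, ?_⟩
  rwa [ha.trace_eq hΩ.isOpen (h 0).1 (frontier_subset_closure hx)]

theorem exists_partition (hΩ : IsOpen Ω) (hb : Bornology.IsBounded Ω)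
    {P : Set (E (m + 1)) → Prop}
    (hP : ∀ p ∈ frontier Ω, ∃ U, IsOpen U ∧ Bornology.IsBounded U ∧ p ∈ U ∧ P U) :
    ∃ (ι : Type) (_ : Fintype ι) (ρ : ι → E (m + 1) → ℝ),
      (∀ i, ContDiff ℝ 1 (ρ i) ∧ HasCompactSupport (ρ i) ∧
        (tsupport (ρ i) ⊆ Ω ∨ ∃ U, P U ∧ tsupport (ρ i) ⊆ U)) ∧
      ∀ x ∈ closure Ω, ∑ i, ρ i x = 1 := by
  choose! U hU using hP
  have hcomp : IsCompact (frontier Ω) :=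
    hb.isCompact_closure.of_isClosed_subset isClosed_frontier frontier_subset_closure
  obtain ⟨t, ht, htc⟩ := hcomp.elim_nhds_subcover U
    fun p hp => (hU p hp).1.mem_nhds (hU p hp).2.2.1
  -- The index `none` stands for `Ω` itself. All members of the cover are bounded, so the supports
  -- are compact.
  let W : Option t → Set (E (m + 1)) := fun o => o.elim Ω fun p => U p
  have hWo : ∀ o, IsOpen (W o) := by
    rintro (_ | p)
    · exact hΩ
    · exact (hU p (ht p p.2)).1
  have hWb : ∀ o, Bornology.IsBounded (W o) := by
    rintro (_ | p)
    · exact hb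
    · exact (hU p (ht p p.2)).2.1
  have hcov : closure Ω ⊆ ⋃ o, W o := by
    intro x hx
    by_cases hxΩ : x ∈ Ω
    · exact mem_iUnion.2 ⟨none, hxΩ⟩
    · have hxf : x ∈ frontier Ω := by rw [hΩ.frontier_eq]; exact ⟨hx, hxΩ⟩
      obtain ⟨p, hp, hxp⟩ := mem_iUnion₂.1 (htc hxf)
      exact mem_iUnion.2 ⟨some ⟨p, hp⟩, hxp⟩
  obtain ⟨ρ, hρ⟩ := SmoothPartitionOfUnity.exists_isSubordinate
    (modelWithCornersSelf ℝ (E (m + 1))) (isClosed_closure (s := Ω)) W hWo hcov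
  let eqv := (Fintype.equivFin (Option t)).symm
  refine ⟨Fin (Fintype.card (Option t)), inferInstance, fun i => ρ (eqv i),
    fun i => ⟨?_, ?_, ?_⟩, fun x hx => ?_⟩
  · exact ((ρ (eqv i)).contMDiff.contDiff).of_le (by exact_mod_cast le_top)
  · exact Metric.isCompact_of_isClosed_isBounded (isClosed_tsupport _)
      ((hWb _).subset (hρ (eqv i)))
  · have := hρ (eqv i)
    change tsupport (ρ (eqv i)) ⊆ Ω ∨ ∃ U, P U ∧ tsupport (ρ (eqv i)) ⊆ U
    generalize eqv i = o at this ⊢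
    rcases o with _ | p
    · exact Or.inl this
    · exact Or.inr ⟨U p, (hU p (ht p p.2)).2.2.2, this⟩
  · rw [Equiv.sum_comp eqv fun o => ρ o x, ← finsum_eq_sum_of_fintype]
    exact ρ.sum_eq_one hx

/-- The divergence theorem for `W^{1,1}` functions. -/
theorem IsBoundedLipschitzDomain.integral_weakDir (hm : 0 < m) (hΩ : IsBoundedLipschitzDomain Ω)
    {f : E (m + 1) → ℝ} {g : Fin (m + 1) → E (m + 1) → ℝ}
    (h : ∀ i, WeakDir Ω (EuclideanSpace.single i 1) f (g i)) (v : E (m + 1)) :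
    IntegrableOn (fun x => trace Ω f x * inner ℝ (outerNormal Ω x) v) (frontier Ω) μHE[m] ∧
      ∫ x in Ω, ∑ i, v i * g i x =
        ∫ x in frontier Ω, trace Ω f x * inner ℝ (outerNormal Ω x) v ∂μHE[m] := by
  have htr : ∀ᵐ x ∂(μHE[m] : Measure (E (m + 1))), x ∈ frontier Ω →
      HasTrace Ω f x (trace Ω f x) := (hΩ.ae_hasTrace h).mono fun x hx hxf => (hx hxf).2
  have hd := WeakDir.of_partials (h 0).1 h v
  obtain ⟨ι, _, ρ, hρ, hsum⟩ := exists_partition hΩ.isOpen hΩ.isBounded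
    (P := fun U => ∃ F ψ K, IsGraphChart Ω U F ψ K) (fun p hp => by
      obtain ⟨U, F, ψ, K, hpU, hc⟩ := hΩ.lipschitz.exists_chart hp
      exact ⟨U ∩ Metric.ball p 1, hc.isOpen.inter Metric.isOpen_ball,
        Metric.isBounded_ball.subset inter_subset_right, ⟨hpU, Metric.mem_ball_self one_pos⟩,
        F, ψ, K, hc.mono (hc.isOpen.inter Metric.isOpen_ball) inter_subset_left⟩)
  have key : ∀ i, IntegrableOn (fun x => ρ i x * trace Ω f x * inner ℝ (outerNormal Ω x) v)
        (frontier Ω) μHE[m] ∧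
      ∫ x in Ω, (ρ i x * (∑ j, v j * g j x) + f x * fderiv ℝ (ρ i) x v) =
        ∫ x in frontier Ω, ρ i x * trace Ω f x * inner ℝ (outerNormal Ω x) v ∂μHE[m] := by
    intro i
    obtain ⟨h1, h2, h3 | ⟨U, ⟨F, ψ, K, hc⟩, h3⟩⟩ := hρ i
    -- An interior piece is itself a test function: the volume integral vanishes by the definition
    -- of the weak derivative, the boundary integrand pointwise.
    · have hz : ∀ x ∈ frontier Ω, ρ i x * trace Ω f x * inner ℝ (outerNormal Ω x) v = 0 := by
        intro x hx
        rw [hΩ.isOpen.frontier_eq] at hx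
        rw [image_eq_zero_of_notMem_tsupport fun hx' => hx.2 (h3 hx')]
        ring
      constructor
      · exact integrableOn_zero.congr_fun (fun x hx => (hz x hx).symm)
          isClosed_frontier.measurableSet
      · rw [setIntegral_eq_zero_of_forall_eq_zero hz]
        have := hd.2.2 (ρ i) h1 h2 h3
        rw [integral_add _ (integrableOn_mul_of_continuous hd.1
          (continuous_fderiv_apply_of_contDiff h1 v) (hasCompactSupport_fderiv_apply h2 v)), this]
        · simp only [mul_comm (ρ i _)]
          ring
        · simpa [mul_comm, IntegrableOn] using
            integrableOn_mul_of_continuous hd.2.1 h1.continuous h2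
    · exact hc.integral_cutoff_dir hm hΩ.isOpen h htr h1 h2 h3 v
  have hbd : ∀ x ∈ frontier Ω, ∑ i, ρ i x * trace Ω f x * inner ℝ (outerNormal Ω x) v =
      trace Ω f x * inner ℝ (outerNormal Ω x) v := by
    intro x hx
    rw [← Finset.sum_mul, ← Finset.sum_mul, hsum x (frontier_subset_closure hx), one_mul]
  have hin : ∀ x ∈ Ω, ∑ i, (ρ i x * (∑ j, v j * g j x) + f x * fderiv ℝ (ρ i) x v) =
      ∑ j, v j * g j x := by
    intro x hx
    -- The cutoffs sum to the constant 1 near each point of `Ω`, so the terms containing their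
    -- derivatives cancel.
    have hder : ∑ i, fderiv ℝ (ρ i) x v = 0 := by
      have h1 : fderiv ℝ (fun y => ∑ i, ρ i y) x = ∑ i, fderiv ℝ (ρ i) x :=
        fderiv_fun_sum fun i _ => (hρ i).1.differentiable one_ne_zero x
      have h2 : (fun y => ∑ i, ρ i y) =ᶠ[𝓝 x] fun _ => 1 := by
        filter_upwards [hΩ.isOpen.mem_nhds hx] with y hy using hsum y (subset_closure hy)
      rw [h2.fderiv_eq] at h1
      have h3 := congrArg (fun L : E (m + 1) →L[ℝ] ℝ => L v) h1
      simpa using h3.symm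
    rw [Finset.sum_add_distrib, ← Finset.sum_mul, hsum x (subset_closure hx), one_mul,
      ← Finset.mul_sum, hder, mul_zero, add_zero]
  constructor
  · refine IntegrableOn.congr_fun ?_ hbd isClosed_frontier.measurableSet
    exact integrable_finsetSum _ fun i _ => (key i).1
  · rw [← setIntegral_congr_fun hΩ.isOpen.measurableSet hin,
      ← setIntegral_congr_fun isClosed_frontier.measurableSet hbd,
      integral_finsetSum _ fun i _ => hd.integrableOn_cutoff (hρ i).1 (hρ i).2.1,
      integral_finsetSum _ fun i _ => (key i).1]
    exact Finset.sum_congr rfl fun i _ => (key i).2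

end

section

/-! ### Weak derivatives: uniqueness, composition, products -/

variable {n : ℕ} {Ω : Set (E n)} {i : Fin n} {f f' g g' : E n → ℝ}

theorem locallyIntegrableOn_congr (hf : LocallyIntegrableOn f Ω)
    (h : f =ᵐ[volume.restrict Ω] f') : LocallyIntegrableOn f' Ω := by
  intro x hx
  obtain ⟨s, hs, hfs⟩ := hf x hx
  refine ⟨s ∩ Ω, inter_mem hs self_mem_nhdsWithin, ?_⟩
  exact (hfs.mono_set inter_subset_left).congr
    (ae_mono (Measure.restrict_mono inter_subset_right le_rfl) h)

theorem IsWeakPartial.congr_left (h : IsWeakPartial Ω i f g)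
    (hf : f =ᵐ[volume.restrict Ω] f') : IsWeakPartial Ω i f' g := by
  refine ⟨locallyIntegrableOn_congr h.1 hf, h.2.1, fun φ h1 h2 h3 => ?_⟩
  rw [← h.2.2 φ h1 h2 h3]
  exact integral_congr_ae (hf.mono fun x hx => by simp only [hx])

/-- Uniqueness is the chain rule for the first projection, with `f` as its own composite. -/
theorem IsWeakPartial.ae_eq (hΩ : IsOpen Ω) (h : IsWeakPartial Ω i f g)
    (h' : IsWeakPartial Ω i f g') : g =ᵐ[volume.restrict Ω] g' :=
  (ae_weakPartial_comp hΩ h h h' (Ψ := Prod.fst) (Ψ' := fun _ => ContinuousLinearMap.fst ℝ ℝ ℝ)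
    (O := univ) (fun _ _ => hasFDerivAt_fst) (ae_of_all _ fun _ => mem_univ _)
    (ae_of_all _ fun _ => rfl)).mono fun _ hx => hx.symm

theorem IsWeakPartial.weakPartial (h : IsWeakPartial Ω i f g) :
    IsWeakPartial Ω i f (weakPartial Ω i f) := by
  have h' : ∃ g, IsWeakPartial Ω i f g := ⟨g, h⟩
  rw [EllipticIdentity.weakPartial, dif_pos h']
  exact h'.choose_spec

theorem MemW1.congr :
    ∀ {k : ℕ} {f f' : E n → ℝ}, MemW1 Ω k f → f =ᵐ[volume.restrict Ω] f' → MemW1 Ω k f'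
  | 0, _, _, h, hf => IntegrableOn.congr_fun_ae h hf
  | _ + 1, _, _, h, hf => ⟨h.1.congr_fun_ae hf, fun i =>
      let ⟨g, hg, hg'⟩ := h.2 i
      ⟨g, hg.congr_left hf, hg'⟩⟩

theorem MemW1Loc.congr :
    ∀ {k : ℕ} {f f' : E n → ℝ}, MemW1Loc Ω k f → f =ᵐ[volume.restrict Ω] f' → MemW1Loc Ω k f'
  | 0, _, _, h, hf => locallyIntegrableOn_congr h hf
  | _ + 1, _, _, h, hf => ⟨locallyIntegrableOn_congr h.1 hf, fun i =>
      let ⟨g, hg, hg'⟩ := h.2 i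
      ⟨g, hg.congr_left hf, hg'⟩⟩

/-- Uniqueness transfers the regularity of some weak derivative to the chosen one, so that
derivatives can be iterated. -/
theorem MemW1.weakPartial (hΩ : IsOpen Ω) {k : ℕ} (h : MemW1 Ω (k + 1) f) (i : Fin n) :
    IsWeakPartial Ω i f (weakPartial Ω i f) ∧ MemW1 Ω k (weakPartial Ω i f) := by
  obtain ⟨g, hg, hg'⟩ := h.2 i
  exact ⟨hg.weakPartial, hg'.congr (hg.ae_eq hΩ hg.weakPartial)⟩

theorem MemW1Loc.weakPartial (hΩ : IsOpen Ω) {k : ℕ} (h : MemW1Loc Ω (k + 1) f) (i : Fin n) :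
    IsWeakPartial Ω i f (weakPartial Ω i f) ∧ MemW1Loc Ω k (weakPartial Ω i f) := by
  obtain ⟨g, hg, hg'⟩ := h.2 i
  exact ⟨hg.weakPartial, hg'.congr (hg.ae_eq hΩ hg.weakPartial)⟩

theorem MemW1.integrableOn {k : ℕ} (h : MemW1 Ω k f) : IntegrableOn f Ω := by
  cases k
  exacts [h, h.1]

theorem MemW1.weakDir (hΩ : IsOpen Ω) (h : MemW1 Ω 1 f) (i : Fin n) :
    WeakDir Ω (EuclideanSpace.single i 1) f (EllipticIdentity.weakPartial Ω i f) :=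
  (h.weakPartial hΩ i).1.weakDir hΩ h.1 (h.weakPartial hΩ i).2

theorem ae_weakPartial_comp_one (hΩ : IsOpen Ω) {O : Set ℝ} {F F' : ℝ → ℝ}
    (hF : ∀ s ∈ O, HasDerivAt F (F' s) s) (hf : ∀ᵐ x ∂volume.restrict Ω, f x ∈ O)
    (h : IsWeakPartial Ω i f f') (h' : IsWeakPartial Ω i (fun x => F (f x)) g) :
    ∀ᵐ x ∂volume.restrict Ω, g x = F' (f x) * f' x := by
  have := ae_weakPartial_comp hΩ h h h' (Ψ := fun q => F q.1)
    (Ψ' := fun q => F' q.1 • ContinuousLinearMap.fst ℝ ℝ ℝ) (O := O ×ˢ univ)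
    (fun q hq => (hF q.1 hq.1).comp_hasFDerivAt q hasFDerivAt_fst)
    (hf.mono fun _ hx => ⟨hx, mem_univ _⟩) (ae_of_all _ fun _ => rfl)
  exact this.mono fun x hx => by simpa using hx

/-- The chain rule for `(s, t) ↦ F s * t`. It serves for `H(u) ∂ⱼu`, whose factors are only locally
integrable. -/
theorem ae_weakPartial_comp_mul (hΩ : IsOpen Ω) {O : Set ℝ} {F F' : ℝ → ℝ}
    (hF : ∀ s ∈ O, HasDerivAt F (F' s) s) (hf : ∀ᵐ x ∂volume.restrict Ω, f x ∈ O)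
    (h : IsWeakPartial Ω i f f') (hg : IsWeakPartial Ω i g g') {p p' : E n → ℝ}
    (hp : IsWeakPartial Ω i p p') (hpe : ∀ᵐ x ∂volume.restrict Ω, p x = F (f x) * g x) :
    ∀ᵐ x ∂volume.restrict Ω, p' x = F' (f x) * f' x * g x + F (f x) * g' x := by
  have := ae_weakPartial_comp hΩ h hg hp (Ψ := fun q => F q.1 * q.2)
    (Ψ' := fun q => F q.1 • ContinuousLinearMap.snd ℝ ℝ ℝ +
      q.2 • (F' q.1 • ContinuousLinearMap.fst ℝ ℝ ℝ)) (O := O ×ˢ univ)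
    (fun q hq => ((hF q.1 hq.1).comp_hasFDerivAt q hasFDerivAt_fst).mul hasFDerivAt_snd)
    (hf.mono fun _ hx => ⟨hx, mem_univ _⟩) hpe
  refine this.mono fun x hx => ?_
  rw [hx]
  simp
  ring

theorem IsC1UpToBoundary.continuousOn {a : E n → ℝ} (h : IsC1UpToBoundary Ω a) :
    ContinuousOn a (closure Ω) := by
  obtain ⟨U, -, hΩU, a', ha', hae⟩ := h
  exact (ha'.continuousOn.mono hΩU).congr hae

/-- On `∂Ω` the function `a` itself may fail to be differentiable; the derivative of its extension
supplies continuous values there, hence bounds by compactness. -/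
theorem IsC1UpToBoundary.exists_fderiv {a : E n → ℝ} (h : IsC1UpToBoundary Ω a) (hΩ : IsOpen Ω)
    (v : E n) : ∃ b : E n → ℝ, ContinuousOn b (closure Ω) ∧ ∀ x ∈ Ω, fderiv ℝ a x v = b x := by
  obtain ⟨U, hU, hΩU, a', ha', hae⟩ := h
  refine ⟨fun x => fderiv ℝ a' x v, ?_, fun x hx => ?_⟩
  · exact ((ha'.continuousOn_fderiv_of_isOpen hU le_rfl).mono hΩU).clm_apply continuousOn_const
  · rw [Filter.EventuallyEq.fderiv_eq]
    filter_upwards [hΩ.mem_nhds hx] with y hy using hae (subset_closure hy)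

theorem IsC1UpToBoundary.weakDir_mul {a : E n → ℝ} (h : IsC1UpToBoundary Ω a) (hΩ : IsOpen Ω)
    (hb : Bornology.IsBounded Ω) {v : E n} (hf : WeakDir Ω v f g) :
    WeakDir Ω v (fun x => a x * f x) (fun x => a x * g x + f x * fderiv ℝ a x v) := by
  obtain ⟨U, hU, hΩU, a', ha', hae⟩ := h
  have hfd : ∀ x ∈ Ω, fderiv ℝ a x v = fderiv ℝ a' x v := fun x hx => by
    rw [Filter.EventuallyEq.fderiv_eq]
    filter_upwards [hΩ.mem_nhds hx] with y hy using hae (subset_closure hy)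
  obtain ⟨h1, h2, h3⟩ := hf.mul hΩ hb hU hΩU ha'
  refine ⟨h1.congr_fun (fun x hx => ?_) hΩ.measurableSet,
    h2.congr_fun (fun x hx => ?_) hΩ.measurableSet, fun φ c1 c2 c3 => ?_⟩
  · simp only [hae (subset_closure hx)]
  · simp only [hae (subset_closure hx), hfd x hx]
  · refine (setIntegral_congr_fun hΩ.measurableSet fun x hx => ?_).trans ((h3 φ c1 c2 c3).trans
      (congrArg Neg.neg (setIntegral_congr_fun hΩ.measurableSet fun x hx => ?_)))
    · simp only [hae (subset_closure hx)]
    · simp only [hae (subset_closure hx), hfd x hx]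

theorem integrableOn_mul_of_continuousOn_closure {a : E n → ℝ} (ha : ContinuousOn a (closure Ω))
    (hΩ : IsOpen Ω) (hb : Bornology.IsBounded Ω) (hf : IntegrableOn f Ω) :
    IntegrableOn (fun x => a x * f x) Ω :=
  hf.continuousOn_mul_of_subset ha hb.isCompact_closure hΩ.measurableSet subset_closure

end

section

/-! ### The divergence theorem for `A ∇w` -/

variable {m : ℕ} {Ω : Set (E (m + 1))} {A : E (m + 1) → Matrix (Fin (m + 1)) (Fin (m + 1)) ℝ}
  {c C : ℝ} {w : E (m + 1) → ℝ}

theorem IsBoundedLipschitzDomain.ae_conormal (hΩ : IsBoundedLipschitzDomain Ω)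
    (hw : MemW1 Ω 2 w) : ∀ᵐ x ∂(μHE[m] : Measure (E (m + 1))).restrict (frontier Ω),
      (∃ ν, IsOuterNormal Ω x ν) ∧
        ∀ j, HasTrace Ω (weakPartial Ω j w) x (trace Ω (weakPartial Ω j w) x) := by
  rw [ae_restrict_iff' isClosed_frontier.measurableSet]
  have : ∀ j, ∀ᵐ x ∂(μHE[m] : Measure (E (m + 1))), x ∈ frontier Ω →
      (∃ ν, IsOuterNormal Ω x ν) ∧
        HasTrace Ω (weakPartial Ω j w) x (trace Ω (weakPartial Ω j w) x) := fun j =>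
    hΩ.ae_hasTrace fun i => (hw.weakPartial hΩ.isOpen j).2.weakDir hΩ.isOpen i
  filter_upwards [ae_all_iff.2 this] with x hx hxf
  exact ⟨(hx 0 hxf).1, fun j => (hx j hxf).2⟩

theorem IsBoundedLipschitzDomain.ae_conormalDefinedAt (hΩ : IsBoundedLipschitzDomain Ω)
    (hw : MemW1 Ω 2 w) : ∀ᵐ x ∂(μHE[m] : Measure (E (m + 1))).restrict (frontier Ω),
      ConormalDefinedAt Ω w x := by
  filter_upwards [hΩ.ae_conormal hw, ae_restrict_mem isClosed_frontier.measurableSet]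
    with x hx hxf
  refine ⟨hx.1, fun j => ?_⟩
  rw [(hx.2 j).canonicalValue_eq hΩ.isOpen (hw.weakPartial hΩ.isOpen j).2.integrableOn
    (frontier_subset_closure hxf)]
  exact ⟨EReal.coe_ne_top _, EReal.coe_ne_bot _⟩

/-- The boundary integral of a single term of the conormal derivative. -/
theorem IsBoundedLipschitzDomain.integral_entry (hm : 0 < m) (hΩ : IsBoundedLipschitzDomain Ω)
    {a : E (m + 1) → ℝ} (ha : IsC1UpToBoundary Ω a) (hw : MemW1 Ω 2 w) (i j : Fin (m + 1)) :
    IntegrableOn (fun x => outerNormal Ω x i * (a x * traceGrad Ω w x j)) (frontier Ω) μHE[m] ∧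
      ∫ x in Ω, (a x * weakPartial Ω i (weakPartial Ω j w) x +
          weakPartial Ω j w x * fderiv ℝ a x (EuclideanSpace.single i 1)) =
        ∫ x in frontier Ω, outerNormal Ω x i * (a x * traceGrad Ω w x j) ∂μHE[m] := by
  have hwj := (hw.weakPartial hΩ.isOpen j).2
  -- The scalar theorem is applied to `a ∂ⱼw` in the direction of the `i`-th axis.
  have hd := fun k => ha.weakDir_mul hΩ.isOpen hΩ.isBounded (hwj.weakDir hΩ.isOpen k)
  obtain ⟨h1, h2⟩ := hΩ.integral_weakDir hm hd (EuclideanSpace.single i 1)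
  have hae : (fun x => trace Ω (fun x => a x * weakPartial Ω j w x) x *
      inner ℝ (outerNormal Ω x) (EuclideanSpace.single i 1)) =ᵐ[
        (μHE[m] : Measure (E (m + 1))).restrict (frontier Ω)]
      fun x => outerNormal Ω x i * (a x * traceGrad Ω w x j) := by
    filter_upwards [hΩ.ae_conormal hw, ae_restrict_mem isClosed_frontier.measurableSet]
      with x hx hxf
    have hxc := frontier_subset_closure hxf
    rw [((hx.2 j).mul hΩ.isOpen.measurableSet
      ((ha.continuousOn x hxc).mono subset_closure)).trace_eq hΩ.isOpen (hd 0).1 hxc,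
      EuclideanSpace.inner_single_right]
    simp [traceGrad, trace]
    ring
  refine ⟨h1.congr hae, ?_⟩
  rw [← integral_congr_ae hae, ← h2]
  refine setIntegral_congr_fun hΩ.isOpen.measurableSet fun x _ => ?_
  simp

theorem conormalDeriv_eq_sum (A : E (m + 1) → Matrix (Fin (m + 1)) (Fin (m + 1)) ℝ)
    (w : E (m + 1) → ℝ) (x : E (m + 1)) : conormalDeriv Ω A w x =
      ∑ i, ∑ j, outerNormal Ω x i * (A x i j * traceGrad Ω w x j) := by
  simp [conormalDeriv, dotProduct, Matrix.mulVec, Finset.mul_sum]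

/-- The divergence of `A ∇w` differentiates `aᵢⱼ` in `xᵢ`, the row divergence in `xⱼ`; symmetry of
`A` near the point reconciles them. -/
theorem IsUniformlyElliptic.inner_matDiv (hA : IsUniformlyElliptic Ω A c C) (hΩ : IsOpen Ω)
    {x : E (m + 1)} (hx : x ∈ Ω) (y : E (m + 1)) : inner ℝ (matDiv A x) y =
      ∑ i, ∑ j, y j * fderiv ℝ (fun z => A z i j) x (EuclideanSpace.single i 1) := by
  rw [Finset.sum_comm, PiLp.inner_apply]
  refine Finset.sum_congr rfl fun j _ => ?_
  simp only [matDiv, RCLike.inner_apply, conj_trivial, Finset.mul_sum]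
  refine Finset.sum_congr rfl fun i _ => ?_
  rw [Filter.EventuallyEq.fderiv_eq (f := fun z => A z i j)]
  filter_upwards [hΩ.mem_nhds hx] with z hz using (hA.symm z (subset_closure hz)).apply i j

theorem IsUniformlyElliptic.integrableOn_hessian (hA : IsUniformlyElliptic Ω A c C)
    (hΩ : IsBoundedLipschitzDomain Ω) (hw : MemW1 Ω 2 w) :
    IntegrableOn (fun x => ∑ i, ∑ j, A x i j * weakPartial Ω i (weakPartial Ω j w) x) Ω :=
  integrable_finsetSum _ fun i _ => integrable_finsetSum _ fun j _ =>
    integrableOn_mul_of_continuousOn_closure (hA.c1 i j).continuousOn hΩ.isOpen hΩ.isBounded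
      ((hw.weakPartial hΩ.isOpen j).2.weakPartial hΩ.isOpen i).2

theorem IsUniformlyElliptic.integrableOn_entry_fderiv (hA : IsUniformlyElliptic Ω A c C)
    (hΩ : IsBoundedLipschitzDomain Ω) (hw : MemW1 Ω 2 w) (i j : Fin (m + 1)) :
    IntegrableOn (fun x => weakPartial Ω j w x *
      fderiv ℝ (fun z => A z i j) x (EuclideanSpace.single i 1)) Ω := by
  obtain ⟨b, hb, hbe⟩ := (hA.c1 i j).exists_fderiv hΩ.isOpen (EuclideanSpace.single i 1)
  refine (integrableOn_mul_of_continuousOn_closure hb hΩ.isOpen hΩ.isBounded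
    (hw.weakPartial hΩ.isOpen j).2.integrableOn).congr_fun (fun x hx => ?_)
    hΩ.isOpen.measurableSet
  simp only [hbe x hx, mul_comm]

theorem IsUniformlyElliptic.integrableOn_matDiv (hA : IsUniformlyElliptic Ω A c C)
    (hΩ : IsBoundedLipschitzDomain Ω) (hw : MemW1 Ω 2 w) :
    IntegrableOn (fun x => inner ℝ (matDiv A x) (weakGrad Ω w x)) Ω := by
  refine IntegrableOn.congr_fun (f := fun x => ∑ i, ∑ j, weakPartial Ω j w x *
      fderiv ℝ (fun z => A z i j) x (EuclideanSpace.single i 1)) ?_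
    (fun x hx => by simp only [hA.inner_matDiv hΩ.isOpen hx]; rfl) hΩ.isOpen.measurableSet
  exact integrable_finsetSum _ fun i _ => integrable_finsetSum _ fun j _ =>
    hA.integrableOn_entry_fderiv hΩ hw i j

theorem IsUniformlyElliptic.integrableOn_conormalDeriv (hm : 0 < m)
    (hA : IsUniformlyElliptic Ω A c C) (hΩ : IsBoundedLipschitzDomain Ω) (hw : MemW1 Ω 2 w) :
    IntegrableOn (conormalDeriv Ω A w) (frontier Ω) μHE[m] := by
  rw [funext (conormalDeriv_eq_sum A w)]
  exact integrable_finsetSum _ fun i _ => integrable_finsetSum _ fun j _ =>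
    (hΩ.integral_entry hm (hA.c1 i j) hw i j).1

/-- The divergence theorem for the field `A ∇w` with `w ∈ W^{2,1}(Ω)`. -/
theorem IsUniformlyElliptic.integral_add_integral_matDiv (hm : 0 < m)
    (hA : IsUniformlyElliptic Ω A c C) (hΩ : IsBoundedLipschitzDomain Ω) (hw : MemW1 Ω 2 w) :
    (∫ x in Ω, ∑ i, ∑ j, A x i j * weakPartial Ω i (weakPartial Ω j w) x) +
        ∫ x in Ω, inner ℝ (matDiv A x) (weakGrad Ω w x) =
      boundaryTerm Ω A w := by
  rw [← integral_add (hA.integrableOn_hessian hΩ hw) (hA.integrableOn_matDiv hΩ hw)]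
  have h1 : ∫ x in Ω, ((∑ i, ∑ j, A x i j * weakPartial Ω i (weakPartial Ω j w) x) +
      inner ℝ (matDiv A x) (weakGrad Ω w x)) = ∫ x in Ω, ∑ i, ∑ j,
        (A x i j * weakPartial Ω i (weakPartial Ω j w) x + weakPartial Ω j w x *
          fderiv ℝ (fun z => A z i j) x (EuclideanSpace.single i 1)) := by
    refine setIntegral_congr_fun hΩ.isOpen.measurableSet fun x hx => ?_
    simp only [hA.inner_matDiv hΩ.isOpen hx, Finset.sum_add_distrib]
    rfl
  have hinteg : ∀ i j, IntegrableOn (fun x => A x i j * weakPartial Ω i (weakPartial Ω j w) x +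
      weakPartial Ω j w x * fderiv ℝ (fun z => A z i j) x (EuclideanSpace.single i 1)) Ω :=
    fun i j => (integrableOn_mul_of_continuousOn_closure (hA.c1 i j).continuousOn hΩ.isOpen
      hΩ.isBounded ((hw.weakPartial hΩ.isOpen j).2.weakPartial hΩ.isOpen i).2).add
        (hA.integrableOn_entry_fderiv hΩ hw i j)
  have hbd := fun i j => hΩ.integral_entry hm (hA.c1 i j) hw i j
  rw [h1, boundaryTerm, Nat.add_sub_cancel]
  simp only [conormalDeriv_eq_sum]
  rw [integral_finsetSum _ fun i _ => integrable_finsetSum _ fun j _ => hinteg i j,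
    integral_finsetSum _ fun i _ => integrable_finsetSum _ fun j _ => (hbd i j).1]
  refine Finset.sum_congr rfl fun i _ => ?_
  rw [integral_finsetSum _ fun j _ => hinteg i j, integral_finsetSum _ fun j _ => (hbd i j).1]
  exact Finset.sum_congr rfl fun j _ => (hbd i j).2

end

section

/-! ### The chain rule and the inequalities -/

variable {n : ℕ} {Ω : Set (E n)} {A : E n → Matrix (Fin n) (Fin n) ℝ} {c C : ℝ}
  {O : Set ℝ} {h H Ht : ℝ → ℝ} {u : E n → ℝ}

theorem IsUniformlyElliptic.matNorm_sq (hA : IsUniformlyElliptic Ω A c C) {x : E n}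
    (hx : x ∈ closure Ω) (y : E n) :
    matNorm (A x) y ^ 2 = ∑ i, ∑ j, A x i j * (y i * y j) := by
  rw [matNorm, Real.sq_sqrt ((mul_nonneg hA.c_pos.le (sq_nonneg _)).trans (hA.lower x hx y))]
  simp only [dotProduct, Matrix.mulVec, Finset.mul_sum]
  exact Finset.sum_congr rfl fun i _ => Finset.sum_congr rfl fun j _ => by ring

theorem IsUniformlyElliptic.le_matNorm_sq (hA : IsUniformlyElliptic Ω A c C) {x : E n}
    (hx : x ∈ closure Ω) (y : E n) : c * ‖y‖ ^ 2 ≤ matNorm (A x) y ^ 2 := by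
  rw [matNorm, Real.sq_sqrt ((mul_nonneg hA.c_pos.le (sq_nonneg _)).trans (hA.lower x hx y))]
  exact hA.lower x hx y

theorem ae_weakPartial_primitive (hΩ : IsOpen Ω) (hu : MemW1Loc Ω 2 u)
    (hO : ∀ᵐ x ∂volume.restrict Ω, u x ∈ O) (hHt : ∀ s ∈ O, HasDerivAt Ht (H s) s)
    (hw : MemW1 Ω 2 fun x => Ht (u x)) : ∀ᵐ x ∂volume.restrict Ω, ∀ j,
      weakPartial Ω j (fun x => Ht (u x)) x = H (u x) * weakPartial Ω j u x :=
  ae_all_iff.2 fun j =>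
    ae_weakPartial_comp_one hΩ hHt hO (hu.weakPartial hΩ j).1 (hw.weakPartial hΩ j).1

theorem ae_weakPartial_weakPartial_primitive (hΩ : IsOpen Ω) (hu : MemW1Loc Ω 2 u)
    (hO : ∀ᵐ x ∂volume.restrict Ω, u x ∈ O) (hH : ∀ s ∈ O, HasDerivAt H (h s) s)
    (hHt : ∀ s ∈ O, HasDerivAt Ht (H s) s) (hw : MemW1 Ω 2 fun x => Ht (u x)) :
    ∀ᵐ x ∂volume.restrict Ω, ∀ i j, weakPartial Ω i (weakPartial Ω j fun x => Ht (u x)) x =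
      h (u x) * weakPartial Ω i u x * weakPartial Ω j u x +
        H (u x) * weakPartial Ω i (weakPartial Ω j u) x :=
  ae_all_iff.2 fun i => ae_all_iff.2 fun j =>
    ae_weakPartial_comp_mul hΩ hH hO (hu.weakPartial hΩ i).1
      ((hu.weakPartial hΩ j).2.weakPartial hΩ i).1 ((hw.weakPartial hΩ j).2.weakPartial hΩ i).1
      ((ae_weakPartial_primitive hΩ hu hO hHt hw).mono fun _ hx => hx j)

/-- The Hessian of `Ht(u)` is `h(u) ∇u ⊗ ∇u + H(u) D²u`; contraction with `A` splits it into the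
energy density and `Pu H(u)`. -/
theorem IsUniformlyElliptic.ae_matNorm_sq_mul (hA : IsUniformlyElliptic Ω A c C) (hΩ : IsOpen Ω)
    (hu : MemW1Loc Ω 2 u) (hO : ∀ᵐ x ∂volume.restrict Ω, u x ∈ O)
    (hH : ∀ s ∈ O, HasDerivAt H (h s) s) (hHt : ∀ s ∈ O, HasDerivAt Ht (H s) s)
    (hw : MemW1 Ω 2 fun x => Ht (u x)) : ∀ᵐ x ∂volume.restrict Ω,
      (∑ i, ∑ j, A x i j * weakPartial Ω i (weakPartial Ω j fun x => Ht (u x)) x) -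
        ellipticOp Ω A u x * H (u x) = matNorm (A x) (weakGrad Ω u x) ^ 2 * h (u x) := by
  filter_upwards [ae_weakPartial_weakPartial_primitive hΩ hu hO hH hHt hw,
    ae_restrict_mem hΩ.measurableSet] with x hx hxΩ
  simp only [hx, hA.matNorm_sq (subset_closure hxΩ), ellipticOp, Finset.sum_mul, weakGrad,
    ← Finset.sum_sub_distrib]
  exact Finset.sum_congr rfl fun i _ => Finset.sum_congr rfl fun j _ => by ring

theorem ae_inner_weakGrad_primitive (hΩ : IsOpen Ω) (hu : MemW1Loc Ω 2 u)
    (hO : ∀ᵐ x ∂volume.restrict Ω, u x ∈ O) (hHt : ∀ s ∈ O, HasDerivAt Ht (H s) s)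
    (hw : MemW1 Ω 2 fun x => Ht (u x)) (b : E n → E n) : ∀ᵐ x ∂volume.restrict Ω,
      inner ℝ (b x) (weakGrad Ω (fun x => Ht (u x)) x) =
        inner ℝ (b x) (weakGrad Ω u x) * H (u x) := by
  filter_upwards [ae_weakPartial_primitive hΩ hu hO hHt hw] with x hx
  have : weakGrad Ω (fun x => Ht (u x)) x = H (u x) • weakGrad Ω u x := by
    ext j
    simp [weakGrad, hx]
  rw [this, inner_smul_right, mul_comm]

theorem IsUniformlyElliptic.exists_norm_matDiv_le (hA : IsUniformlyElliptic Ω A c C)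
    (hΩ : IsOpen Ω) (hb : Bornology.IsBounded Ω) : ∃ M, ∀ x ∈ Ω, ‖matDiv A x‖ ≤ M := by
  choose b hb' hbe using fun i j =>
    (hA.c1 i j).exists_fderiv hΩ (EuclideanSpace.single j 1)
  have hcont : ContinuousOn (fun x => (WithLp.toLp 2 fun i => ∑ j, b i j x : E n)) (closure Ω) :=
    (PiLp.continuous_toLp 2 _).comp_continuousOn
      (continuousOn_pi.2 fun i => continuousOn_finsetSum _ fun j _ => hb' i j)
  obtain ⟨M, hM⟩ := hb.isCompact_closure.exists_bound_of_continuousOn hcont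
  refine ⟨M, fun x hx => ?_⟩
  have hx' : matDiv A x = WithLp.toLp 2 fun i => ∑ j, b i j x := by
    simp only [matDiv, hbe _ _ x hx]
  exact hx' ▸ hM x (subset_closure hx)

theorem IsUniformlyElliptic.ae_norm_matDiv_le (hA : IsUniformlyElliptic Ω A c C)
    (hΩ : IsOpen Ω) (hb : Bornology.IsBounded Ω) : ∀ᵐ x ∂volume.restrict Ω,
      ‖matDiv A x‖ ≤ (eLpNorm (matDiv A) ⊤ (volume.restrict Ω)).toReal := by
  obtain ⟨M, hM⟩ := hA.exists_norm_matDiv_le hΩ hb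
  -- Without finiteness `toReal` would return 0 and the bound would carry no meaning.
  have hfin : eLpNorm (matDiv A) ⊤ (volume.restrict Ω) ≠ ⊤ := by
    rw [eLpNorm_exponent_top]
    exact (eLpNormEssSup_lt_top_of_ae_bound
      ((ae_restrict_mem hΩ.measurableSet).mono fun x hx => hM x hx)).ne
  rw [eLpNorm_exponent_top] at hfin ⊢
  filter_upwards [ae_le_eLpNormEssSup (f := matDiv A) (μ := volume.restrict Ω)] with x hx
  simpa using ENNReal.toReal_mono hfin hx

/-- The difference of the two sides is the square `(c p t - M|s|)² / (c t)`. -/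
theorem two_mul_abs_mul_le {M c t s p : ℝ} (hc : 0 < c) (ht : 0 < t) :
    2 * (M * p * |s|) ≤ c * p ^ 2 * t + M ^ 2 * c⁻¹ * (s ^ 2 / t) := by
  have h1 : c * p ^ 2 * t + M ^ 2 * c⁻¹ * (s ^ 2 / t) - 2 * (M * p * |s|) =
      (c * p * t - M * |s|) ^ 2 / (c * t) := by
    rw [← sq_abs s]
    field_simp
    ring
  have : 0 ≤ (c * p * t - M * |s|) ^ 2 / (c * t) := by positivity
  linarith

/-- Young's inequality for the first-order term. -/
theorem IsUniformlyElliptic.ae_two_mul_abs_inner_le (hA : IsUniformlyElliptic Ω A c C)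
    (hΩ : IsOpen Ω) (hb : Bornology.IsBounded Ω) (hO : ∀ᵐ x ∂volume.restrict Ω, u x ∈ O)
    (h_pos : ∀ s ∈ O, 0 < h s) (y : E n → E n) : ∀ᵐ x ∂volume.restrict Ω,
      2 * |inner ℝ (matDiv A x) (y x) * H (u x)| ≤
        matNorm (A x) (y x) ^ 2 * h (u x) + dConst Ω A c * gTransform h H (u x) := by
  filter_upwards [hA.ae_norm_matDiv_le hΩ hb, hO, ae_restrict_mem hΩ.measurableSet]
    with x hx hxO hxΩ
  have ht := h_pos _ hxO
  rw [abs_mul]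
  calc 2 * (|inner ℝ (matDiv A x) (y x)| * |H (u x)|)
      ≤ 2 * ((eLpNorm (matDiv A) ⊤ (volume.restrict Ω)).toReal * ‖y x‖ * |H (u x)|) := by
        gcongr
        exact (abs_real_inner_le_norm _ _).trans (by gcongr)
    _ ≤ c * ‖y x‖ ^ 2 * h (u x) + dConst Ω A c * gTransform h H (u x) :=
        two_mul_abs_mul_le hA.c_pos ht
    _ ≤ _ := by
        gcongr
        exact hA.le_matNorm_sq (subset_closure hxΩ) _

/-- Absorption: `2∫q ≤ 2∫|F| + R ≤ ∫q + d∫G + R`, and the finite number `∫q` is subtracted. -/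
theorem coe_integral_le_of_two_mul_abs_le {q F G : E n → ℝ} {d R : ℝ}
    (hq : IntegrableOn q Ω) (hF : IntegrableOn F Ω) (hd : 0 ≤ d)
    (hle : ∀ᵐ x ∂volume.restrict Ω, 2 * |F x| ≤ q x + d * G x)
    (hq0 : ∀ᵐ x ∂volume.restrict Ω, 0 ≤ q x)
    (hR : 2 * ∫ x in Ω, q x ≤ 2 * (∫ x in Ω, |F x|) + R) :
    ((∫ x in Ω, q x : ℝ) : EReal) ≤
      ((ENNReal.ofReal d * ∫⁻ x in Ω, ENNReal.ofReal (G x) : ℝ≥0∞) : EReal) + (R : EReal) := by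
  set K : ℝ≥0∞ := ENNReal.ofReal d * ∫⁻ x in Ω, ENNReal.ofReal (G x) with hK
  -- An infinite right side leaves nothing to prove. Since `0 * ⊤ = 0`, the case `d = 0` belongs to
  -- the finite branch even if `∫G` diverges.
  by_cases hKt : K = ⊤
  · rw [hKt, EReal.coe_ennreal_top, EReal.top_add_coe]
    exact le_top
  have hF2 : IntegrableOn (fun x => 2 * |F x|) Ω := hF.abs.const_mul 2
  have key : ENNReal.ofReal (∫ x in Ω, 2 * |F x|) ≤ ENNReal.ofReal (∫ x in Ω, q x) + K := by
    rw [ofReal_integral_eq_lintegral_ofReal hF2 (ae_of_all _ fun x => by positivity),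
      ofReal_integral_eq_lintegral_ofReal hq hq0, hK,
      ← lintegral_const_mul' _ _ ENNReal.ofReal_ne_top,
      ← lintegral_add_left' hq.aestronglyMeasurable.aemeasurable.ennreal_ofReal]
    refine lintegral_mono_ae (hle.mono fun x hx => ?_)
    rw [← ENNReal.ofReal_mul hd]
    exact (ENNReal.ofReal_le_ofReal hx).trans ENNReal.ofReal_add_le
  have hQ : 0 ≤ ∫ x in Ω, q x := integral_nonneg_of_ae hq0
  have hKr : K = ENNReal.ofReal K.toReal := (ENNReal.ofReal_toReal hKt).symm
  rw [hKr, ← ENNReal.ofReal_add hQ ENNReal.toReal_nonneg,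
    ENNReal.ofReal_le_ofReal_iff (add_nonneg hQ ENNReal.toReal_nonneg),
    integral_const_mul] at key
  rw [hKr, EReal.coe_ennreal_ofReal, max_eq_left ENNReal.toReal_nonneg, ← EReal.coe_add,
    EReal.coe_le_coe_iff]
  linarith

end

end EllipticIdentity

end

/-! ### The identity and the inequalities -/

theorem theorem3p1 {n : ℕ} (hn : 2 ≤ n)
    (Ω : Set (E n)) (hΩ : IsBoundedLipschitzDomain Ω)
    (A : E n → Matrix (Fin n) (Fin n) ℝ) (c C : ℝ) (hA : IsUniformlyElliptic Ω A c C)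
    (B : EReal) (hB : 0 < B)
    (h H Ht : ℝ → ℝ)
    (h_cont : ContinuousOn h (openInterval B)) (h_pos : ∀ s ∈ openInterval B, 0 < h s)
    (hH : ∀ s ∈ openInterval B, HasDerivAt H (h s) s)
    (hHt : ∀ s ∈ openInterval B, HasDerivAt Ht (H s) s)
    (u : E n → ℝ) (hu : MemW1Loc Ω 2 u)
    (hu_range : ∀ᵐ x ∂volume.restrict Ω, u x ∈ openInterval B)
    (hu_Ht : MemW1 Ω 2 fun x => Ht (u x))
    (hu_P : IntegrableOn (fun x => ellipticOp Ω A u x * H (u x)) Ω) :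
    -- the identity, and convergence of all the integrals in it
    (IntegrableOn (fun x => matNorm (A x) (weakGrad Ω u x) ^ 2 * h (u x)) Ω ∧
      IntegrableOn (fun x => ellipticOp Ω A u x * H (u x)) Ω ∧
      IntegrableOn (fun x => inner ℝ (matDiv A x) (weakGrad Ω u x) * H (u x)) Ω ∧
      (∀ᵐ x ∂(μHE[n - 1] : Measure (E n)).restrict (frontier Ω),
        ConormalDefinedAt Ω (fun x => Ht (u x)) x) ∧
      IntegrableOn (conormalDeriv Ω A fun x => Ht (u x)) (frontier Ω) μHE[n - 1] ∧
      (∫ x in Ω, matNorm (A x) (weakGrad Ω u x) ^ 2 * h (u x)) =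
        -(∫ x in Ω, ellipticOp Ω A u x * H (u x))
          - (∫ x in Ω, inner ℝ (matDiv A x) (weakGrad Ω u x) * H (u x))
          + boundaryTerm Ω A fun x => Ht (u x)) ∧
    -- the inequality for `div A ≡ 0`
    ((∀ x ∈ Ω, matDiv A x = 0) →
      (∫ x in Ω, matNorm (A x) (weakGrad Ω u x) ^ 2 * h (u x)) ≤
        (∫ x in Ω, |ellipticOp Ω A u x| * |H (u x)|)
          + boundaryTerm Ω A fun x => Ht (u x)) ∧
    -- the general inequality; the integral of `G_H(u)` may be infinite
    ((∫ x in Ω, matNorm (A x) (weakGrad Ω u x) ^ 2 * h (u x) : ℝ) : EReal) ≤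
      ((ENNReal.ofReal (dConst Ω A c) *
          ∫⁻ x in Ω, ENNReal.ofReal (gTransform h H (u x)) : ℝ≥0∞) : EReal)
        + ((2 * (∫ x in Ω, |ellipticOp Ω A u x| * |H (u x)|)
          + 2 * boundaryTerm Ω A fun x => Ht (u x) : ℝ) : EReal) := by
  obtain ⟨m, rfl⟩ : ∃ m, n = m + 1 := ⟨n - 1, by omega⟩
  have hm : 0 < m := by omega
  have hquad := hA.ae_matNorm_sq_mul hΩ.isOpen hu hu_range hH hHt hu_Ht
  have hdiv := ae_inner_weakGrad_primitive hΩ.isOpen hu hu_range hHt hu_Ht (matDiv A)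
  have hhess := hA.integrableOn_hessian hΩ hu_Ht
  -- The energy density equals a difference of two integrable functions almost everywhere, so its
  -- integrability need not be assumed.
  have hq : IntegrableOn (fun x => matNorm (A x) (weakGrad Ω u x) ^ 2 * h (u x)) Ω :=
    (hhess.sub hu_P).congr hquad
  have hF : IntegrableOn (fun x => inner ℝ (matDiv A x) (weakGrad Ω u x) * H (u x)) Ω :=
    (hA.integrableOn_matDiv hΩ hu_Ht).congr hdiv
  have hid : (∫ x in Ω, matNorm (A x) (weakGrad Ω u x) ^ 2 * h (u x)) =
      -(∫ x in Ω, ellipticOp Ω A u x * H (u x))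
        - (∫ x in Ω, inner ℝ (matDiv A x) (weakGrad Ω u x) * H (u x))
        + boundaryTerm Ω A fun x => Ht (u x) := by
    rw [← hA.integral_add_integral_matDiv hm hΩ hu_Ht, ← integral_congr_ae hquad,
      integral_sub hhess hu_P, ← integral_congr_ae hdiv]
    ring
  have hP : -(∫ x in Ω, ellipticOp Ω A u x * H (u x)) ≤
      ∫ x in Ω, |ellipticOp Ω A u x| * |H (u x)| := by
    simp only [← abs_mul]
    exact (neg_le_abs _).trans abs_integral_le_integral_abs
  refine ⟨⟨hq, hu_P, hF, hΩ.ae_conormalDefinedAt hu_Ht,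
    hA.integrableOn_conormalDeriv hm hΩ hu_Ht, hid⟩, fun hz => ?_, ?_⟩
  · have hF0 : ∫ x in Ω, inner ℝ (matDiv A x) (weakGrad Ω u x) * H (u x) = 0 :=
      setIntegral_eq_zero_of_forall_eq_zero fun x hx => by rw [hz x hx, inner_zero_left, zero_mul]
    linarith
  -- The doubled identity provides the last hypothesis, with `R` equal to twice `∫|Pu||H(u)| + Θ`.
  · refine coe_integral_le_of_two_mul_abs_le hq hF
      (mul_nonneg (sq_nonneg _) (inv_nonneg.2 hA.c_pos.le))
      (hA.ae_two_mul_abs_inner_le hΩ.isOpen hΩ.isBounded hu_range h_pos _)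
      (hu_range.mono fun x hx => mul_nonneg (sq_nonneg _) (h_pos _ hx).le) ?_
    have hF' : -(∫ x in Ω, inner ℝ (matDiv A x) (weakGrad Ω u x) * H (u x)) ≤
        ∫ x in Ω, |inner ℝ (matDiv A x) (weakGrad Ω u x) * H (u x)| :=
      (neg_le_abs _).trans abs_integral_le_integral_abs
    linarith
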